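/- **Setting.** Let $n\ge 1$ and let $(M^{2n+1},J,\theta)$ be a strictly pseudoconvex pseudohermitian manifold: $\theta$ is a contact form, $J$ is a formally integrable complex structure on $H=\ker\theta$, and $d\theta(X,JX)>0$ for $0\ne X\in H$. Let $T$ be the Reeb field ($\theta(T)=1$, $d\theta(T,\cdot)=0$), and, on an open set, let $\{\theta^\alpha\}_{\alpha=1}^n$ be an admissible coframe, with $\{T,Z_\alpha,Z_{\bar\alpha}\}$ the frame dual to $\{\theta,\theta^\alpha,\theta^{\bar\alpha}\}$ and $Z_\alpha\in T^{1,0}$. Write $d\theta=ih_{\alpha\bar\beta}\theta^\alpha\wedge\theta^{\bar\beta}$ and raise and lower indices with $h$. The Tanaka--Webster connection forms $\omega_\alpha{}^\beta$ and the torsion $A_{\alpha\beta}$ are defined by $$d\theta^\beta=\theta^\alpha\wedge\omega_\alpha{}^\beta+\theta\wedge A^\beta{}_{\bar\gamma}\theta^{\bar\gamma},\qquad \omega_{\alpha\bar\beta}+\omega_{\bar\beta\alpha}=dh_{\alpha\bar\beta},\qquad A_{\alpha\beta}=A_{\beta\alpha};$$ $\nabla$ is the associated covariant derivative and $\nabla_0$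 is the derivative along $T$. The curvature is $R_\alpha{}^\beta{}_{\gamma\bar\delta}=(d\omega_\alpha{}^\beta-\omega_\alpha{}^\mu\wedge\omega_\mu{}^\beta)(Z_\gamma,Z_{\bar\delta})$; put $R_{\alpha\bar\beta}=R_\gamma{}^\gamma{}_{\alpha\bar\beta}$, $R=R_\alpha{}^\alpha$ (Webster scalar curvature), $P_{\alpha\bar\beta}=\frac1{n+2}\bigl(R_{\alpha\bar\beta}-\frac{1}{2(n+1)}Rh_{\alpha\bar\beta}\bigr)$, $P=P_\alpha{}^\alpha$, $\mathring P_{\alpha\bar\beta}=P_{\alpha\bar\beta}-\frac Pn h_{\alpha\bar\beta}$, $W_\alpha=\nabla_\alpha R-i\nabla^\beta A_{\alpha\beta}$, and $\Delta_b=-(\nabla^\alpha\nabla_\alpha+\nabla_\alpha\nabla^\alpha)$. A real function $f\in C^\infty(M)$ is CR pluriharmonic if locally it is the real part of a CR function, i.e. of a smooth $v$ with $\nabla_{\bar\alpha}v=0$. The CR Paneitz operator is $$P_4f=\Delta_b^2f+\nabla_0^2f-4\operatorname{Im}\nabla^\alpha(A_{\alpha\beta}\nabla^\beta f)+4\operatorname{Re}\nabla_{\bar\beta}(\mathring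 P^{\alpha\bar\beta}\nabla_\alpha f)-\tfrac{4(n^2-1)}{n}\operatorname{Re}\nabla^\beta(P\nabla_\beta f)+\tfrac{n-1}{2}Q_4f,$$ $$Q_4=\tfrac{2(n+1)^2}{n(n+2)}\Delta_bP-\tfrac{4}{n(n+2)}\operatorname{Im}\nabla^\alpha\nabla^\beta A_{\alpha\beta}-\tfrac{2(n-1)}{n}|A_{\alpha\beta}|^2-\tfrac{2(n+1)}{n}|\mathring P_{\alpha\bar\beta}|^2+\tfrac{2(n-1)(n+1)^2}{n^2}P^2 .$$ For a real number $\nu>0$ put $$\begin{aligned}\mathcal P_\nu f={}&\tfrac{2(\nu+1)}{\nu^2}\Delta_b^2f-\tfrac8\nu\operatorname{Im}\nabla^\alpha(A_{\alpha\beta}\nabla^\beta f)-\tfrac{8(\nu+1)}{\nu}\operatorname{Re}\nabla^\alpha(P\nabla_\alpha f)\\&+\tfrac{16(\nu+1)}{\nu(\nu+2)}\operatorname{Re}\Bigl(\bigl(\nabla_\alpha P-\tfrac{i\nu}{2(\nu+1)}\nabla^\beta A_{\alpha\beta}\bigr)\nabla^\alpha f\Bigr)+\Bigl[\tfrac{2(\nu+1)^2}{\nu(\nu+2)}\Delta_bP-\tfrac{4}{\nu(\nu+2)}\operatorname{Im}\nabla^\alpha\nabla^\beta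 A_{\alpha\beta}\\&\quad-\tfrac{2(\nu-1)}{\nu}|A_{\alpha\beta}|^2-\tfrac{2(\nu+1)}{\nu}|\mathring P_{\alpha\bar\beta}|^2+\tfrac{2(\nu-1)(\nu+1)^2}{\nu^2}P^2\Bigr]f .\end{aligned}$$ **Lemma.** Let $f$ be CR pluriharmonic on $(M^{2n+1},J,\theta)$. In every local admissible frame: 1. If $n\ge2$, then the $P'$-operator $P_4'f:=\frac{2}{n-1}P_4f$ is given by $P_4'f=\mathcal P_n f$. 2. The expression $\mathcal P_\nu f$ is rational in the dimensional parameter without a pole at $1$: it is a linear combination of the operators $\Delta_b^2f$, $\operatorname{Im}\nabla^\alpha(A_{\alpha\beta}\nabla^\beta f)$, $\operatorname{Re}\nabla^\alpha(P\nabla_\alpha f)$, $\operatorname{Re}(\nabla_\alpha P\,\nabla^\alpha f)$, $\operatorname{Re}(i\nabla^\beta A_{\alpha\beta}\nabla^\alpha f)$, $(\Delta_bP)f$, $(\operatorname{Im}\nabla^\alpha\nabla^\beta A_{\alpha\beta})f$, $|A_{\alpha\beta}|^2f$, $|\mathring P_{\alpha\bar\beta}|^2f$, $P^2f$, whose coefficients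 are universal rational functions of $\nu$ that are regular at $\nu=1$. 3. If $n=1$, then the critical $P'$-operator, defined as the formal limit $P_4'f:=\lim_{\nu\to1}\mathcal P_\nu f$ of this expression (with the geometric quantities those of the three-manifold), exists and equals $$P_4'f=4\Delta_b^2f-8\operatorname{Im}\nabla^\alpha(A_{\alpha\beta}\nabla^\beta f)-4\operatorname{Re}\nabla^\alpha(R\nabla_\alpha f)+\tfrac83\operatorname{Re}(W_\alpha\nabla^\alpha f)+\tfrac23\bigl(\Delta_bR-2\operatorname{Im}\nabla^\alpha\nabla^\beta A_{\alpha\beta}\bigr)f .$$ -/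

import Mathlib

open scoped Manifold ContDiff Topology

noncomputable section

namespace CRGeom

section VectorFields

variable {n : ℕ} {M : Type*} [TopologicalSpace M]
  [ChartedSpace (EuclideanSpace ℝ (Fin (2 * n + 1))) M]

variable (n M) in
/-- Real vector fields on a `(2n+1)`-dimensional manifold (no regularity built in). -/
abbrev RealField : Type _ := ∀ x : M, TangentSpace (𝓡 (2 * n + 1)) x

variable (n M) in
/-- Complex-valued `1`-forms, i.e. sections of the complexified cotangent bundle
(no regularity built in). -/
abbrev ComplexForm : Type _ := ∀ x : M, TangentSpace (𝓡 (2 * n + 1)) x →L[ℝ] ℂ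

variable (n M) in
/-- Complex vector fields `re + i im`, i.e. sections of the complexified tangent bundle
(no regularity built in). -/
structure ComplexField where
  /-- The real part. -/
  re : RealField n M
  /-- The imaginary part. -/
  im : RealField n M

/-- Smoothness of a real vector field on a set. -/
def RealField.SmoothOn [IsManifold (𝓡 (2 * n + 1)) ∞ M] (X : RealField n M) (U : Set M) : Prop :=
  ContMDiffOn (𝓡 (2 * n + 1)) (𝓡 (2 * n + 1)).tangent ∞
    (fun x => (⟨x, X x⟩ : TangentBundle (𝓡 (2 * n + 1)) M)) U

/-- Smoothness of a complex vector field on a set. -/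
def ComplexField.SmoothOn [IsManifold (𝓡 (2 * n + 1)) ∞ M] (V : ComplexField n M) (U : Set M) : Prop :=
  RealField.SmoothOn V.re U ∧ RealField.SmoothOn V.im U

/-- Smoothness of a complex-valued `1`-form on a set. -/
def ComplexForm.SmoothOn [IsManifold (𝓡 (2 * n + 1)) ∞ M] (η : ComplexForm n M) (U : Set M) :
    Prop :=
  ContMDiffOn (𝓡 (2 * n + 1))
    ((𝓡 (2 * n + 1)).prod 𝓘(ℝ, EuclideanSpace ℝ (Fin (2 * n + 1)) →L[ℝ] ℂ)) ∞
    (fun x => Bundle.TotalSpace.mk' (EuclideanSpace ℝ (Fin (2 * n + 1)) →L[ℝ] ℂ)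
      (E := fun x : M => TangentSpace (𝓡 (2 * n + 1)) x →L[ℝ] Bundle.Trivial M ℂ x) x (η x)) U

/-- A real vector field, regarded as a complex one. -/
def RealField.toComplex (X : RealField n M) : ComplexField n M := ⟨X, fun _ => 0⟩

/-- The complex conjugate of a complex vector field. -/
def ComplexField.conj (V : ComplexField n M) : ComplexField n M := ⟨V.re, fun x => -V.im x⟩

/-- The differential `df` of a complex-valued function. -/
def differential (f : M → ℂ) : ComplexForm n M := fun x => mfderiv (𝓡 (2 * n + 1)) 𝓘(ℝ, ℂ) f x

/-- The derivative `V f` of a complex-valued function along a complex vector field. -/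
def ComplexField.deriv (V : ComplexField n M) (f : M → ℂ) (x : M) : ℂ :=
  differential f x (V.re x) + Complex.I * differential f x (V.im x)

/-- The complex bilinear extension of the Lie bracket of vector fields. -/
def ComplexField.bracket (V W : ComplexField n M) : ComplexField n M where
  re x := VectorField.mlieBracket (𝓡 (2 * n + 1)) V.re W.re x -
    VectorField.mlieBracket (𝓡 (2 * n + 1)) V.im W.im x
  im x := VectorField.mlieBracket (𝓡 (2 * n + 1)) V.re W.im x +
    VectorField.mlieBracket (𝓡 (2 * n + 1)) V.im W.re x

/-- The value `η(V)` of a form on a complex vector field (complex linear extension). -/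
def ComplexForm.app (η : ComplexForm n M) (V : ComplexField n M) (x : M) : ℂ :=
  η x (V.re x) + Complex.I * η x (V.im x)

/-- The conjugate form. -/
def ComplexForm.conj (η : ComplexForm n M) : ComplexForm n M :=
  fun x => (Complex.conjCLE : ℂ →L[ℝ] ℂ) ∘L η x

/-- The exterior derivative `dη(V, W) = V(η(W)) - W(η(V)) - η([V, W])`. With this normalization
`(η ∧ ζ)(V, W) = η(V) ζ(W) - η(W) ζ(V)`. -/
def ComplexForm.d (η : ComplexForm n M) (V W : ComplexField n M) (x : M) : ℂ :=
  V.deriv (η.app W) x - W.deriv (η.app V) x - η.app (V.bracket W) x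

end VectorFields

section Pseudohermitian

/-- A strictly pseudoconvex pseudohermitian structure `(J, θ)` on a manifold of dimension `2n+1`.
The contact distribution is `H = ker θ`; `J` is an almost complex structure on `H` (it is recorded
as a fibrewise endomorphism of the tangent bundle, but only its restriction to `H` is
meaningful or ever used). -/
structure PseudohermitianStructure (n : ℕ) (M : Type*) [TopologicalSpace M]
    [ChartedSpace (EuclideanSpace ℝ (Fin (2 * n + 1))) M]
    [IsManifold (𝓡 (2 * n + 1)) ∞ M] where
  /-- The contact form. -/
  form : ∀ x : M, TangentSpace (𝓡 (2 * n + 1)) x →L[ℝ] ℝ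
  /-- The complex structure on `H = ker θ`. -/
  J : ∀ x : M, TangentSpace (𝓡 (2 * n + 1)) x →ₗ[ℝ] TangentSpace (𝓡 (2 * n + 1)) x
  form_ne_zero : ∀ x, form x ≠ 0
  form_smooth : ComplexForm.SmoothOn (fun x => Complex.ofRealCLM ∘L form x) Set.univ
  J_mem : ∀ x v, form x v = 0 → form x (J x v) = 0
  J_sq : ∀ x v, form x v = 0 → J x (J x v) = -v
  /-- `J` is smooth: it maps smooth local sections of `H` to smooth local sections. -/
  J_smooth : ∀ U : Set M, IsOpen U → ∀ X : RealField n M, X.SmoothOn U →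
    (∀ x ∈ U, form x (X x) = 0) → RealField.SmoothOn (fun x => J x (X x)) U
  /-- Formal integrability: the smooth local sections of `T^{1,0}`, i.e. the fields
  `X - i J X` with `X` in `H`, are closed under the Lie bracket. -/
  integrable : ∀ U : Set M, IsOpen U → ∀ V W : ComplexField n M, V.SmoothOn U → W.SmoothOn U →
    (∀ x ∈ U, form x (V.re x) = 0 ∧ V.im x = -J x (V.re x)) →
    (∀ x ∈ U, form x (W.re x) = 0 ∧ W.im x = -J x (W.re x)) →
    ∀ x ∈ U, form x ((V.bracket W).re x) = 0 ∧
      (V.bracket W).im x = -J x ((V.bracket W).re x)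
  /-- Strict pseudoconvexity: `dθ(X, J X) > 0` for nonzero `X` in `H` (as `θ` vanishes on
  sections of `H`, `dθ(X, J X) = -θ([X, J X])`). In particular `θ` is a contact form. -/
  pseudoconvex : ∀ U : Set M, IsOpen U → ∀ X : RealField n M, X.SmoothOn U →
    (∀ x ∈ U, form x (X x) = 0) → ∀ x ∈ U, X x ≠ 0 →
    0 < -form x (VectorField.mlieBracket (𝓡 (2 * n + 1)) X (fun y => J y (X y)) x)

variable {n : ℕ} {M : Type*} [TopologicalSpace M]
  [ChartedSpace (EuclideanSpace ℝ (Fin (2 * n + 1))) M]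
  [IsManifold (𝓡 (2 * n + 1)) ∞ M]

namespace PseudohermitianStructure

variable (S : PseudohermitianStructure n M)

/-- The contact form `θ` as a complex-valued form. -/
def theta : ComplexForm n M := fun x => Complex.ofRealCLM ∘L S.form x

/-- The value of `V` at `x` lies in `T^{1,0}`, the `+i`-eigenspace of `J` on `H ⊗ ℂ`. -/
def IsT10At (V : ComplexField n M) (x : M) : Prop :=
  S.form x (V.re x) = 0 ∧ V.im x = -S.J x (V.re x)

/-- `v` is a CR function on `U`: it is smooth and annihilated by all vectors of type `(0,1)`,
that is, by all `w + i J w` with `w` in `H`. -/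
def IsCRFunctionOn (v : M → ℂ) (U : Set M) : Prop :=
  ContMDiffOn (𝓡 (2 * n + 1)) 𝓘(ℝ, ℂ) ∞ v U ∧
    ∀ x ∈ U, ∀ w : TangentSpace (𝓡 (2 * n + 1)) x, S.form x w = 0 →
      differential v x w + Complex.I * differential v x (S.J x w) = 0

/-- CR pluriharmonic functions: real-valued smooth functions that are locally the real part of a
CR function. -/
def IsPluriharmonic (f : M → ℝ) : Prop :=
  ContMDiff (𝓡 (2 * n + 1)) 𝓘(ℝ, ℝ) ∞ f ∧
    ∀ x : M, ∃ U : Set M, IsOpen U ∧ x ∈ U ∧ ∃ v : M → ℂ, S.IsCRFunctionOn v U ∧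
      ∀ y ∈ U, f y = (v y).re

/-- An admissible coframe `{θ^α}` on the open set `U`, together with the frame `{T, Z_α, Z_ᾱ}`
dual to `{θ, θ^α, θ^ᾱ}`. -/
structure AdmissibleFrame (U : Set M) where
  /-- The Reeb field `T`. -/
  T : RealField n M
  /-- The frame `Z_α` of `T^{1,0}`. -/
  Z : Fin n → ComplexField n M
  /-- The admissible coframe `θ^α`. -/
  coframe : Fin n → ComplexForm n M
  T_smooth : T.SmoothOn U
  Z_smooth : ∀ α, (Z α).SmoothOn U
  coframe_smooth : ∀ α, (coframe α).SmoothOn U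
  form_T : ∀ x ∈ U, S.form x (T x) = 1
  d_form_T : ∀ Y : RealField n M, Y.SmoothOn U →
    ∀ x ∈ U, S.theta.d T.toComplex Y.toComplex x = 0
  Z_mem : ∀ α, ∀ x ∈ U, S.IsT10At (Z α) x
  coframe_T : ∀ α, ∀ x ∈ U, coframe α x (T x) = 0
  coframe_Z : ∀ α β, ∀ x ∈ U, (coframe α).app (Z β) x = if α = β then 1 else 0
  coframe_Zbar : ∀ α β, ∀ x ∈ U, (coframe α).app (Z β).conj x = 0

end PseudohermitianStructure

/-- The directions `0, α, ᾱ` of an admissible frame. -/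
inductive Dir (n : ℕ) where
  /-- The direction of the Reeb field. -/
  | zero : Dir n
  /-- The direction `α`. -/
  | hol (α : Fin n) : Dir n
  /-- The direction `ᾱ`. -/
  | anti (α : Fin n) : Dir n

/-- Conjugation of directions. -/
def Dir.conj : Dir n → Dir n
  | .zero => .zero
  | .hol α => .anti α
  | .anti α => .hol α

namespace PseudohermitianStructure.AdmissibleFrame

variable {S : PseudohermitianStructure n M} {U : Set M} (F : S.AdmissibleFrame U)

/-- The frame fields `T`, `Z_α`, `Z_ᾱ`. -/
def field : Dir n → ComplexField n M
  | .zero => F.T.toComplex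
  | .hol α => F.Z α
  | .anti α => (F.Z α).conj

/-- The Levi form: `dθ = i h_{αβ̄} θ^α ∧ θ^β̄`, that is `h_{αβ̄} = -i dθ(Z_α, Z_β̄)`. -/
def h (α β : Fin n) (x : M) : ℂ := -Complex.I * S.theta.d (F.Z α) (F.Z β).conj x

/-- The inverse `h^{αβ̄}` of the Levi form: `h^{αβ̄} h_{γβ̄} = δ^α_γ`. -/
def hInv (α β : Fin n) (x : M) : ℂ := (Matrix.of fun γ δ => F.h γ δ x)⁻¹ β α

/-- The torsion `A_{αβ}`. The structure equation `dθ^γ = θ^δ ∧ ω_δ^γ + θ ∧ τ^γ`, where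
`τ^γ = h^{γᾱ} A_{ᾱβ̄} θ^β̄`, says that `A_{ᾱβ̄} = h_{γᾱ} dθ^γ(T, Z_β̄)`. -/
def A (α β : Fin n) (x : M) : ℂ :=
  starRingEnd ℂ (∑ γ, F.h γ α x * (F.coframe γ).d F.T.toComplex (F.Z β).conj x)

/-- The value `ω_α^γ(e)` of the Tanaka--Webster connection form on a frame field `e`. The structure
equations `dθ^γ = θ^α ∧ ω_α^γ + θ ∧ τ^γ` and `dh_{αδ̄} = h_{γδ̄} ω_α^γ + h_{αγ̄} ω_δ̄^γ̄`
(with `ω_δ̄^γ̄` the conjugate of `ω_δ^γ`) are solved for `ω`: the first one gives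
`ω_α^γ(T) = dθ^γ(Z_α, T)` and `ω_α^γ(Z_β̄) = dθ^γ(Z_α, Z_β̄)`, and the second one then gives
`ω_α^γ(Z_β)`. -/
def omega (α γ : Fin n) : Dir n → M → ℂ
  | .zero => fun x => (F.coframe γ).d (F.Z α) F.T.toComplex x
  | .anti β => fun x => (F.coframe γ).d (F.Z α) (F.Z β).conj x
  | .hol β => fun x => ∑ δ, F.hInv γ δ x * ((F.Z β).deriv (F.h α δ) x -
      ∑ σ, F.h α σ x * starRingEnd ℂ ((F.coframe σ).d (F.Z δ) (F.Z β).conj x))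

/-- The value `ω_ᾱ^γ̄(e)` of the conjugate connection form on a frame field. -/
def omegaBar (α γ : Fin n) (d : Dir n) (x : M) : ℂ := starRingEnd ℂ (F.omega α γ d.conj x)

/-- The connection form `ω_α^γ` evaluated on an arbitrary complex vector field. -/
def omegaApp (α γ : Fin n) (V : ComplexField n M) (x : M) : ℂ :=
  S.theta.app V x * F.omega α γ .zero x +
    ∑ μ, (F.coframe μ).app V x * F.omega α γ (.hol μ) x +
    ∑ μ, (F.coframe μ).conj.app V x * F.omega α γ (.anti μ) x

/-- The curvature `R_α^β_{γδ̄} = Π_α^β(Z_γ, Z_δ̄)`, where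
`Π_α^β = dω_α^β - ω_α^μ ∧ ω_μ^β`. -/
def curvature (α β γ δ : Fin n) (x : M) : ℂ :=
  (F.Z γ).deriv (F.omega α β (.anti δ)) x - (F.Z δ).conj.deriv (F.omega α β (.hol γ)) x -
    F.omegaApp α β ((F.Z γ).bracket (F.Z δ).conj) x -
    ∑ μ, (F.omega α μ (.hol γ) x * F.omega μ β (.anti δ) x -
      F.omega α μ (.anti δ) x * F.omega μ β (.hol γ) x)

/-- The pseudohermitian Ricci tensor `R_{αβ̄} = R_γ^γ_{αβ̄}`. -/
def ricci (α β : Fin n) (x : M) : ℂ := ∑ γ, F.curvature γ γ α β x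

/-- The trace `h^{αβ̄} t_{αβ̄}`. -/
def trace (t : Fin n → Fin n → M → ℂ) (x : M) : ℂ := ∑ α, ∑ β, F.hInv α β x * t α β x

/-- The pseudohermitian (Webster) scalar curvature `R = R_α^α`. -/
def R (x : M) : ℂ := F.trace F.ricci x

/-- The pseudohermitian Schouten tensor
`P_{αβ̄} = (R_{αβ̄} - R h_{αβ̄} / (2(n+1))) / (n+2)`. -/
def schouten (α β : Fin n) (x : M) : ℂ :=
  1 / ((n : ℂ) + 2) * (F.ricci α β x - 1 / (2 * ((n : ℂ) + 1)) * F.R x * F.h α β x)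

/-- The trace `P = P_α^α` of the Schouten tensor. -/
def P (x : M) : ℂ := F.trace F.schouten x

/-- The tracefree part `P_{αβ̄} - (P / n) h_{αβ̄}` of the Schouten tensor. -/
def schouten0 (α β : Fin n) (x : M) : ℂ := F.schouten α β x - F.P x / (n : ℂ) * F.h α β x

/-- `∇_α u`. -/
def grad (u : M → ℂ) (α : Fin n) (x : M) : ℂ := (F.Z α).deriv u x

/-- `∇_ᾱ u`. -/
def gradBar (u : M → ℂ) (α : Fin n) (x : M) : ℂ := (F.Z α).conj.deriv u x

/-- `∇_0 u = T u`. -/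
def nabla0 (u : M → ℂ) (x : M) : ℂ := F.T.toComplex.deriv u x

/-- `∇^α u = h^{αβ̄} ∇_β̄ u`. -/
def gradUp (u : M → ℂ) (α : Fin n) (x : M) : ℂ := ∑ β, F.hInv α β x * F.gradBar u β x

/-- `∇^ᾱ u = h^{βᾱ} ∇_β u`. -/
def gradBarUp (u : M → ℂ) (α : Fin n) (x : M) : ℂ := ∑ β, F.hInv β α x * F.grad u β x

/-- The covariant derivative `∇_d σ_α` of a form `σ_α` of type `(1,0)`. -/
def cov (d : Dir n) (σ : Fin n → M → ℂ) (α : Fin n) (x : M) : ℂ :=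
  (F.field d).deriv (σ α) x - ∑ γ, F.omega α γ d x * σ γ x

/-- The covariant derivative `∇_d σ_ᾱ` of a form `σ_ᾱ` of type `(0,1)`. -/
def covBar (d : Dir n) (σ : Fin n → M → ℂ) (α : Fin n) (x : M) : ℂ :=
  (F.field d).deriv (σ α) x - ∑ γ, F.omegaBar α γ d x * σ γ x

/-- The covariant derivative `∇_d t_{αβ}` of a tensor `t_{αβ}`. -/
def cov2 (d : Dir n) (t : Fin n → Fin n → M → ℂ) (α β : Fin n) (x : M) : ℂ :=
  (F.field d).deriv (t α β) x - ∑ γ, F.omega α γ d x * t γ β x - ∑ γ, F.omega β γ d x * t α γ x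

/-- The divergence `∇^α σ_α = h^{αβ̄} ∇_β̄ σ_α`. -/
def div (σ : Fin n → M → ℂ) (x : M) : ℂ := ∑ α, ∑ β, F.hInv α β x * F.cov (.anti β) σ α x

/-- The divergence `∇^ᾱ σ_ᾱ = h^{αβ̄} ∇_α σ_β̄`. -/
def divBar (σ : Fin n → M → ℂ) (x : M) : ℂ := ∑ α, ∑ β, F.hInv α β x * F.covBar (.hol α) σ β x

/-- The sublaplacian `Δ_b u = -(∇^α ∇_α u + ∇_α ∇^α u)`. -/
def sublaplacian (u : M → ℂ) (x : M) : ℂ := -(F.div (F.grad u) x + F.divBar (F.gradBar u) x)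

/-- `∇^α (A_{αβ} ∇^β u)`. -/
def torsionDiv (u : M → ℂ) (x : M) : ℂ :=
  F.div (fun α y => ∑ β, F.A α β y * F.gradUp u β y) x

/-- `∇^β A_{αβ}`. -/
def divA (α : Fin n) (x : M) : ℂ := ∑ β, ∑ γ, F.hInv β γ x * F.cov2 (.anti γ) F.A α β x

/-- `|A_{αβ}|^2 = A_{αβ} A^{αβ}`. -/
def normSqA (x : M) : ℂ :=
  ∑ α, ∑ β, ∑ γ, ∑ δ,
    F.A α β x * F.hInv α γ x * F.hInv β δ x * starRingEnd ℂ (F.A γ δ x)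

/-- `|t_{αβ̄}|^2 = t_{αβ̄} t^{αβ̄}` for the tracefree Schouten tensor `t`. -/
def normSqSchouten0 (x : M) : ℂ :=
  ∑ α, ∑ β, ∑ γ, ∑ δ,
    F.schouten0 α β x * F.hInv α γ x * F.hInv δ β x * F.schouten0 δ γ x

/-- `∇_β̄ (t^{αβ̄} ∇_α u) = ∇_β̄ (h^{δβ̄} t_{δγ̄} ∇^γ̄ u) = ∇^δ (t_{δγ̄} ∇^γ̄ u)` for the tracefree
Schouten tensor `t`. -/
def schoutenDiv (u : M → ℂ) (x : M) : ℂ :=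
  F.div (fun δ y => ∑ γ, F.schouten0 δ γ y * F.gradBarUp u γ y) x

/-- `W_α = ∇_α R - i ∇^β A_{αβ}`. -/
def W (α : Fin n) (x : M) : ℂ := F.grad F.R α x - Complex.I * F.divA α x

/-- The zeroth order part `Q_4` of the CR Paneitz operator. -/
def Q4 (x : M) : ℂ :=
  2 * ((n : ℂ) + 1) ^ 2 / (n * (n + 2)) * F.sublaplacian F.P x -
    4 / (n * ((n : ℂ) + 2)) * (F.div F.divA x).im -
    2 * ((n : ℂ) - 1) / n * F.normSqA x -
    2 * ((n : ℂ) + 1) / n * F.normSqSchouten0 x +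
    2 * ((n : ℂ) - 1) * (n + 1) ^ 2 / n ^ 2 * F.P x ^ 2

/-- The CR Paneitz operator `P_4` in dimension `2n+1`. -/
def paneitz (u : M → ℂ) (x : M) : ℂ :=
  F.sublaplacian (F.sublaplacian u) x + F.nabla0 (F.nabla0 u) x -
    4 * (F.torsionDiv u x).im + 4 * (F.schoutenDiv u x).re -
    4 * ((n : ℂ) ^ 2 - 1) / n * (F.div (fun β y => F.P y * F.grad u β y) x).re +
    ((n : ℂ) - 1) / 2 * F.Q4 x * u x

/-- The explicit expression for the `P'`-operator; the real parameter `ν` stands for the dimensional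
parameter `n` in the coefficients. -/
def pPrime (ν : ℝ) (u : M → ℂ) (x : M) : ℂ :=
  2 * ((ν : ℂ) + 1) / ν ^ 2 * F.sublaplacian (F.sublaplacian u) x -
    8 / (ν : ℂ) * (F.torsionDiv u x).im -
    8 * ((ν : ℂ) + 1) / ν * (F.div (fun α y => F.P y * F.grad u α y) x).re +
    16 * ((ν : ℂ) + 1) / (ν * (ν + 2)) *
      (∑ α, (F.grad F.P α x - Complex.I * ν / (2 * ((ν : ℂ) + 1)) * F.divA α x) *
        F.gradUp u α x).re +
    (2 * ((ν : ℂ) + 1) ^ 2 / (ν * (ν + 2)) * F.sublaplacian F.P x -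
      4 / (ν * ((ν : ℂ) + 2)) * (F.div F.divA x).im -
      2 * ((ν : ℂ) - 1) / ν * F.normSqA x -
      2 * ((ν : ℂ) + 1) / ν * F.normSqSchouten0 x +
      2 * ((ν : ℂ) - 1) * (ν + 1) ^ 2 / ν ^ 2 * F.P x ^ 2) * u x

/-- The explicit expression for the critical `P'`-operator (`n = 1`). -/
def criticalPPrime (u : M → ℂ) (x : M) : ℂ :=
  4 * F.sublaplacian (F.sublaplacian u) x - 8 * (F.torsionDiv u x).im -
    4 * (F.div (fun α y => F.R y * F.grad u α y) x).re +
    8 / 3 * (∑ α, F.W α x * F.gradUp u α x).re +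
    2 / 3 * (F.sublaplacian F.R x - 2 * (F.div F.divA x).im) * u x

end PseudohermitianStructure.AdmissibleFrame

end Pseudohermitian

section Rationality

/-- The pseudohermitian operators, defined in all dimensions, of which the `P'`-operator is a
combination with coefficients depending only on the dimension. -/
inductive PPrimeTerm where
  | sublaplacianSq
  | imTorsionDiv
  | reDivPGrad
  | reGradPGrad
  | reIDivAGrad
  | sublaplacianP
  | imDivDivA
  | normSqA
  | normSqSchouten0
  | PSq
  deriving DecidableEq

instance : Fintype PPrimeTerm where
  elems := {.sublaplacianSq, .imTorsionDiv, .reDivPGrad, .reGradPGrad, .reIDivAGrad,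
    .sublaplacianP, .imDivDivA, .normSqA, .normSqSchouten0, .PSq}
  complete t := by cases t <;> simp

variable {n : ℕ} {M : Type*} [TopologicalSpace M]
  [ChartedSpace (EuclideanSpace ℝ (Fin (2 * n + 1))) M]
  [IsManifold (𝓡 (2 * n + 1)) ∞ M]
  {S : PseudohermitianStructure n M} {U : Set M}

/-- The operator named by a term. -/
def PPrimeTerm.eval (F : S.AdmissibleFrame U) (u : M → ℂ) (x : M) : PPrimeTerm → ℂ
  | .sublaplacianSq => F.sublaplacian (F.sublaplacian u) x
  | .imTorsionDiv => (F.torsionDiv u x).im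
  | .reDivPGrad => (F.div (fun α y => F.P y * F.grad u α y) x).re
  | .reGradPGrad => (∑ α, F.grad F.P α x * F.gradUp u α x).re
  | .reIDivAGrad => (∑ α, Complex.I * F.divA α x * F.gradUp u α x).re
  | .sublaplacianP => F.sublaplacian F.P x * u x
  | .imDivDivA => (F.div F.divA x).im * u x
  | .normSqA => F.normSqA x * u x
  | .normSqSchouten0 => F.normSqSchouten0 x * u x
  | .PSq => F.P x ^ 2 * u x

/-- The coefficient of a term in the `P'`-operator, as a function of the dimensional parameter. -/
def PPrimeTerm.coeff (ν : ℝ) : PPrimeTerm → ℝ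
  | .sublaplacianSq => 2 * (ν + 1) / ν ^ 2
  | .imTorsionDiv => -(8 / ν)
  | .reDivPGrad => -(8 * (ν + 1) / ν)
  | .reGradPGrad => 16 * (ν + 1) / (ν * (ν + 2))
  | .reIDivAGrad => -(8 / (ν + 2))
  | .sublaplacianP => 2 * (ν + 1) ^ 2 / (ν * (ν + 2))
  | .imDivDivA => -(4 / (ν * (ν + 2)))
  | .normSqA => -(2 * (ν - 1) / ν)
  | .normSqSchouten0 => -(2 * (ν + 1) / ν)
  | .PSq => 2 * (ν - 1) * (ν + 1) ^ 2 / ν ^ 2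

/-- `c` is a rational function of the real parameter without a pole at `a`. -/
def IsRationalRegularAt (c : ℝ → ℝ) (a : ℝ) : Prop :=
  ∃ p q : Polynomial ℝ, q.eval a ≠ 0 ∧ ∀ ν, q.eval ν ≠ 0 → c ν = p.eval ν / q.eval ν

end Rationality

end CRGeom

end

/-! Locally `f = v + v̄`, where `v` is half of a CR function, so `Z_ᾱ v = 0`. On such `f` the terms
of `P_4 f` without a visible factor `n - 1` acquire one, by two identities.

(a) Since `Z_ᾱ v = 0`, the commutator of `Z_α` and `Z_β̄` gives `Δ_b v = -i n T v`, and the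
commutator of `T` and `Z_β̄` gives `Z_β̄ T v = A_β̄γ̄ ∇^γ̄ v`. Applying `Δ_b` twice and adding the
conjugate yields `Δ_b² f + n² T² f = 4n Im ∇^α(A_αβ ∇^β f)` (`lap_lap_of_pluriharmonic`).
Eliminating `T² f` from `P_4 f` leaves the coefficients `1 - 1/n²` and `4/n - 4`, both multiples of
`n - 1`.

(b) The mixed Hessian `∇_β̄ ∇^γ̄ v` is `i T v` times the identity. In the divergence of a tracefree
tensor contracted with `∇v` the second derivatives of `v` therefore drop out
(`div_tracefree_of_cr`). By the contracted Bianchi identity (`bianchi`, `div_ric0`) the divergence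
of the tracefree Ricci tensor is a multiple of `n - 1`.

Division by `n - 1` then gives `𝒫_n f` (`paneitz_of_pluriharmonic`). The coefficients of `𝒫_ν` are
rational and regular at `1`, so the critical operator is the value at `ν = 1`, simplified by `P =
R/4` and `P̊ = 0`.

The tensor calculus is done in a `FrameAlgebra`: a commutative star algebra with derivations `T`,
`Z_α`, `Z_ᾱ`. Only the trace of the connection is needed there. The Ricci tensor is the (1,1) part
of `ρ = d(tr ω)`, the other parts of `ρ` come from traced Jacobi identities, and `dρ = 0` is the
Bianchi identity. The analytic input is that Lie brackets act as commutators
(`ComplexField.deriv_bracket`), that vectors expand in the frame (`deriv_expand`), and that the Levi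
form is nondegenerate (`det_h_ne_zero`). Then `frameAlgebra` is such a model over the smooth
functions on a small open set, and `IsModel` carries identities back to the manifold. -/

open scoped Manifold ContDiff Topology

noncomputable section

namespace CRGeom

/-! ### Frames of derivations: the Jacobi identity and the exterior derivative. -/

section Moving

variable {κ A : Type*} [Fintype κ] [CommRing A] [Algebra ℂ A]
  (e : κ → Derivation ℂ A A) (C : κ → κ → κ → A)

/-- `C` are structure functions of the frame `e` of derivations. -/
def IsStructure : Prop := ∀ i j f, e i (e j f) - e j (e i f) = ∑ k, C i j k * e k f

/-- The derivations `e` are linearly independent over the ring. -/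
def FrameIndep : Prop := ∀ a : κ → A, (∀ f, ∑ k, a k * e k f = 0) → ∀ k, a k = 0

variable {e C}

theorem IsStructure.antisymm (hC : IsStructure e C) (hi : FrameIndep e) (i j k : κ) :
    C i j k = -C j i k := by
  have := hi (fun k => C i j k + C j i k) (fun f => by
    simp only [add_mul, Finset.sum_add_distrib]
    rw [← hC, ← hC]; ring) k
  exact eq_neg_of_add_eq_zero_left this

/-- The left side is the coefficient of `e l` in the cyclic sum of `[e i, [e j, e k]]`. That sum is
zero as an operator, and independence of the frame allows coefficients to be compared. -/
theorem IsStructure.jacobi (hC : IsStructure e C) (hi : FrameIndep e) (i j k l : κ) :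
    (e i (C j k l) + ∑ m, C j k m * C i m l) + (e j (C k i l) + ∑ m, C k i m * C j m l) +
      (e k (C i j l) + ∑ m, C i j m * C k m l) = 0 := by
  have key : ∀ i j k f, ∑ l, (e i (C j k l) + ∑ m, C j k m * C i m l) * e l f =
      e i (e j (e k f)) - e i (e k (e j f)) - (e j (e k (e i f)) - e k (e j (e i f))) := by
    intro i j k f
    have h1 : e i (e j (e k f)) - e i (e k (e j f)) =
        ∑ l, (C j k l * e i (e l f) + e l f * e i (C j k l)) := by
      rw [← map_sub, hC, map_sum]
      exact Finset.sum_congr rfl fun l _ => by rw [Derivation.leibniz]; simp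
    have h2 : ∑ m, C j k m * (e i (e m f) - e m (e i f)) =
        ∑ l, (∑ m, C j k m * C i m l) * e l f := by
      simp only [hC i _ f, Finset.mul_sum, Finset.sum_mul, ← mul_assoc]
      exact Finset.sum_comm
    rw [h1, hC j k (e i f)]
    simp only [add_mul, Finset.sum_add_distrib, ← h2, mul_sub, Finset.sum_sub_distrib]
    rw [Finset.sum_congr rfl fun l _ => mul_comm (e l f) (e i (C j k l))]
    ring
  refine hi (fun l => (e i (C j k l) + ∑ m, C j k m * C i m l) +
    (e j (C k i l) + ∑ m, C k i m * C j m l) + (e k (C i j l) + ∑ m, C i j m * C k m l))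
    (fun f => ?_) l
  simp only [add_mul, Finset.sum_add_distrib] at key ⊢
  linear_combination key i j k f + key j k i f + key k i j f

variable (e C) in
/-- The exterior derivative of a `1`-form, in terms of the frame. -/
def dForm (ϖ : κ → A) (i j : κ) : A := e i (ϖ j) - e j (ϖ i) - ∑ k, C i j k * ϖ k

theorem IsStructure.dForm_antisymm (hC : IsStructure e C) (hi : FrameIndep e) (ϖ : κ → A)
    (i j : κ) : dForm e C ϖ i j = -dForm e C ϖ j i := by
  simp only [dForm, hC.antisymm hi i j, neg_mul, Finset.sum_neg_distrib]
  ring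

/-- `d² = 0`. -/
theorem IsStructure.d_dForm (hC : IsStructure e C) (hi : FrameIndep e) (ϖ : κ → A) (i j k : κ) :
    (e i (dForm e C ϖ j k) - ∑ m, C i j m * dForm e C ϖ m k) +
    (e j (dForm e C ϖ k i) - ∑ m, C j k m * dForm e C ϖ m i) +
    (e k (dForm e C ϖ i j) - ∑ m, C k i m * dForm e C ϖ m j) = 0 := by
  have h1 : ∀ i j k, e i (dForm e C ϖ j k) = e i (e j (ϖ k)) - e i (e k (ϖ j)) -
      (∑ l, C j k l * e i (ϖ l) + ∑ l, e i (C j k l) * ϖ l) := by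
    intro i j k
    rw [dForm, map_sub, map_sub, map_sum, ← Finset.sum_add_distrib]
    congr 1
    exact Finset.sum_congr rfl fun l _ => by rw [Derivation.leibniz]; simp [mul_comm]
  have h2 : ∀ i j k, ∑ m, C i j m * dForm e C ϖ m k =
      (e i (e j (ϖ k)) - e j (e i (ϖ k))) - ∑ m, C i j m * e k (ϖ m) +
      ∑ l, (∑ m, C i j m * C k m l) * ϖ l := by
    intro i j k
    have h : ∑ m, C i j m * ∑ l, C m k l * ϖ l = -∑ l, (∑ m, C i j m * C k m l) * ϖ l := by
      simp only [Finset.mul_sum, Finset.sum_mul, ← Finset.sum_neg_distrib]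
      rw [Finset.sum_comm]
      exact Finset.sum_congr rfl fun l _ => Finset.sum_congr rfl fun m _ => by
        rw [hC.antisymm hi m k]; ring
    simp only [dForm, mul_sub, Finset.sum_sub_distrib, hC i j (ϖ k), h, sub_neg_eq_add]
  -- All terms that differentiate `ϖ` cancel among themselves; what multiplies an undifferentiated
  -- `ϖ l` is a Jacobi sum.
  have h3 : ∑ l, ((e i (C j k l) + ∑ m, C j k m * C i m l) +
    (e j (C k i l) + ∑ m, C k i m * C j m l) + (e k (C i j l) + ∑ m, C i j m * C k m l)) * ϖ l
      = 0 := Finset.sum_eq_zero fun l _ => by rw [hC.jacobi hi, zero_mul]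
  simp only [add_mul _ _ (ϖ _), Finset.sum_add_distrib] at h3
  simp only [h1, h2]
  linear_combination -h3

end Moving

/-- The directions as an option type. -/
def Dir.equivOption (n : ℕ) : Option (Fin n ⊕ Fin n) ≃ Dir n where
  toFun := fun | none => .zero | some (.inl a) => .hol a | some (.inr a) => .anti a
  invFun := fun | .zero => none | .hol a => some (.inl a) | .anti a => some (.inr a)
  left_inv := by rintro (_ | _ | _) <;> rfl
  right_inv := by rintro (_ | _ | _) <;> rfl

instance (n : ℕ) : Fintype (Dir n) := Fintype.ofEquiv _ (Dir.equivOption n)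

theorem Dir.sum_eq {n : ℕ} {A : Type*} [AddCommMonoid A] (f : Dir n → A) :
    ∑ d, f d = f .zero + ∑ α, f (.hol α) + ∑ α, f (.anti α) := by
  rw [← Equiv.sum_comp (Dir.equivOption n) f, Fintype.sum_option, Fintype.sum_sum_type, ← add_assoc]
  rfl

end CRGeom

/-! ### The algebraic frame, the Levi form and the Tanaka–Webster connection. -/

namespace CRGeom

/-- An algebraic model of an admissible frame: derivations `T`, `Z_α`, `Z_ᾱ` of an algebra with
conjugation, subject to the commutation relations of the frame fields. Here `wa α γ β` is
`ω_α^γ(Z_β̄)`, `w0 α γ` is `ω_α^γ(T)` and `-r` is the torsion with one index raised. -/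
structure FrameAlgebra (n : ℕ) (A : Type*) [CommRing A] [StarRing A] [Algebra ℂ A]
    [StarModule ℂ A] where
  /-- The derivation along the Reeb field. -/
  T : Derivation ℂ A A
  /-- The derivations along the fields of type `(1,0)`. -/
  Z : Fin n → Derivation ℂ A A
  /-- The derivations along the fields of type `(0,1)`. -/
  Zb : Fin n → Derivation ℂ A A
  /-- The Levi form. -/
  h : Fin n → Fin n → A
  /-- The inverse Levi form. -/
  hInv : Fin n → Fin n → A
  /-- The connection form along `T`. -/
  w0 : Fin n → Fin n → A
  /-- The `(0,1)` part of `[T, Z_α]`. -/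
  r : Fin n → Fin n → A
  /-- The connection form along `Z_β̄`. -/
  wa : Fin n → Fin n → Fin n → A
  /-- The structure functions of `[Z_α, Z_β]`. -/
  c : Fin n → Fin n → Fin n → A
  star_T : ∀ f, star (T f) = T (star f)
  star_Z : ∀ α f, star (Z α f) = Zb α (star f)
  star_h : ∀ α β, star (h α β) = h β α
  hInv_h : ∀ α γ, ∑ β, hInv α β * h γ β = if α = γ then 1 else 0
  lie_Z_Zb : ∀ α β f, Z α (Zb β f) - Zb β (Z α f) = -(algebraMap ℂ A Complex.I * h α β) * T f -
    ∑ γ, wa α γ β * Z γ f + ∑ γ, star (wa β γ α) * Zb γ f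
  lie_T_Z : ∀ α f, T (Z α f) - Z α (T f) = ∑ γ, w0 α γ * Z γ f + ∑ γ, r α γ * Zb γ f
  lie_Z_Z : ∀ α β f, Z α (Z β f) - Z β (Z α f) = ∑ γ, c α β γ * Z γ f
  indep : ∀ (a : A) (b c : Fin n → A),
    (∀ f, a * T f + ∑ γ, b γ * Z γ f + ∑ γ, c γ * Zb γ f = 0) →
      a = 0 ∧ (∀ γ, b γ = 0) ∧ ∀ γ, c γ = 0

namespace FrameAlgebra

section ImaginaryUnit

variable {A : Type*} [CommRing A] [Algebra ℂ A]

variable (A) in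
/-- The imaginary unit in the algebra. -/
def iu : A := algebraMap ℂ A Complex.I

theorem iu_mul_iu : iu A * iu A = -1 := by
  rw [iu, ← map_mul, Complex.I_mul_I, map_neg, map_one]

theorem star_iu [StarRing A] [StarModule ℂ A] : star (iu A) = -iu A := by
  rw [iu, ← algebraMap_star_comm, ← map_neg]
  simp

theorem derivation_iu_mul (D : Derivation ℂ A A) (a : A) : D (iu A * a) = iu A * D a := by
  rw [iu, ← Algebra.smul_def, ← Algebra.smul_def, D.map_smul]

theorem iu_mul_eq_zero {a : A} (ha : iu A * a = 0) : a = 0 := by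
  linear_combination -iu A * ha + a * iu_mul_iu (A := A)

end ImaginaryUnit

variable {n : ℕ} {A : Type*} [CommRing A] [StarRing A] [Algebra ℂ A] [StarModule ℂ A]
  (F : FrameAlgebra n A)

/-- The frame. -/
def e : Dir n → Derivation ℂ A A
  | .zero => F.T
  | .hol α => F.Z α
  | .anti α => F.Zb α

/-- The structure functions of the frame. -/
def C : Dir n → Dir n → Dir n → A
  | .zero, .zero, _ => 0
  | .zero, .hol _, .zero => 0
  | .zero, .hol α, .hol γ => F.w0 α γ
  | .zero, .hol α, .anti γ => F.r α γ
  | .zero, .anti _, .zero => 0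
  | .zero, .anti α, .hol γ => star (F.r α γ)
  | .zero, .anti α, .anti γ => star (F.w0 α γ)
  | .hol _, .zero, .zero => 0
  | .hol α, .zero, .hol γ => -F.w0 α γ
  | .hol α, .zero, .anti γ => -F.r α γ
  | .hol _, .hol _, .zero => 0
  | .hol α, .hol β, .hol γ => F.c α β γ
  | .hol _, .hol _, .anti _ => 0
  | .hol α, .anti β, .zero => -(iu A * F.h α β)
  | .hol α, .anti β, .hol γ => -F.wa α γ β
  | .hol α, .anti β, .anti γ => star (F.wa β γ α)
  | .anti _, .zero, .zero => 0
  | .anti α, .zero, .hol γ => -star (F.r α γ)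
  | .anti α, .zero, .anti γ => -star (F.w0 α γ)
  | .anti β, .hol α, .zero => iu A * F.h α β
  | .anti β, .hol α, .hol γ => F.wa α γ β
  | .anti β, .hol α, .anti γ => -star (F.wa β γ α)
  | .anti _, .anti _, .zero => 0
  | .anti _, .anti _, .hol _ => 0
  | .anti α, .anti β, .anti γ => star (F.c α β γ)

theorem star_Zb (α : Fin n) (f : A) : star (F.Zb α f) = F.Z α (star f) := by
  rw [← star_star (F.Z α (star f)), F.star_Z, star_star]

theorem star_e (d : Dir n) (f : A) : star (F.e d f) = F.e d.conj (star f) := by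
  cases d
  exacts [F.star_T f, F.star_Z _ f, F.star_Zb _ f]

theorem star_C (i j k : Dir n) : star (F.C i j k) = F.C i.conj j.conj k.conj := by
  rcases i with _ | i | i <;> rcases j with _ | j | j <;> rcases k with _ | k | k <;>
    simp [C, Dir.conj, F.star_h, star_iu]

theorem lie_T_Zb (α : Fin n) (f : A) : F.T (F.Zb α f) - F.Zb α (F.T f) =
    ∑ γ, star (F.r α γ) * F.Z γ f + ∑ γ, star (F.w0 α γ) * F.Zb γ f := by
  have := congrArg star (F.lie_T_Z α (star f))
  simpa [F.star_T, F.star_Z, F.star_Zb, star_sum, mul_comm, add_comm] using this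

theorem lie_Zb_Zb (α β : Fin n) (f : A) : F.Zb α (F.Zb β f) - F.Zb β (F.Zb α f) =
    ∑ γ, star (F.c α β γ) * F.Zb γ f := by
  have := congrArg star (F.lie_Z_Z α β (star f))
  simpa [F.star_T, F.star_Z, F.star_Zb, star_sum, mul_comm] using this

theorem isStructure : IsStructure F.e F.C := by
  intro i j f
  rw [Dir.sum_eq]
  rcases i with _ | i | i <;> rcases j with _ | j | j <;>
    simp only [e, C, zero_mul, neg_mul, Finset.sum_const_zero, Finset.sum_neg_distrib,
      sub_self, zero_add, add_zero]
  · exact F.lie_T_Z j f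
  · exact F.lie_T_Zb j f
  · linear_combination -F.lie_T_Z i f
  · exact F.lie_Z_Z i j f
  · have := F.lie_Z_Zb i j f
    rw [← iu] at this
    linear_combination this
  · linear_combination -F.lie_T_Zb i f
  · have := F.lie_Z_Zb j i f
    rw [← iu] at this
    linear_combination -this
  · exact F.lie_Zb_Zb i j f

theorem frameIndep : FrameIndep F.e := by
  intro a ha
  obtain ⟨h1, h2, h3⟩ := F.indep (a .zero) (fun γ => a (.hol γ)) (fun γ => a (.anti γ))
    (fun f => by have := ha f; rwa [Dir.sum_eq] at this)
  rintro (_ | γ | γ)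
  exacts [h1, h2 γ, h3 γ]

/-! ### The Levi form -/

theorem h_hInv (β δ : Fin n) : ∑ α, F.hInv α β * F.h α δ = if β = δ then 1 else 0 := by
  have h1 : (Matrix.of F.hInv) * (Matrix.of F.h).transpose = 1 := by
    ext α γ
    simp [Matrix.mul_apply, F.hInv_h, Matrix.one_apply]
  -- A one-sided inverse of a square matrix over a commutative ring is two-sided.
  have h3 := mul_eq_one_comm.mp h1
  have h2 := congrFun (congrFun h3 δ) β
  simp only [Matrix.mul_apply, Matrix.transpose_apply, Matrix.of_apply, Matrix.one_apply] at h2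
  rw [← Finset.sum_congr rfl fun α _ => mul_comm (F.h α δ) (F.hInv α β), h2]
  simp [eq_comm]

/-- Lowering the second index of a tensor is injective. -/
theorem eq_of_sum_mul_h {a b : Fin n → A} (hab : ∀ γ, ∑ δ, a δ * F.h δ γ = ∑ δ, b δ * F.h δ γ)
    (μ : Fin n) : a μ = b μ := by
  have key : ∀ a : Fin n → A, ∑ γ, F.hInv μ γ * ∑ δ, a δ * F.h δ γ = a μ := by
    intro a
    calc ∑ γ, F.hInv μ γ * ∑ δ, a δ * F.h δ γ = ∑ δ, a δ * ∑ γ, F.hInv μ γ * F.h δ γ := by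
          simp only [Finset.mul_sum]
          rw [Finset.sum_comm]
          exact Finset.sum_congr rfl fun _ _ => Finset.sum_congr rfl fun _ _ => by ring
      _ = a μ := by simp [F.hInv_h]
  rw [← key a, ← key b]
  simp only [hab]

theorem star_hInv (α β : Fin n) : star (F.hInv α β) = F.hInv β α := by
  refine F.eq_of_sum_mul_h (a := fun β => star (F.hInv α β)) (b := fun β => F.hInv β α)
    (fun γ => ?_) β
  rw [F.h_hInv]
  simpa [F.star_h, mul_comm, apply_ite star] using congrArg star (F.hInv_h α γ)

/-! ### The connection -/

/-- The connection form along `Z_β`. -/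
def wh (α γ β : Fin n) : A :=
  ∑ δ, F.hInv γ δ * (F.Z β (F.h α δ) - ∑ σ, F.h α σ * star (F.wa δ σ β))

/-- The connection form. -/
def om (α γ : Fin n) : Dir n → A
  | .zero => F.w0 α γ
  | .hol β => F.wh α γ β
  | .anti β => F.wa α γ β

/-- The torsion. -/
def tor (α β : Fin n) : A := -∑ γ, F.h α γ * F.r β γ

theorem sum_wh_mul_h (α β δ : Fin n) : ∑ γ, F.wh α γ β * F.h γ δ =
    F.Z β (F.h α δ) - ∑ σ, F.h α σ * star (F.wa δ σ β) := by
  simp only [wh, Finset.sum_mul]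
  rw [Finset.sum_comm]
  have : ∀ μ, ∑ γ, F.hInv γ μ * (F.Z β (F.h α μ) - ∑ σ, F.h α σ * star (F.wa μ σ β)) * F.h γ δ =
      (F.Z β (F.h α μ) - ∑ σ, F.h α σ * star (F.wa μ σ β)) * if μ = δ then 1 else 0 := by
    intro μ
    rw [← F.h_hInv, Finset.mul_sum]
    exact Finset.sum_congr rfl fun _ _ => by ring
  simp [this]

/-- This is `d²θ = 0` on `Z_α, Z_β, Z_γ̄`: the `T`-component of the Jacobi identity. It says that
the connection has no torsion in pure (1,0) directions. The identity comes multiplied by `i` and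
with an index lowered by `h`; both are cancelled. -/
theorem c_eq (α β δ : Fin n) : F.c α β δ = F.wh β δ α - F.wh α δ β := by
  refine F.eq_of_sum_mul_h (a := F.c α β) (b := fun δ => F.wh β δ α - F.wh α δ β)
    (fun γ => ?_) δ
  have := F.isStructure.jacobi F.frameIndep (.hol α) (.hol β) (.anti γ) .zero
  simp only [Dir.sum_eq, C, e, map_neg, derivation_iu_mul, mul_zero, Finset.sum_const_zero,
    zero_add, add_zero, map_zero] at this
  simp only [sub_mul, Finset.sum_sub_distrib, sum_wh_mul_h]
  rw [← sub_eq_zero]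
  apply iu_mul_eq_zero
  simp only [mul_neg, neg_mul, neg_neg, Finset.sum_neg_distrib, mul_left_comm _ (iu A),
    ← Finset.mul_sum, mul_comm (star _) (F.h _ _)] at this
  linear_combination this

/-- This is `d²θ = 0` on `T, Z_α, Z_β`; the symmetry of the torsion is thus a consequence of the
bracket relations. -/
theorem tor_symm (α β : Fin n) : F.tor α β = F.tor β α := by
  have := F.isStructure.jacobi F.frameIndep .zero (.hol α) (.hol β) .zero
  simp only [Dir.sum_eq, C, e, mul_zero, Finset.sum_const_zero,
    zero_add, add_zero, map_zero, mul_neg, neg_mul, neg_neg, Finset.sum_neg_distrib, mul_left_comm _ (iu A),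
    ← Finset.mul_sum] at this
  simp only [mul_comm (F.r _ _)] at this
  rw [tor, tor, ← sub_eq_zero]
  apply iu_mul_eq_zero
  linear_combination -this

/-- This is `d²θ = 0` on `T, Z_α, Z_δ̄`. Compatibility of the connection with `h` is built into
`wh`, but along `T` it has to be derived, since `w0` is read off from `[T, Z_α]`. -/
theorem T_h (α δ : Fin n) : F.T (F.h α δ) =
    ∑ γ, F.w0 α γ * F.h γ δ + ∑ σ, F.h α σ * star (F.w0 δ σ) := by
  have := F.isStructure.jacobi F.frameIndep .zero (.hol α) (.anti δ) .zero
  simp only [Dir.sum_eq, C, e, map_neg, derivation_iu_mul, mul_zero, Finset.sum_const_zero,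
    zero_add, add_zero, map_zero] at this
  simp only [mul_neg, neg_mul, neg_neg, mul_left_comm _ (iu A),
    ← Finset.mul_sum, mul_comm (star _) (F.h _ _)] at this
  rw [← sub_eq_zero]
  apply iu_mul_eq_zero
  linear_combination -this

theorem e_h (d : Dir n) (α δ : Fin n) : F.e d (F.h α δ) =
    ∑ γ, F.om α γ d * F.h γ δ + ∑ σ, F.h α σ * star (F.om δ σ d.conj) := by
  have key : ∀ β α δ, F.Z β (F.h α δ) =
    ∑ γ, F.wh α γ β * F.h γ δ + ∑ σ, F.h α σ * star (F.wa δ σ β) := fun β α δ => by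
    rw [sum_wh_mul_h]; ring
  cases d with
  | zero => exact F.T_h α δ
  | hol β => exact key β α δ
  | anti β =>
    -- As `h` is Hermitian, the antiholomorphic direction is the conjugate of the holomorphic one.
    have := congrArg star (key β δ α)
    simp only [star_Z, star_h, star_add, star_sum, star_mul', star_star] at this
    simp only [e, om, Dir.conj, this]
    rw [add_comm]
    simp only [mul_comm]

end FrameAlgebra
end CRGeom

/-! ### Covariant derivatives, the Ricci form and the contracted Bianchi identity. -/

namespace CRGeom
namespace FrameAlgebra

variable {n : ℕ} {A : Type*} [CommRing A] [StarRing A] [Algebra ℂ A] [StarModule ℂ A]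
  (F : FrameAlgebra n A)

/-! ### Covariant derivatives -/

/-- The covariant derivative of a form of type `(1,0)`. -/
def cov (d : Dir n) (σ : Fin n → A) (α : Fin n) : A := F.e d (σ α) - ∑ γ, F.om α γ d * σ γ

/-- The covariant derivative of a form of type `(0,1)`. -/
def covBar (d : Dir n) (σ : Fin n → A) (α : Fin n) : A :=
  F.e d (σ α) - ∑ γ, star (F.om α γ d.conj) * σ γ

/-- The divergence of a form of type `(1,0)`. -/
def div (σ : Fin n → A) : A := ∑ α, ∑ β, F.hInv α β * F.cov (.anti β) σ α

/-- The divergence of a form of type `(0,1)`. -/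
def divBar (σ : Fin n → A) : A := ∑ α, ∑ β, F.hInv α β * F.covBar (.hol α) σ β

/-- `∇^α u`. -/
def gradUp (u : A) (α : Fin n) : A := ∑ β, F.hInv α β * F.Zb β u

/-- `∇^ᾱ u`. -/
def gradBarUp (u : A) (α : Fin n) : A := ∑ β, F.hInv β α * F.Z β u

/-- The sublaplacian. -/
def lap (u : A) : A := -(F.div (fun α => F.Z α u) + F.divBar (fun α => F.Zb α u))

/-- `∇^α (A_{αβ} ∇^β u)`. -/
def torsionDiv (u : A) : A := F.div (fun α => ∑ β, F.tor α β * F.gradUp u β)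

/-- The covariant derivative of the torsion in an antiholomorphic direction. -/
def covTor (γ α β : Fin n) : A := F.Zb γ (F.tor α β) - ∑ δ, F.wa α δ γ * F.tor δ β -
  ∑ δ, F.wa β δ γ * F.tor α δ

/-- `∇^β A_{αβ}`. -/
def divTor (α : Fin n) : A := ∑ β, ∑ γ, F.hInv β γ * F.covTor γ α β

/-! ### The curvature form of the canonical bundle -/

/-- The trace of the connection form. -/
def trOm (d : Dir n) : A := ∑ γ, F.om γ γ d

/-- The trace of the curvature form. -/
def rho : Dir n → Dir n → A := dForm F.e F.C F.trOm

/-- The Ricci tensor. -/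
def ric (α β : Fin n) : A := F.rho (.hol α) (.anti β)

/-- The scalar curvature. -/
def scal : A := ∑ α, ∑ β, F.hInv α β * F.ric α β

/-- Trace over `δ` of the `Z_δ`-component of the Jacobi identity for `Z_β̄, Z_γ̄, Z_δ`. What
survives is the antisymmetrized torsion, which is zero by `tor_symm`. -/
theorem rho_anti_anti (β γ : Fin n) : F.rho (.anti β) (.anti γ) = 0 := by
  have := Finset.sum_congr rfl fun δ (_ : δ ∈ Finset.univ) =>
    F.isStructure.jacobi F.frameIndep (.anti β) (.anti γ) (.hol δ) (.hol δ)
  simp only [Dir.sum_eq, C, e, mul_zero, zero_mul, Finset.sum_const_zero,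
    zero_add, add_zero, map_zero, Finset.sum_add_distrib, map_neg, neg_mul, mul_neg,
    Finset.sum_neg_distrib, mul_assoc (iu A), ← Finset.mul_sum _ _ (iu A)] at this
  have h1 : ∑ x, F.h x γ * star (F.r β x) = ∑ x, F.h x β * star (F.r γ x) := by
    simpa [tor, star_sum, F.star_h] using congrArg star (F.tor_symm γ β)
  have h2 : ∑ x, ∑ y, F.wa x y γ * F.wa y x β = ∑ x, ∑ y, F.wa x y β * F.wa y x γ := by
    rw [Finset.sum_comm]; simp only [mul_comm]
  have h3 : ∑ x, ∑ y, star (F.c β γ y) * F.wa x x y = ∑ y, ∑ x, star (F.c β γ y) * F.wa x x y :=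
    Finset.sum_comm
  simp only [rho, dForm, Dir.sum_eq, C, trOm, e, om, map_sum, Finset.mul_sum, zero_mul,
    Finset.sum_const_zero, zero_add]
  linear_combination this + iu A * h1 - h2 + h3

/-- Since `h` is parallel, lowering an index commutes with the derivative. By symmetry the torsion
is written so that `β` sits on `h`; contracting with the inverse Levi form in `divTor_eq` then
removes `h`. -/
theorem covTor_eq (ν γ β : Fin n) : F.covTor ν γ β = -∑ μ, F.h β μ * (F.Zb ν (F.r γ μ) +
    ∑ κ, star (F.wh κ μ ν) * F.r γ κ - ∑ δ, F.wa γ δ ν * F.r δ μ) := by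
  have h1 : ∀ μ, F.Zb ν (F.h β μ) = _ := F.e_h (.anti ν) β
  simp only [om, Dir.conj] at h1
  have hs : F.covTor ν γ β = F.Zb ν (F.tor β γ) - ∑ δ, F.wa γ δ ν * F.tor β δ -
      ∑ δ, F.wa β δ ν * F.tor δ γ := by
    rw [covTor, F.tor_symm γ β]
    simp only [F.tor_symm _ β, F.tor_symm γ]
  simp only [hs, tor, map_neg, map_sum, Derivation.leibniz, h1, smul_eq_mul, mul_add, mul_sub,
    Finset.sum_add_distrib, Finset.sum_sub_distrib, Finset.mul_sum, mul_neg,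
    Finset.sum_neg_distrib]
  have h2 : ∑ μ, ∑ δ, F.r γ μ * (F.wa β δ ν * F.h δ μ) =
      ∑ δ, ∑ μ, F.wa β δ ν * (F.h δ μ * F.r γ μ) := by
    rw [Finset.sum_comm]
    exact Finset.sum_congr rfl fun _ _ => Finset.sum_congr rfl fun _ _ => by ring
  have h3 : ∑ μ, ∑ σ, F.r γ μ * (F.h β σ * star (F.wh μ σ ν)) =
      ∑ μ, ∑ κ, F.h β μ * (star (F.wh κ μ ν) * F.r γ κ) := by
    rw [Finset.sum_comm]
    exact Finset.sum_congr rfl fun _ _ => Finset.sum_congr rfl fun _ _ => by ring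
  have h4 : ∑ μ, ∑ δ, F.wa γ μ ν * (F.h β δ * F.r μ δ) =
      ∑ μ, ∑ δ, F.h β μ * (F.wa γ δ ν * F.r δ μ) := by
    rw [Finset.sum_comm]
    exact Finset.sum_congr rfl fun _ _ => Finset.sum_congr rfl fun _ _ => by ring
  linear_combination -h2 - h3 + h4

theorem sum_hInv_mul_sum_h (X : Fin n → Fin n → A) :
    ∑ β, ∑ ν, F.hInv β ν * ∑ μ, F.h β μ * X ν μ = ∑ ν, X ν ν := by
  rw [Finset.sum_comm]
  refine Finset.sum_congr rfl fun ν _ => ?_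
  have : ∑ μ, (∑ β, F.hInv β ν * F.h β μ) * X ν μ = X ν ν := by simp [F.h_hInv]
  rw [← this]
  simp only [Finset.mul_sum, Finset.sum_mul]
  rw [Finset.sum_comm]
  exact Finset.sum_congr rfl fun _ _ => Finset.sum_congr rfl fun _ _ => by ring

theorem divTor_eq (γ : Fin n) : F.divTor γ = -∑ ν, (F.Zb ν (F.r γ ν) +
    ∑ κ, star (F.wh κ ν ν) * F.r γ κ - ∑ δ, F.wa γ δ ν * F.r δ ν) := by
  simp only [divTor, covTor_eq, mul_neg, Finset.sum_neg_distrib]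
  rw [F.sum_hInv_mul_sum_h fun ν μ => F.Zb ν (F.r γ μ) +
    ∑ κ, star (F.wh κ μ ν) * F.r γ κ - ∑ δ, F.wa γ δ ν * F.r δ μ]

/-- Trace over `δ` of the `Z_δ`-component of the Jacobi identity for `T, Z_γ̄, Z_δ`. This is how the
divergence of the torsion enters the Bianchi identity. -/
theorem rho_zero_anti (γ : Fin n) : F.rho .zero (.anti γ) = star (F.divTor γ) := by
  have := Finset.sum_congr rfl fun δ (_ : δ ∈ Finset.univ) =>
    F.isStructure.jacobi F.frameIndep .zero (.anti γ) (.hol δ) (.hol δ)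
  simp only [Dir.sum_eq, C, e, mul_zero, zero_mul, Finset.sum_const_zero,
    zero_add, add_zero, Finset.sum_add_distrib, map_neg, neg_mul, mul_neg,
    Finset.sum_neg_distrib, c_eq, mul_sub, Finset.sum_sub_distrib] at this
  have h1 : ∑ x, ∑ y, F.wa x y γ * F.w0 y x = ∑ x, ∑ y, F.w0 x y * F.wa y x γ := by
    rw [Finset.sum_comm]; simp only [mul_comm]
  have h2 : ∑ x, ∑ y, star (F.w0 γ y) * F.wa x x y = ∑ y, ∑ x, star (F.w0 γ y) * F.wa x x y :=
    Finset.sum_comm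
  have h3 : ∑ x, ∑ y, star (F.r γ y) * F.wh x x y = ∑ y, ∑ x, star (F.r γ y) * F.wh x x y :=
    Finset.sum_comm
  simp only [rho, dForm, Dir.sum_eq, C, trOm, e, om, map_sum, Finset.mul_sum, zero_mul,
    Finset.sum_const_zero, zero_add, divTor_eq, star_neg, star_sum, star_add, star_sub, star_mul', star_star, star_Zb,
    Finset.sum_add_distrib, Finset.sum_sub_distrib, mul_comm (F.wh _ _ _) (star (F.r _ _))]
  linear_combination this - h1 + h2 + h3

theorem sum_h_mul_hInv (D : Fin n → A) (δ : Fin n) :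
    ∑ μ, F.hInv μ δ * ∑ β, F.h μ β * D β = D δ := by
  have : ∑ β, (∑ μ, F.hInv μ δ * F.h μ β) * D β = D δ := by simp [F.h_hInv]
  rw [← this]
  simp only [Finset.mul_sum, Finset.sum_mul]
  rw [Finset.sum_comm]
  exact Finset.sum_congr rfl fun _ _ => Finset.sum_congr rfl fun _ _ => by ring

theorem derivation_hInv (D : Derivation ℂ A A) (α δ : Fin n) : D (F.hInv α δ) =
    -∑ μ, ∑ σ, F.hInv α σ * F.hInv μ δ * D (F.h μ σ) := by
  have h1 : ∀ μ, ∑ β, F.h μ β * D (F.hInv α β) = -∑ β, F.hInv α β * D (F.h μ β) := by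
    intro μ
    have := congrArg D (F.hInv_h α μ)
    simp only [map_sum, Derivation.leibniz, smul_eq_mul, Finset.sum_add_distrib, apply_ite D,
      map_zero, Derivation.map_one_eq_zero, ite_self] at this
    linear_combination this
  rw [← F.sum_h_mul_hInv (fun β => D (F.hInv α β)) δ]
  simp only [h1, mul_neg, Finset.sum_neg_distrib, Finset.mul_sum]
  congr 1
  exact Finset.sum_congr rfl fun _ _ => Finset.sum_congr rfl fun _ _ => by ring

/-- `d log det h`. -/
theorem trOm_add_star (d : Dir n) : F.trOm d + star (F.trOm d.conj) =
    ∑ α, ∑ δ, F.hInv α δ * F.e d (F.h α δ) := by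
  have h1 : ∑ α, ∑ δ, F.hInv α δ * ∑ γ, F.om α γ d * F.h γ δ = F.trOm d := by
    refine Finset.sum_congr rfl fun α _ => ?_
    have : ∑ γ, F.om α γ d * ∑ δ, F.hInv α δ * F.h γ δ = F.om α α d := by simp [F.hInv_h]
    rw [← this]
    simp only [Finset.mul_sum]
    rw [Finset.sum_comm]
    exact Finset.sum_congr rfl fun _ _ => Finset.sum_congr rfl fun _ _ => by ring
  have h2 := F.sum_hInv_mul_sum_h fun δ σ => star (F.om δ σ d.conj)
  simp only [e_h, mul_add, Finset.sum_add_distrib, h1, h2, trOm, star_sum]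

theorem _root_.CRGeom.Dir.conj_conj (d : Dir n) : d.conj.conj = d := by cases d <;> rfl

/-- By `trOm_add_star`, `tr ω` plus its conjugate is the trace of `h⁻¹ dh`, formally `d log det h`,
which is closed. Hence `ρ` is purely imaginary and the Ricci tensor is Hermitian. -/
theorem rho_add_star (i j : Dir n) : F.rho i j + star (F.rho i.conj j.conj) = 0 := by
  have hconj : ∀ f : Dir n → A, ∑ d : Dir n, f d.conj = ∑ d, f d := fun f =>
    Equiv.sum_comp ⟨Dir.conj, Dir.conj, Dir.conj_conj, Dir.conj_conj⟩ f
  have hη : F.rho i j + star (F.rho i.conj j.conj) =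
      dForm F.e F.C (fun d => ∑ α, ∑ δ, F.hInv α δ * F.e d (F.h α δ)) i j := by
    simp only [← trOm_add_star, dForm, rho, star_sub, star_sum, star_mul', star_e, star_C,
      Dir.conj_conj, map_add, mul_add, Finset.sum_add_distrib]
    rw [← hconj fun d => F.C i j d * star (F.trOm d.conj)]
    simp only [Dir.conj_conj]
    ring
  have hcross : ∀ i j, ∑ α, ∑ δ, F.e j (F.h α δ) * F.e i (F.hInv α δ) = -∑ α, ∑ δ, ∑ μ, ∑ σ,
      F.e j (F.h α δ) * (F.hInv α σ * F.hInv μ δ * F.e i (F.h μ σ)) := by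
    intro i j
    simp only [derivation_hInv, mul_neg, Finset.sum_neg_distrib, Finset.mul_sum]
  -- Both sides are minus the trace of `h⁻¹ (e_i h) h⁻¹ (e_j h)`, which is symmetric in `i, j` by
  -- cyclicity; the equivalence swaps the two pairs of summation indices.
  have hsymm : ∑ α, ∑ δ, F.e j (F.h α δ) * F.e i (F.hInv α δ) =
      ∑ α, ∑ δ, F.e i (F.h α δ) * F.e j (F.hInv α δ) := by
    rw [hcross, hcross]
    congr 1
    simp only [← Fintype.sum_prod_type']
    refine Fintype.sum_equiv ⟨fun p => ⟨p.2.2.1, p.2.2.2, p.1, p.2.1⟩,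
      fun p => ⟨p.2.2.1, p.2.2.2, p.1, p.2.1⟩, fun _ => rfl, fun _ => rfl⟩ _ _ fun p => ?_
    simp only [Equiv.coe_fn_mk]
    ring
  have hC : ∑ α, ∑ δ, F.hInv α δ * (F.e i (F.e j (F.h α δ)) - F.e j (F.e i (F.h α δ))) =
      ∑ k, F.C i j k * ∑ α, ∑ δ, F.hInv α δ * F.e k (F.h α δ) := by
    simp only [F.isStructure i j, Finset.mul_sum]
    rw [Finset.sum_congr rfl fun α _ => Finset.sum_comm, Finset.sum_comm]
    exact Finset.sum_congr rfl fun _ _ => Finset.sum_congr rfl fun _ _ =>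
      Finset.sum_congr rfl fun _ _ => by ring
  rw [hη]
  simp only [dForm, map_sum, Derivation.leibniz, smul_eq_mul, Finset.sum_add_distrib, ← hC,
    mul_sub, Finset.sum_sub_distrib]
  linear_combination hsymm

theorem star_ric (α β : Fin n) : star (F.ric α β) = F.ric β α := by
  have h1 := F.rho_add_star (.anti α) (.hol β)
  have h2 := F.isStructure.dForm_antisymm F.frameIndep F.trOm (.hol β) (.anti α)
  simp only [Dir.conj, rho, ric] at h1 h2 ⊢
  linear_combination h1 - h2

theorem star_scal : star F.scal = F.scal := by
  simp only [scal, star_sum, star_mul', star_ric, star_hInv]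
  exact Finset.sum_comm

theorem e_hInv (d : Dir n) (α δ : Fin n) : F.e d (F.hInv α δ) =
    -∑ μ, F.hInv μ δ * F.om μ α d - ∑ σ, F.hInv α σ * star (F.om σ δ d.conj) := by
  have h1 : ∑ μ, ∑ σ, F.hInv α σ * F.hInv μ δ * ∑ γ, F.om μ γ d * F.h γ σ =
      ∑ μ, F.hInv μ δ * F.om μ α d := by
    refine Finset.sum_congr rfl fun μ _ => ?_
    have : ∑ γ, F.om μ γ d * ∑ σ, F.hInv α σ * F.h γ σ = F.om μ α d := by simp [F.hInv_h]
    rw [← this]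
    simp only [Finset.mul_sum]
    rw [Finset.sum_comm]
    exact Finset.sum_congr rfl fun _ _ => Finset.sum_congr rfl fun _ _ => by ring
  have h2 : ∑ μ, ∑ σ, F.hInv α σ * F.hInv μ δ * ∑ γ, F.h μ γ * star (F.om σ γ d.conj) =
      ∑ σ, F.hInv α σ * star (F.om σ δ d.conj) := by
    rw [Finset.sum_comm]
    refine Finset.sum_congr rfl fun σ _ => ?_
    rw [← F.sum_h_mul_hInv (fun γ => star (F.om σ γ d.conj)) δ, Finset.mul_sum]
    exact Finset.sum_congr rfl fun _ _ => by ring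
  simp only [derivation_hInv, e_h, mul_add, Finset.sum_add_distrib, h1, h2]
  ring

/-- The covariant derivative `∇_β̄ t_{δγ̄}`. -/
def covMixed (β : Fin n) (t : Fin n → Fin n → A) (δ γ : Fin n) : A :=
  F.Zb β (t δ γ) - ∑ ν, F.wa δ ν β * t ν γ - ∑ ν, star (F.wh γ ν β) * t δ ν

/-- The inverse Levi form is parallel (`e_hInv`), so the trace commutes with covariant
differentiation. -/
theorem sum_hInv_mul_covMixed (γ : Fin n) (t : Fin n → Fin n → A) :
    ∑ δ, ∑ β, F.hInv δ β * F.covMixed γ t δ β = F.Zb γ (∑ δ, ∑ β, F.hInv δ β * t δ β) := by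
  have h0 : ∀ α δ, F.Zb γ (F.hInv α δ) = _ := F.e_hInv (.anti γ)
  simp only [om, Dir.conj] at h0
  simp only [covMixed, map_sum, Derivation.leibniz, smul_eq_mul, h0, mul_sub, mul_neg,
    Finset.sum_add_distrib, Finset.sum_sub_distrib, Finset.mul_sum, Finset.sum_neg_distrib]
  have h1 : ∑ δ, ∑ β, ∑ μ, t δ β * (F.hInv μ β * F.wa μ δ γ) =
      ∑ δ, ∑ β, ∑ ν, F.hInv δ β * (F.wa δ ν γ * t ν β) := by
    rw [Finset.sum_congr rfl fun _ _ => Finset.sum_comm, Finset.sum_comm,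
      Finset.sum_congr rfl fun _ _ => Finset.sum_comm]
    exact Finset.sum_congr rfl fun _ _ => Finset.sum_congr rfl fun _ _ =>
      Finset.sum_congr rfl fun _ _ => by ring
  have h2 : ∑ δ, ∑ β, ∑ σ, t δ β * (F.hInv δ σ * star (F.wh σ β γ)) =
      ∑ δ, ∑ β, ∑ ν, F.hInv δ β * (star (F.wh β ν γ) * t δ ν) := by
    rw [Finset.sum_congr rfl fun _ _ => Finset.sum_comm]
    exact Finset.sum_congr rfl fun _ _ => Finset.sum_congr rfl fun _ _ =>
      Finset.sum_congr rfl fun _ _ => by ring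
  linear_combination h1 + h2

/-- This is `dρ = 0` on `Z_δ, Z_β̄, Z_γ̄`. The brackets of `Z_δ` with `Z_β̄` and `Z_γ̄` have
`T`-components proportional to `h`; these pair with `ρ(T, ·)`, the conjugate divergence of the
torsion. -/
theorem covMixed_ric (β γ δ : Fin n) : F.covMixed β F.ric δ γ = F.covMixed γ F.ric δ β +
    iu A * F.h δ β * star (F.divTor γ) - iu A * F.h δ γ * star (F.divTor β) := by
  have := F.isStructure.d_dForm F.frameIndep F.trOm (.hol δ) (.anti β) (.anti γ)
  have hanti : ∀ γ δ, F.rho (.anti γ) (.hol δ) = -F.ric δ γ := fun γ δ =>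
    F.isStructure.dForm_antisymm F.frameIndep F.trOm _ _
  have hric : ∀ δ γ, F.rho (.hol δ) (.anti γ) = F.ric δ γ := fun _ _ => rfl
  simp only [show dForm F.e F.C F.trOm = F.rho from rfl, Dir.sum_eq, hanti, hric, rho_anti_anti, rho_zero_anti, C, e, c_eq, map_neg,
    map_zero, mul_zero, zero_mul, neg_mul, mul_neg, Finset.sum_const_zero, add_zero, zero_add,
    Finset.sum_neg_distrib, star_sub, sub_mul, Finset.sum_sub_distrib] at this
  simp only [covMixed]
  linear_combination -this

theorem sum_hInv_mul_h : ∑ δ, ∑ β, F.hInv δ β * F.h δ β = n := by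
  simp [F.hInv_h]

/-- Contraction of `covMixed_ric` over `δ, β`. The first torsion term is multiplied by the trace `n`
of `h`, the second is merely reindexed, whence `n - 1`. -/
theorem bianchi (γ : Fin n) : ∑ δ, ∑ β, F.hInv δ β * F.covMixed β F.ric δ γ =
    F.Zb γ F.scal + iu A * (n - 1) * star (F.divTor γ) := by
  have h1 : ∑ δ, ∑ β, F.hInv δ β * (iu A * F.h δ β * star (F.divTor γ)) =
      iu A * n * star (F.divTor γ) := by
    rw [← F.sum_hInv_mul_h]
    simp only [Finset.mul_sum, Finset.sum_mul]
    exact Finset.sum_congr rfl fun _ _ => Finset.sum_congr rfl fun _ _ => by ring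
  have h2 : ∑ δ, ∑ β, F.hInv δ β * (iu A * F.h δ γ * star (F.divTor β)) =
      iu A * star (F.divTor γ) := by
    have : ∑ β, (∑ δ, F.hInv δ β * F.h δ γ) * star (F.divTor β) = star (F.divTor γ) := by
      simp [F.h_hInv]
    rw [Finset.sum_comm, ← this]
    simp only [Finset.mul_sum, Finset.sum_mul]
    exact Finset.sum_congr rfl fun _ _ => Finset.sum_congr rfl fun _ _ => by ring
  simp only [F.covMixed_ric _ γ, mul_sub, mul_add, Finset.sum_add_distrib, Finset.sum_sub_distrib,
    sum_hInv_mul_covMixed, h1, h2, scal]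
  ring

end FrameAlgebra
end CRGeom

/-! ### Identities for CR and pluriharmonic functions. -/

namespace CRGeom
namespace FrameAlgebra

theorem algebraMap_inv_natCast {A : Type*} [CommRing A] [Algebra ℂ A] {n : ℕ} (hn : n ≠ 0) :
    algebraMap ℂ A (n : ℂ)⁻¹ * n = 1 := by
  rw [← map_natCast (algebraMap ℂ A) n, ← map_mul, inv_mul_cancel₀ (by exact_mod_cast hn), map_one]

variable {n : ℕ} {A : Type*} [CommRing A] [StarRing A] [Algebra ℂ A] [StarModule ℂ A]
  (F : FrameAlgebra n A)

/-! ### Pluriharmonic functions -/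

theorem star_div (σ : Fin n → A) : star (F.div σ) = F.divBar (fun α => star (σ α)) := by
  simp only [div, divBar, star_sum, star_mul', star_hInv, cov, covBar, star_sub, star_e, Dir.conj]
  exact Finset.sum_comm

theorem star_gradUp (u : A) (α : Fin n) : star (F.gradUp u α) = F.gradBarUp (star u) α := by
  simp only [gradUp, gradBarUp, star_sum, star_mul', star_hInv, star_Zb]

theorem star_lap (u : A) : star (F.lap u) = F.lap (star u) := by
  have h1 := F.star_div fun α => F.Z α u
  have h2 := F.star_div fun α => F.Z α (star u)
  simp only [star_Z, star_star] at h1 h2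
  rw [lap, lap, star_neg, star_add, h1, ← h2, star_star, add_comm]

theorem star_torsionDiv (u : A) : star (F.torsionDiv u) =
    F.divBar (fun α => ∑ β, star (F.tor α β) * F.gradBarUp (star u) β) := by
  simp only [torsionDiv, star_div, star_sum, star_mul', star_gradUp]

theorem Zb_Z (α β : Fin n) (u : A) : F.Zb β (F.Z α u) - ∑ γ, F.wa α γ β * F.Z γ u =
    F.Z α (F.Zb β u) - ∑ γ, star (F.wa β γ α) * F.Zb γ u + iu A * F.h α β * F.T u := by
  have := F.lie_Z_Zb α β u
  rw [← iu] at this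
  linear_combination -this

/-- Trace of the commutation relation `Zb_Z`; it allows the sublaplacian to be written with
derivatives `Z_ᾱ u` and `T u` only, which suits functions killed by all `Z_ᾱ`. -/
theorem div_grad (u : A) :
    F.div (fun α => F.Z α u) = F.divBar (fun α => F.Zb α u) + iu A * n * F.T u := by
  simp only [div, divBar, cov, covBar, e, om, Dir.conj, F.Zb_Z, mul_add, Finset.sum_add_distrib,
    ← F.sum_hInv_mul_h]
  congr 1
  simp only [Finset.mul_sum, Finset.sum_mul]
  exact Finset.sum_congr rfl fun _ _ => Finset.sum_congr rfl fun _ _ => by ring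

theorem lap_eq (u : A) : F.lap u = -(2 * F.divBar (fun α => F.Zb α u) + iu A * n * F.T u) := by
  rw [lap, div_grad]; ring

theorem lap_add (u v : A) : F.lap (u + v) = F.lap u + F.lap v := by
  simp only [lap, div, divBar, cov, covBar, map_add, mul_add, mul_sub, Finset.sum_add_distrib,
    Finset.sum_sub_distrib]
  ring

theorem lap_smul (c : ℂ) (u : A) : F.lap (c • u) = c • F.lap u := by
  simp only [lap, div, divBar, cov, covBar, Derivation.map_smul, mul_smul_comm, ← Finset.smul_sum,
    ← smul_sub, ← smul_add, smul_neg]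

theorem torsionDiv_add (u v : A) : F.torsionDiv (u + v) = F.torsionDiv u + F.torsionDiv v := by
  simp only [torsionDiv, gradUp, div, cov, map_add, mul_add, mul_sub, Finset.sum_add_distrib,
    Finset.sum_sub_distrib]
  ring

section CR

variable {v : A} (hv : ∀ α, F.Zb α v = 0)
include hv

theorem lap_of_cr : F.lap v = -(iu A * n * F.T v) := by
  simp [lap_eq, hv, divBar, covBar]

theorem torsionDiv_of_cr : F.torsionDiv v = 0 := by
  simp [torsionDiv, hv, gradUp, div, cov]

/-- On a CR function `[T, Z_β̄] v` reduces to `-Z_β̄ T v`, while the only part of the bracket that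
sees `v` is its (1,0) part, which is the conjugate torsion. So `T v` fails to be CR exactly by the
torsion. -/
theorem sum_star_tor_mul_gradBarUp (β : Fin n) :
    ∑ γ, star (F.tor β γ) * F.gradBarUp v γ = F.Zb β (F.T v) := by
  have h1 := F.lie_T_Zb β v
  simp only [hv, map_zero, mul_zero, Finset.sum_const_zero] at h1
  have h2 : ∀ γ, star (F.tor β γ) = -∑ κ, F.h κ γ * star (F.r β κ) := fun γ => by
    rw [tor_symm, tor, star_neg, star_sum]
    simp only [star_mul', star_h]
  have h3 : ∑ μ, ∑ κ, (∑ γ, F.hInv μ γ * F.h κ γ) * (star (F.r β κ) * F.Z μ v) =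
      ∑ κ, star (F.r β κ) * F.Z κ v := by
    simp [F.hInv_h]
  have h4 : ∑ γ, star (F.tor β γ) * F.gradBarUp v γ =
      -∑ μ, ∑ κ, (∑ γ, F.hInv μ γ * F.h κ γ) * (star (F.r β κ) * F.Z μ v) := by
    simp only [h2, gradBarUp, neg_mul, Finset.sum_neg_distrib, Finset.mul_sum, Finset.sum_mul]
    congr 1
    rw [Finset.sum_comm]
    refine Finset.sum_congr rfl fun _ _ => ?_
    rw [Finset.sum_comm]
    exact Finset.sum_congr rfl fun _ _ => Finset.sum_congr rfl fun _ _ => by ring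
  rw [h4, h3]
  linear_combination h1

theorem lap_T_of_cr : F.lap (F.T v) =
    -(2 * star (F.torsionDiv (star v)) + iu A * n * F.T (F.T v)) := by
  simp only [lap_eq, star_torsionDiv, star_star, F.sum_star_tor_mul_gradBarUp hv]

/-- The first `Δ_b` replaces `v` by `-i n T v`; the second is then `lap_T_of_cr`. -/
theorem lap_lap_of_cr : F.lap (F.lap v) =
    2 * iu A * n * star (F.torsionDiv (star v)) - (n : A) ^ 2 * F.T (F.T v) := by
  have h : F.lap v = (-(Complex.I * n)) • F.T v := by
    rw [F.lap_of_cr hv, Algebra.smul_def, map_neg, map_mul, map_natCast, ← iu, neg_mul]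
  rw [h, lap_smul, F.lap_T_of_cr hv, Algebra.smul_def, map_neg, map_mul, map_natCast, ← iu]
  linear_combination (n : A) ^ 2 * F.T (F.T v) * iu_mul_iu (A := A)

/-- The square of the sublaplacian of a pluriharmonic function. -/
theorem lap_lap_of_pluriharmonic :
    F.lap (F.lap (v + star v)) + (n : A) ^ 2 * F.T (F.T (v + star v)) =
      2 * iu A * n * (star (F.torsionDiv (v + star v)) - F.torsionDiv (v + star v)) := by
  have h1 := F.lap_lap_of_cr hv
  have h2 := congrArg star h1
  simp only [star_lap, star_sub, star_mul', star_star, star_iu, star_pow, star_T, star_natCast,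
    star_ofNat] at h2
  -- `torsionDiv v = 0` because it involves only `Z_β̄ v`, so `torsionDiv` of the sum is that of
  -- `star v`; the claim is the identity for `v` plus its conjugate.
  simp only [lap_add, map_add, torsionDiv_add, F.torsionDiv_of_cr hv, zero_add, h1, h2]
  ring

/-- The mixed second derivative of a CR function is pure trace: `∇_β̄ ∇_α v` equals `∇_α ∇_β̄ v = 0`
plus the commutator term `i h T v`, and raising the index turns `h` into the identity. -/
theorem Zb_gradBarUp_of_cr (β γ : Fin n) :
    F.Zb β (F.gradBarUp v γ) + ∑ ν, star (F.wh ν γ β) * F.gradBarUp v ν =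
      if γ = β then iu A * F.T v else 0 := by
  have h0 : ∀ α δ, F.Zb β (F.hInv α δ) = _ := F.e_hInv (.anti β)
  simp only [om, Dir.conj] at h0
  have h1 : ∀ μ, F.Zb β (F.Z μ v) = ∑ γ, F.wa μ γ β * F.Z γ v + iu A * F.h μ β * F.T v := by
    intro μ
    have := F.Zb_Z μ β v
    simp only [hv, map_zero, mul_zero, Finset.sum_const_zero] at this
    linear_combination this
  have h2 : ∑ μ, F.hInv μ γ * (iu A * F.h μ β * F.T v) = if γ = β then iu A * F.T v else 0 := by
    have : (∑ μ, F.hInv μ γ * F.h μ β) * (iu A * F.T v) = if γ = β then iu A * F.T v else 0 := by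
      simp [F.h_hInv]
    rw [← this, Finset.sum_mul]
    exact Finset.sum_congr rfl fun _ _ => by ring
  rw [← h2]
  simp only [gradBarUp, map_sum, Derivation.leibniz, smul_eq_mul, h0, h1, mul_add, mul_sub,
    mul_neg, Finset.sum_add_distrib, Finset.sum_sub_distrib, Finset.sum_neg_distrib,
    Finset.mul_sum]
  have h3 : ∑ μ, ∑ κ, F.hInv μ γ * (F.wa μ κ β * F.Z κ v) =
      ∑ κ, ∑ μ, F.Z κ v * (F.hInv μ γ * F.wa μ κ β) := by
    rw [Finset.sum_comm]
    exact Finset.sum_congr rfl fun _ _ => Finset.sum_congr rfl fun _ _ => by ring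
  have h4 : ∑ ν, ∑ μ, star (F.wh ν γ β) * (F.hInv μ ν * F.Z μ v) =
      ∑ μ, ∑ ν, F.Z μ v * (F.hInv μ ν * star (F.wh ν γ β)) := by
    rw [Finset.sum_comm]
    exact Finset.sum_congr rfl fun _ _ => Finset.sum_congr rfl fun _ _ => by ring
  linear_combination h3 + h4

/-- Divergence of a tracefree tensor contracted with the gradient of a CR function. -/
theorem div_tracefree_of_cr (t : Fin n → Fin n → A) (ht : ∑ α, ∑ β, F.hInv α β * t α β = 0) :
    F.div (fun δ => ∑ γ, t δ γ * F.gradBarUp v γ) =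
      ∑ γ, (∑ δ, ∑ β, F.hInv δ β * F.covMixed β t δ γ) * F.gradBarUp v γ := by
  have h1 : ∀ δ β, F.cov (.anti β) (fun δ => ∑ γ, t δ γ * F.gradBarUp v γ) δ =
      ∑ γ, F.covMixed β t δ γ * F.gradBarUp v γ + t δ β * (iu A * F.T v) := by
    intro δ β
    -- The second derivatives of `v`, contracted with `t`, collapse to one entry of `t` times `i T
    -- v`.
    have h2 : t δ β * (iu A * F.T v) = ∑ γ, t δ γ * (F.Zb β (F.gradBarUp v γ) +
        ∑ ν, star (F.wh ν γ β) * F.gradBarUp v ν) := by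
      simp [F.Zb_gradBarUp_of_cr hv]
    have h3 : ∑ γ, ∑ ν, t δ γ * (star (F.wh ν γ β) * F.gradBarUp v ν) =
        ∑ γ, ∑ ν, star (F.wh γ ν β) * t δ ν * F.gradBarUp v γ := by
      rw [Finset.sum_comm]
      exact Finset.sum_congr rfl fun _ _ => Finset.sum_congr rfl fun _ _ => by ring
    have h4 : ∑ ν, ∑ γ, F.wa δ ν β * (t ν γ * F.gradBarUp v γ) =
        ∑ γ, ∑ ν, F.wa δ ν β * t ν γ * F.gradBarUp v γ := by
      rw [Finset.sum_comm]
      exact Finset.sum_congr rfl fun _ _ => Finset.sum_congr rfl fun _ _ => by ring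
    rw [h2]
    simp only [cov, e, om, covMixed, map_sum, Derivation.leibniz, smul_eq_mul, mul_add, sub_mul,
      Finset.sum_add_distrib, Finset.sum_sub_distrib, Finset.mul_sum, Finset.sum_mul, h3, h4,
      mul_comm (F.gradBarUp v _)]
    ring
  -- The pure-trace Hessian meets the tracefree tensor and disappears.
  have h5 : ∑ δ, ∑ β, F.hInv δ β * (t δ β * (iu A * F.T v)) = 0 := by
    simp only [← mul_assoc, ← Finset.sum_mul, ht, zero_mul]
  simp only [div, h1, mul_add, Finset.sum_add_distrib, h5, add_zero, Finset.mul_sum,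
    Finset.sum_mul]
  rw [Finset.sum_congr rfl fun _ _ => Finset.sum_comm, Finset.sum_comm]
  exact Finset.sum_congr rfl fun _ _ => Finset.sum_congr rfl fun _ _ =>
    Finset.sum_congr rfl fun _ _ => by ring

end CR

theorem covMixed_h (β δ γ : Fin n) : F.covMixed β F.h δ γ = 0 := by
  have : F.Zb β (F.h δ γ) = _ := F.e_h (.anti β) δ γ
  simp only [om, Dir.conj] at this
  rw [covMixed, this]
  simp only [mul_comm (F.h _ _)]
  ring

/-- As `h` is parallel, only `a` is differentiated. -/
theorem sum_hInv_mul_covMixed_mul_h (a : A) (γ : Fin n) :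
    ∑ δ, ∑ β, F.hInv δ β * F.covMixed β (fun δ γ => a * F.h δ γ) δ γ = F.Zb γ a := by
  have h1 : ∀ δ β, F.covMixed β (fun δ γ => a * F.h δ γ) δ γ = F.h δ γ * F.Zb β a := by
    intro δ β
    have := F.covMixed_h β δ γ
    simp only [covMixed, Derivation.leibniz, smul_eq_mul, mul_left_comm _ a, ← Finset.mul_sum]
      at this ⊢
    linear_combination a * this
  have : ∑ β, (∑ δ, F.hInv δ β * F.h δ γ) * F.Zb β a = F.Zb γ a := by simp [F.h_hInv]
  simp only [h1, ← this, Finset.sum_mul]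
  rw [Finset.sum_comm]
  exact Finset.sum_congr rfl fun _ _ => Finset.sum_congr rfl fun _ _ => by ring

/-- The tracefree part of the Ricci tensor. -/
def ric0 (α β : Fin n) : A := F.ric α β - algebraMap ℂ A (n : ℂ)⁻¹ * F.scal * F.h α β

theorem sum_hInv_mul_ric0 (hn : n ≠ 0) : ∑ α, ∑ β, F.hInv α β * F.ric0 α β = 0 := by
  simp only [ric0, mul_sub, Finset.sum_sub_distrib, mul_left_comm (F.hInv _ _),
    ← Finset.mul_sum, sum_hInv_mul_h]
  rw [← scal]
  linear_combination -F.scal * algebraMap_inv_natCast (A := A) hn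

/-- `bianchi` minus `1/n` times the gradient of `scal`. Both the scalar and the torsion term then
contain `n - 1`; multiplying through by `n` clears the denominator. -/
theorem div_ric0 (hn : n ≠ 0) (γ : Fin n) :
    (n : A) * ∑ δ, ∑ β, F.hInv δ β * F.covMixed β F.ric0 δ γ =
      (n - 1) * (F.Zb γ F.scal + iu A * n * star (F.divTor γ)) := by
  have h1 : ∀ δ β, F.covMixed β F.ric0 δ γ = F.covMixed β F.ric δ γ -
      F.covMixed β (fun δ γ => algebraMap ℂ A (n : ℂ)⁻¹ * F.scal * F.h δ γ) δ γ := by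
    intro δ β
    simp only [covMixed, ric0, map_sub, mul_sub, Finset.sum_sub_distrib]
    ring
  simp only [h1, mul_sub, Finset.sum_sub_distrib, bianchi, sum_hInv_mul_covMixed_mul_h]
  rw [← Algebra.smul_def, Derivation.map_smul, Algebra.smul_def]
  linear_combination -F.Zb γ F.scal * algebraMap_inv_natCast (A := A) hn

/-- The Ricci term of the Paneitz operator on pluriharmonic functions. -/
theorem div_ric0_grad_of_pluriharmonic (hn : n ≠ 0) {v : A} (hv : ∀ α, F.Zb α v = 0) :
    (n : A) * F.div (fun δ => ∑ γ, F.ric0 δ γ * F.gradBarUp (v + star v) γ) =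
      (n - 1) * star (∑ γ, (F.Z γ F.scal - iu A * n * F.divTor γ) * F.gradUp (v + star v) γ) := by
  -- `Z_α` annihilates `star v`, so the (1,0) gradient of the pluriharmonic function sees only its
  -- CR part.
  have h1 : F.gradBarUp (v + star v) = F.gradBarUp v := by
    ext γ
    have : ∀ α, F.Z α (star v) = 0 := fun α => by rw [← star_Zb, hv, star_zero]
    simp only [gradBarUp, map_add, this, add_zero]
  have h2 : ∀ γ, star (F.gradUp (v + star v) γ) = F.gradBarUp v γ := fun γ => by
    rw [star_gradUp, star_add, star_star, add_comm, h1]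
  rw [h1, F.div_tracefree_of_cr hv _ (F.sum_hInv_mul_ric0 hn), Finset.mul_sum,
    Finset.sum_congr rfl fun γ _ => by rw [← mul_assoc, F.div_ric0 hn], star_sum, Finset.mul_sum]
  refine Finset.sum_congr rfl fun γ _ => ?_
  simp only [star_mul', h2, star_sub, star_Z, star_scal, star_iu, star_natCast]
  ring

end FrameAlgebra
end CRGeom

/-! ### Calculus on the manifold: smoothness, derivatives and Lie brackets. -/

namespace CRGeom

section Calculus

variable {n : ℕ} {M : Type*} [TopologicalSpace M]
  [ChartedSpace (EuclideanSpace ℝ (Fin (2 * n + 1))) M]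

/-- Smoothness of a complex-valued function on a set. -/
abbrev SmoothFnOn (n : ℕ) {M : Type*} [TopologicalSpace M]
    [ChartedSpace (EuclideanSpace ℝ (Fin (2 * n + 1))) M] (u : M → ℂ) (V : Set M) : Prop :=
  ContMDiffOn (𝓡 (2 * n + 1)) 𝓘(ℝ, ℂ) ∞ u V

theorem differential_congr {u w : M → ℂ} {x : M} (h : u =ᶠ[𝓝 x] w) :
    (differential u x : TangentSpace (𝓡 (2 * n + 1)) x →L[ℝ] ℂ) = differential w x :=
  h.mfderiv_eq

theorem ComplexField.deriv_congr (W : ComplexField n M) {u w : M → ℂ} {x : M} (h : u =ᶠ[𝓝 x] w) :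
    W.deriv u x = W.deriv w x := by
  simp only [ComplexField.deriv, differential_congr h]

theorem ComplexField.deriv_congr_on (W : ComplexField n M) {u w : M → ℂ} {V : Set M}
    (hV : IsOpen V) (h : ∀ y ∈ V, u y = w y) {x : M} (hx : x ∈ V) :
    W.deriv u x = W.deriv w x :=
  W.deriv_congr (Filter.eventuallyEq_of_mem (hV.mem_nhds hx) h)

theorem ComplexField.deriv_const (W : ComplexField n M) (c : ℂ) (x : M) :
    W.deriv (fun _ => c) x = 0 := by
  have : (differential (fun _ => c) x : TangentSpace (𝓡 (2 * n + 1)) x →L[ℝ] ℂ) = 0 :=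
    mfderiv_const
  simp [ComplexField.deriv, this]

/-- Post-composition with a real linear map. -/
theorem differential_clm (L : ℂ →L[ℝ] ℂ) {u : M → ℂ} {x : M}
    (hu : MDifferentiableAt (𝓡 (2 * n + 1)) 𝓘(ℝ, ℂ) u x) (w : TangentSpace (𝓡 (2 * n + 1)) x) :
    differential (fun y => L (u y)) x w = L (differential u x w) := by
  have h := (L.hasFDerivAt (x := u x)).hasMFDerivAt.comp x hu.hasMFDerivAt
  have h2 : differential (fun y => L (u y)) x = L ∘L (differential u x) := h.mfderiv
  rw [h2]; rfl

theorem differential_add {u w : M → ℂ} {x : M}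
    (hu : MDifferentiableAt (𝓡 (2 * n + 1)) 𝓘(ℝ, ℂ) u x)
    (hw : MDifferentiableAt (𝓡 (2 * n + 1)) 𝓘(ℝ, ℂ) w x) :
    (differential (fun y => u y + w y) x : TangentSpace (𝓡 (2 * n + 1)) x →L[ℝ] ℂ) =
      differential u x + differential w x :=
  (hu.hasMFDerivAt.add hw.hasMFDerivAt).mfderiv

theorem differential_mul {u w : M → ℂ} {x : M}
    (hu : MDifferentiableAt (𝓡 (2 * n + 1)) 𝓘(ℝ, ℂ) u x)
    (hw : MDifferentiableAt (𝓡 (2 * n + 1)) 𝓘(ℝ, ℂ) w x)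
    (X : TangentSpace (𝓡 (2 * n + 1)) x) :
    differential (fun y => u y * w y) x X = u x * differential w x X + w x * differential u x X := by
  have h := (hu.hasMFDerivAt.mul hw.hasMFDerivAt).mfderiv
  have h2 : differential (fun y => u y * w y) x = u x • differential w x + w x • differential u x :=
    h
  rw [h2]; rfl

theorem ComplexField.deriv_add (W : ComplexField n M) {u w : M → ℂ} {x : M}
    (hu : MDifferentiableAt (𝓡 (2 * n + 1)) 𝓘(ℝ, ℂ) u x)
    (hw : MDifferentiableAt (𝓡 (2 * n + 1)) 𝓘(ℝ, ℂ) w x) :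
    W.deriv (fun y => u y + w y) x = W.deriv u x + W.deriv w x := by
  simp only [ComplexField.deriv, differential_add hu hw, add_apply]
  ring

theorem ComplexField.deriv_mul (W : ComplexField n M) {u w : M → ℂ} {x : M}
    (hu : MDifferentiableAt (𝓡 (2 * n + 1)) 𝓘(ℝ, ℂ) u x)
    (hw : MDifferentiableAt (𝓡 (2 * n + 1)) 𝓘(ℝ, ℂ) w x) :
    W.deriv (fun y => u y * w y) x = u x * W.deriv w x + w x * W.deriv u x := by
  simp only [ComplexField.deriv, differential_mul hu hw]
  ring

theorem ComplexField.deriv_star (W : ComplexField n M) {u : M → ℂ} {x : M}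
    (hu : MDifferentiableAt (𝓡 (2 * n + 1)) 𝓘(ℝ, ℂ) u x) :
    starRingEnd ℂ (W.deriv u x) = W.conj.deriv (fun y => starRingEnd ℂ (u y)) x := by
  have h := differential_clm (Complex.conjCLE : ℂ →L[ℝ] ℂ) hu
  simp only [ContinuousLinearEquiv.coe_coe, Complex.conjCLE_apply] at h
  simp only [ComplexField.deriv, ComplexField.conj, h, map_neg, map_add, map_mul, Complex.conj_I]
  ring

theorem SmoothFnOn.mdifferentiableAt {u : M → ℂ} {V : Set M} (hu : SmoothFnOn n u V)
    (hV : IsOpen V) {x : M} (hx : x ∈ V) : MDifferentiableAt (𝓡 (2 * n + 1)) 𝓘(ℝ, ℂ) u x :=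
  (hu.contMDiffAt (hV.mem_nhds hx)).mdifferentiableAt (by simp)

theorem SmoothFnOn.mul {u w : M → ℂ} {V : Set M} (hu : SmoothFnOn n u V)
    (hw : SmoothFnOn n w V) : SmoothFnOn n (fun y => u y * w y) V :=
  (contDiff_mul (𝕜 := ℝ) (𝔸 := ℂ) (n := ∞)).contMDiff.comp_contMDiffOn (hu.prodMk_space hw)

theorem SmoothFnOn.add {u w : M → ℂ} {V : Set M} (hu : SmoothFnOn n u V)
    (hw : SmoothFnOn n w V) : SmoothFnOn n (fun y => u y + w y) V :=
  ContMDiffOn.add hu hw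

theorem SmoothFnOn.const (c : ℂ) (V : Set M) : SmoothFnOn n (fun _ : M => c) V :=
  contMDiffOn_const

theorem SmoothFnOn.star {u : M → ℂ} {V : Set M} (hu : SmoothFnOn n u V) :
    SmoothFnOn n (fun y => starRingEnd ℂ (u y)) V :=
  (Complex.conjCLE : ℂ →L[ℝ] ℂ).contMDiff.comp_contMDiffOn hu

variable [IsManifold (𝓡 (2 * n + 1)) ∞ M]

theorem SmoothFnOn.differential {u : M → ℂ} {V : Set M} (hu : SmoothFnOn n u V) (hV : IsOpen V)
    {X : RealField n M} (hX : X.SmoothOn V) :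
    SmoothFnOn n (fun y => differential u y (X y)) V := by
  intro x hx
  have h1 := hu.contMDiffOn_tangentMapWithin (m := ∞) (by simp) hV.uniqueMDiffOn
  have h2 := h1.comp hX (fun y hy => hy)
  have h3 := ((contMDiff_snd_tangentBundle_modelSpace ℂ 𝓘(ℝ, ℂ)).comp_contMDiffOn h2) x hx
  refine h3.congr_of_eventuallyEq_of_mem ?_ hx
  filter_upwards [self_mem_nhdsWithin] with y hy
  have : mfderivWithin (𝓡 (2 * n + 1)) 𝓘(ℝ, ℂ) u V y = mfderiv (𝓡 (2 * n + 1)) 𝓘(ℝ, ℂ) u y :=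
    mfderivWithin_of_isOpen hV hy
  change CRGeom.differential u y (X y) = mfderivWithin (𝓡 (2 * n + 1)) 𝓘(ℝ, ℂ) u V y (X y)
  rw [this]
  rfl

theorem SmoothFnOn.deriv {u : M → ℂ} {V : Set M} (hu : SmoothFnOn n u V) (hV : IsOpen V)
    {W : ComplexField n M} (hW : W.SmoothOn V) : SmoothFnOn n (W.deriv u) V :=
  SmoothFnOn.add (hu.differential hV hW.1)
    (SmoothFnOn.mul (SmoothFnOn.const _ _) (hu.differential hV hW.2))

theorem ComplexForm.SmoothOn.apply {η : ComplexForm n M} {V : Set M} (hη : η.SmoothOn V)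
    {X : RealField n M} (hX : X.SmoothOn V) : SmoothFnOn n (fun y => η y (X y)) V := by
  have h := ContMDiffOn.clm_bundle_apply (F₁ := EuclideanSpace ℝ (Fin (2 * n + 1))) (F₂ := ℂ)
    (E₁ := fun x : M => TangentSpace (𝓡 (2 * n + 1)) x) (E₂ := Bundle.Trivial M ℂ) hη hX
  intro x hx
  have := (Bundle.contMDiffWithinAt_totalSpace.1 (h x hx)).2
  simpa using this

theorem ComplexForm.SmoothOn.app {η : ComplexForm n M} {V : Set M} (hη : η.SmoothOn V)
    {W : ComplexField n M} (hW : W.SmoothOn V) : SmoothFnOn n (η.app W) V :=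
  SmoothFnOn.add (hη.apply hW.1) (SmoothFnOn.mul (SmoothFnOn.const _ _) (hη.apply hW.2))

theorem isManifold_two : IsManifold (𝓡 (2 * n + 1)) 2 M :=
  inferInstance

theorem RealField.SmoothOn.mlieBracket {X Y : RealField n M} {V : Set M} (hV : IsOpen V)
    (hX : X.SmoothOn V) (hY : Y.SmoothOn V) :
    RealField.SmoothOn (VectorField.mlieBracket (𝓡 (2 * n + 1)) X Y) V := by
  intro x hx
  have := isManifold_two (n := n) (M := M)
  have : IsManifold (𝓡 (2 * n + 1)) (minSmoothness ℝ 2) M := by simpa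
  have : IsManifold (𝓡 (2 * n + 1)) ((⊤ : ℕ∞) + 1) M := by simpa
  refine (ContMDiffAt.mlieBracket_vectorField (m := ⊤) (n := ⊤) (hX.contMDiffAt (hV.mem_nhds hx))
    (hY.contMDiffAt (hV.mem_nhds hx)) (by simp)).contMDiffWithinAt

/-- Pulling back the derivative of a function along a vector field to a chart. -/
theorem fderiv_comp_extChartAt_symm {u : M → ℂ} {x : M} {q : EuclideanSpace ℝ (Fin (2 * n + 1))}
    (hq : q ∈ (extChartAt (𝓡 (2 * n + 1)) x).target)
    (hu : MDifferentiableAt (𝓡 (2 * n + 1)) 𝓘(ℝ, ℂ) u ((extChartAt (𝓡 (2 * n + 1)) x).symm q))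
    (X : RealField n M) :
    fderiv ℝ (u ∘ (extChartAt (𝓡 (2 * n + 1)) x).symm) q
      (VectorField.mpullbackWithin 𝓘(ℝ, EuclideanSpace ℝ (Fin (2 * n + 1))) (𝓡 (2 * n + 1))
        (extChartAt (𝓡 (2 * n + 1)) x).symm X (Set.range (𝓡 (2 * n + 1))) q) =
    differential u ((extChartAt (𝓡 (2 * n + 1)) x).symm q)
      (X ((extChartAt (𝓡 (2 * n + 1)) x).symm q)) := by
  have := isManifold_two (n := n) (M := M)
  have : IsManifold (𝓡 (2 * n + 1)) 1 M := IsManifold.of_le (n := 2) (by simp)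
  have hinv := isInvertible_mfderivWithin_extChartAt_symm hq
  have hψ := (mdifferentiableWithinAt_extChartAt_symm hq)
  have hcomp := hu.hasMFDerivAt.comp_hasMFDerivWithinAt q hψ.hasMFDerivWithinAt
  have h0 := hcomp.hasMFDerivAt (by rw [ModelWithCorners.range_eq_univ]; exact Filter.univ_mem)
  have h1 : fderiv ℝ (u ∘ (extChartAt (𝓡 (2 * n + 1)) x).symm) q = _ :=
    mfderiv_eq_fderiv.symm.trans h0.mfderiv
  have h2 := hinv.self_apply_inverse (X ((extChartAt (𝓡 (2 * n + 1)) x).symm q))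
  exact (congrArg (fun L : EuclideanSpace ℝ (Fin (2 * n + 1)) →L[ℝ] ℂ => L _) h1).trans
    (congrArg (mfderiv (𝓡 (2 * n + 1)) 𝓘(ℝ, ℂ) u ((extChartAt (𝓡 (2 * n + 1)) x).symm q)) h2)

/-- The manifold bracket is the vector-space bracket of the fields pulled back to a chart, so the
identity is checked in the chart centred at `x` and transported. -/
theorem differential_mlieBracket {u : M → ℂ} {V : Set M} (hV : IsOpen V) (hu : SmoothFnOn n u V)
    {X Y : RealField n M} (hX : X.SmoothOn V) (hY : Y.SmoothOn V) {x : M} (hx : x ∈ V) :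
    differential u x (VectorField.mlieBracket (𝓡 (2 * n + 1)) X Y x) =
      differential (fun y => differential u y (Y y)) x (X x) -
      differential (fun y => differential u y (X y)) x (Y x) := by
  have := isManifold_two (n := n) (M := M)
  have : IsManifold (𝓡 (2 * n + 1)) 1 M := IsManifold.of_le (n := 2) (by simp)
  set φ := extChartAt (𝓡 (2 * n + 1)) x with hφ
  set pb : RealField n M → EuclideanSpace ℝ (Fin (2 * n + 1)) → EuclideanSpace ℝ (Fin (2 * n + 1)) :=
    fun X => VectorField.mpullbackWithin 𝓘(ℝ, EuclideanSpace ℝ (Fin (2 * n + 1))) (𝓡 (2 * n + 1))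
        φ.symm X (Set.range (𝓡 (2 * n + 1))) with hpb
  have hp : φ x ∈ φ.target := mem_extChartAt_target x
  have hφx : φ.symm (φ x) = x := extChartAt_to_inv x
  have hdiff : ∀ X : RealField n M, X.SmoothOn V → DifferentiableAt ℝ (pb X) (φ x) := by
    intro X hX
    have h1 := MDifferentiableWithinAt.differentiableWithinAt_mpullbackWithin_vectorField
      (s := Set.univ) ((hX.contMDiffAt (hV.mem_nhds hx)).mdifferentiableAt
        (by simp)).mdifferentiableWithinAt
    exact h1.differentiableAt (by simp)
  have hsm : ContDiffAt ℝ ∞ (u ∘ φ.symm) (φ x) := by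
    have h1 : ContMDiffAt (𝓡 (2 * n + 1)) 𝓘(ℝ, ℂ) ∞ u (φ.symm (φ x)) := by
      rw [hφx]; exact hu.contMDiffAt (hV.mem_nhds hx)
    have h2 : ContMDiffAt 𝓘(ℝ, EuclideanSpace ℝ (Fin (2 * n + 1))) (𝓡 (2 * n + 1)) ∞ φ.symm (φ x) :=
      (contMDiffOn_extChartAt_symm x).contMDiffAt
        ((isOpen_extChartAt_target x).mem_nhds hp)
    exact (h1.comp (φ x) h2).contDiffAt
  have hev : ∀ X : RealField n M, (fun q => fderiv ℝ (u ∘ φ.symm) q (pb X q)) =ᶠ[𝓝 (φ x)]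
      (fun y => differential u y (X y)) ∘ φ.symm := by
    intro X
    have hc : ContinuousAt φ.symm (φ x) := continuousAt_extChartAt_symm x
    have hVn : φ.symm ⁻¹' V ∈ 𝓝 (φ x) := hc.preimage_mem_nhds (by rw [hφx]; exact hV.mem_nhds hx)
    filter_upwards [(isOpen_extChartAt_target x).mem_nhds hp, hVn] with q hq hqV
    exact fderiv_comp_extChartAt_symm hq (hu.mdifferentiableAt hV hqV) X
  have hmain : ∀ X Y : RealField n M, X.SmoothOn V →
      fderiv ℝ (fun q => fderiv ℝ (u ∘ φ.symm) q (pb X q)) (φ x) (pb Y (φ x)) =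
      differential (fun y => differential u y (X y)) x (Y x) := by
    intro X Y hX
    rw [(hev X).fderiv_eq]
    have h := fderiv_comp_extChartAt_symm (u := fun y => differential u y (X y)) hp
      (by rw [hφx]; exact (hu.differential hV hX).mdifferentiableAt hV hx) Y
    rw [← hφ, hφx] at h
    exact h
  -- The vector-space identity, which rests on the symmetry of the second derivative of `u ∘
  -- φ.symm`.
  have hbr := VectorField.fderiv_apply_lieBracket hsm
    (by rw [minSmoothness_of_isRCLikeNormedField]; exact ENat.LEInfty.out) (hdiff Y hY) (hdiff X hX)
  rw [hmain Y X hY, hmain X Y hX] at hbr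
  rw [← hbr]
  have hmfd : HasMFDerivAt (𝓡 (2 * n + 1)) 𝓘(ℝ, ℂ) ((u ∘ φ.symm) ∘ φ) x
      ((mfderiv 𝓘(ℝ, EuclideanSpace ℝ (Fin (2 * n + 1))) 𝓘(ℝ, ℂ) (u ∘ φ.symm) (φ x)).comp
        (mfderiv (𝓡 (2 * n + 1)) 𝓘(ℝ, EuclideanSpace ℝ (Fin (2 * n + 1))) φ x)) :=
    ((hsm.differentiableAt (by simp)).mdifferentiableAt.hasMFDerivAt).comp x
      (mdifferentiableAt_extChartAt (mem_chart_source _ x)).hasMFDerivAt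
  -- The bracket at `x` is the inverse of `dφ` applied to the chart bracket; factoring `u` through
  -- `φ` near `x` makes `dφ` cancel.
  have heq : u =ᶠ[𝓝 x] (u ∘ φ.symm) ∘ φ := by
    filter_upwards [extChartAt_source_mem_nhds (I := 𝓡 (2 * n + 1)) x] with y hy
    simp only [Function.comp_apply, hφ, (extChartAt (𝓡 (2 * n + 1)) x).left_inv hy]
  have hcongr := (differential_congr heq).trans hmfd.mfderiv
  obtain ⟨B, hB⟩ : ∃ B : EuclideanSpace ℝ (Fin (2 * n + 1)),
    B = VectorField.lieBracket ℝ (pb X) (pb Y) (φ x) := ⟨_, rfl⟩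
  have hinv := (isInvertible_mfderiv_extChartAt (I := 𝓡 (2 * n + 1))
    (mem_extChartAt_source (I := 𝓡 (2 * n + 1)) x)).self_apply_inverse B
  have hw : VectorField.lieBracketWithin ℝ (pb X) (pb Y)
      (φ.symm ⁻¹' Set.univ ∩ Set.range (𝓡 (2 * n + 1))) (φ x) = B := by
    rw [hB, Set.preimage_univ, Set.univ_inter, ModelWithCorners.range_eq_univ,
      VectorField.lieBracketWithin_univ]
  have hbrdef : VectorField.mlieBracket (𝓡 (2 * n + 1)) X Y x =
      (mfderiv (𝓡 (2 * n + 1)) 𝓘(ℝ, EuclideanSpace ℝ (Fin (2 * n + 1))) φ x).inverse B :=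
    congrArg (mfderiv (𝓡 (2 * n + 1)) 𝓘(ℝ, EuclideanSpace ℝ (Fin (2 * n + 1))) φ x).inverse hw
  rw [hbrdef, ← hB]
  refine (congrArg (fun L : TangentSpace (𝓡 (2 * n + 1)) x →L[ℝ] ℂ => L _) hcongr).trans ?_
  refine (congrArg (mfderiv 𝓘(ℝ, EuclideanSpace ℝ (Fin (2 * n + 1))) 𝓘(ℝ, ℂ) (u ∘ φ.symm) (φ x))
    hinv).trans ?_
  rw [mfderiv_eq_fderiv]
  rfl

theorem ComplexField.deriv_bracket {u : M → ℂ} {V : Set M} (hV : IsOpen V)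
    (hu : SmoothFnOn n u V) {X Y : ComplexField n M} (hX : X.SmoothOn V) (hY : Y.SmoothOn V)
    {x : M} (hx : x ∈ V) :
    (X.bracket Y).deriv u x = X.deriv (Y.deriv u) x - Y.deriv (X.deriv u) x := by
  have hd : ∀ (P : RealField n M) (Q : ComplexField n M), Q.SmoothOn V →
      differential (Q.deriv u) x (P x) = differential (fun y => differential u y (Q.re y)) x (P x) +
        Complex.I * differential (fun y => differential u y (Q.im y)) x (P x) := by
    intro P Q hQ
    have h1 := (hu.differential hV hQ.1).mdifferentiableAt hV hx
    have h2 := (hu.differential hV hQ.2).mdifferentiableAt hV hx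
    have h3 := ((SmoothFnOn.const Complex.I V).mul (hu.differential hV hQ.2)).mdifferentiableAt hV hx
    have h4 : (differential (fun _ : M => Complex.I) x : TangentSpace (𝓡 (2 * n + 1)) x →L[ℝ] ℂ) =
      0 := mfderiv_const
    have h5 := differential_mul ((SmoothFnOn.const (n := n) Complex.I V).mdifferentiableAt hV hx) h2
      (P x)
    rw [h4] at h5
    simp only [zero_apply, mul_zero, add_zero] at h5
    rw [← h5]
    have h6 := differential_add h1 h3
    exact congrArg (fun L : TangentSpace (𝓡 (2 * n + 1)) x →L[ℝ] ℂ => L (P x)) h6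
  simp only [ComplexField.bracket, ComplexField.deriv, map_sub, map_add,
    differential_mlieBracket hV hu hX.1 hY.1 hx, differential_mlieBracket hV hu hX.1 hY.2 hx,
    differential_mlieBracket hV hu hX.2 hY.1 hx, differential_mlieBracket hV hu hX.2 hY.2 hx]
  have e1 := hd X.re Y hY
  have e2 := hd X.im Y hY
  have e3 := hd Y.re X hX
  have e4 := hd Y.im X hX
  rw [e1, e2, e3, e4]
  linear_combination (differential (fun y => differential u y (X.im y)) x (Y.im x) -
    differential (fun y => differential u y (Y.im y)) x (X.im x)) * Complex.I_mul_I

/-- Coordinate functions separate tangent vectors. -/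
theorem eq_zero_of_differential_eq_zero {V : Set M} (x₀ : M)
    (hV : V ⊆ (chartAt (EuclideanSpace ℝ (Fin (2 * n + 1))) x₀).source)
    {x : M} (hx : x ∈ V) (w : TangentSpace (𝓡 (2 * n + 1)) x)
    (hw : ∀ u : M → ℂ, SmoothFnOn n u V → differential u x w = 0) : w = 0 := by
  have := isManifold_two (n := n) (M := M)
  have : IsManifold (𝓡 (2 * n + 1)) 1 M := IsManifold.of_le (n := 2) (by simp)
  have hxs : x ∈ (extChartAt (𝓡 (2 * n + 1)) x₀).source := by
    rw [extChartAt_source]; exact hV hx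
  have hinv := isInvertible_mfderiv_extChartAt (I := 𝓡 (2 * n + 1)) hxs
  apply hinv.injective
  rw [map_zero]
  -- Because `V` lies in a single chart domain, the coordinates themselves are smooth on all of `V`
  -- and no cutoff functions are required.
  have hφ : ContMDiffOn (𝓡 (2 * n + 1)) 𝓘(ℝ, EuclideanSpace ℝ (Fin (2 * n + 1))) ∞
      (extChartAt (𝓡 (2 * n + 1)) x₀) V := contMDiffOn_extChartAt.mono hV
  let z : EuclideanSpace ℝ (Fin (2 * n + 1)) := mfderiv (𝓡 (2 * n + 1))
      𝓘(ℝ, EuclideanSpace ℝ (Fin (2 * n + 1))) (extChartAt (𝓡 (2 * n + 1)) x₀) x w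
  have hcoord : ∀ i : Fin (2 * n + 1), z i = 0 := by
    intro i
    set L : EuclideanSpace ℝ (Fin (2 * n + 1)) →L[ℝ] ℂ :=
      Complex.ofRealCLM ∘L (EuclideanSpace.proj i) with hL
    have h1 := hw (L ∘ extChartAt (𝓡 (2 * n + 1)) x₀) (L.contMDiff.comp_contMDiffOn hφ)
    have h2 := (L.hasFDerivAt (x := extChartAt (𝓡 (2 * n + 1)) x₀ x)).hasMFDerivAt.comp x
      (mdifferentiableAt_extChartAt (I := 𝓡 (2 * n + 1)) (hV hx)).hasMFDerivAt
    have h3 : differential (L ∘ extChartAt (𝓡 (2 * n + 1)) x₀) x w = L z :=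
      congrArg (fun L : TangentSpace (𝓡 (2 * n + 1)) x →L[ℝ] ℂ => L w) h2.mfderiv
    rw [h3] at h1
    exact Complex.ofReal_eq_zero.1 h1
  exact (PiLp.ext hcoord : z = 0)

end Calculus
end CRGeom

/-! ### Complex brackets, and expansion of vectors and derivatives in the frame. -/

namespace CRGeom

section Brackets

variable {n : ℕ} {M : Type*} [TopologicalSpace M]
  [ChartedSpace (EuclideanSpace ℝ (Fin (2 * n + 1))) M]

theorem ComplexForm.app_bracket_swap (η : ComplexForm n M) (V W : ComplexField n M) (x : M) :
    η.app (W.bracket V) x = -η.app (V.bracket W) x := by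
  simp only [ComplexForm.app, ComplexField.bracket,
    VectorField.mlieBracket_swap_apply (V := W.re), VectorField.mlieBracket_swap_apply (V := W.im),
    map_sub, map_add, map_neg]
  ring

theorem ComplexForm.conj_app (η : ComplexForm n M) (W : ComplexField n M) (x : M) :
    η.conj.app W x = starRingEnd ℂ (η.app W.conj x) := by
  simp [ComplexForm.app, ComplexForm.conj, ComplexField.conj]

theorem ComplexField.conj_conj (V : ComplexField n M) : V.conj.conj = V := by
  simp [ComplexField.conj]

theorem RealField.toComplex_conj (X : RealField n M) : X.toComplex.conj = X.toComplex := by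
  simp [ComplexField.conj, RealField.toComplex]

variable [IsManifold (𝓡 (2 * n + 1)) ∞ M]

theorem RealField.SmoothOn.neg {X : RealField n M} {V : Set M} (hX : X.SmoothOn V) :
    RealField.SmoothOn (fun x => -X x) V :=
  ContMDiffOn.neg_section hX

theorem ComplexField.SmoothOn.conj {W : ComplexField n M} {V : Set M} (hW : W.SmoothOn V) :
    W.conj.SmoothOn V := ⟨hW.1, hW.2.neg⟩

theorem RealField.SmoothOn.toComplex {X : RealField n M} {V : Set M} (hX : X.SmoothOn V) :
    X.toComplex.SmoothOn V := by
  refine ⟨hX, ?_⟩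
  -- The zero field is obtained as `X - X`.
  have h : RealField.SmoothOn (X + (-1 : ℝ) • X) V :=
    ContMDiffOn.add_section hX (ContMDiffOn.const_smul_section hX)
  have h0 : X + (-1 : ℝ) • X = fun _ => 0 := by ext1 x; simp
  rwa [h0] at h

theorem RealField.SmoothOn.sub {X Y : RealField n M} {V : Set M} (hX : X.SmoothOn V)
    (hY : Y.SmoothOn V) : RealField.SmoothOn (fun x => X x - Y x) V :=
  ContMDiffOn.sub_section hX hY

theorem RealField.SmoothOn.add {X Y : RealField n M} {V : Set M} (hX : X.SmoothOn V)
    (hY : Y.SmoothOn V) : RealField.SmoothOn (fun x => X x + Y x) V :=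
  ContMDiffOn.add_section hX hY

theorem ComplexField.SmoothOn.bracket {W Z : ComplexField n M} {V : Set M} (hV : IsOpen V)
    (hW : W.SmoothOn V) (hZ : Z.SmoothOn V) : (W.bracket Z).SmoothOn V :=
  ⟨(hW.1.mlieBracket hV hZ.1).sub (hW.2.mlieBracket hV hZ.2),
    (hW.1.mlieBracket hV hZ.2).add (hW.2.mlieBracket hV hZ.1)⟩

theorem RealField.SmoothOn.mdifferentiableAt {X : RealField n M} {V : Set M} (hV : IsOpen V)
    (hX : X.SmoothOn V) {x : M} (hx : x ∈ V) :
    MDifferentiableAt (𝓡 (2 * n + 1)) (𝓡 (2 * n + 1)).tangent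
      (fun x => (⟨x, X x⟩ : TangentBundle (𝓡 (2 * n + 1)) M)) x :=
  (hX.contMDiffAt (hV.mem_nhds hx)).mdifferentiableAt (by simp)

theorem mlieBracket_neg_right {X Y : RealField n M} {V : Set M} (hV : IsOpen V)
    (hY : Y.SmoothOn V) {x : M} (hx : x ∈ V) :
    VectorField.mlieBracket (𝓡 (2 * n + 1)) X (fun y => -Y y) x =
      -VectorField.mlieBracket (𝓡 (2 * n + 1)) X Y x := by
  have := VectorField.mlieBracket_const_smul_right (V := X) (c := (-1 : ℝ))
    (hY.mdifferentiableAt hV hx)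
  have h2 : (-1 : ℝ) • Y = fun y => -Y y := by ext1 y; simp
  rw [h2] at this
  rw [this, neg_one_smul]

theorem mlieBracket_neg_left {X Y : RealField n M} {V : Set M} (hV : IsOpen V)
    (hX : X.SmoothOn V) {x : M} (hx : x ∈ V) :
    VectorField.mlieBracket (𝓡 (2 * n + 1)) (fun y => -X y) Y x =
      -VectorField.mlieBracket (𝓡 (2 * n + 1)) X Y x := by
  rw [VectorField.mlieBracket_swap_apply, mlieBracket_neg_right hV hX hx,
    VectorField.mlieBracket_swap_apply (V := Y), neg_neg]

/-- Conjugation commutes with brackets; smoothness is what permits a sign to be pulled out of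
`mlieBracket`. -/
theorem ComplexForm.app_conj_bracket (η : ComplexForm n M) {V W : ComplexField n M} {U : Set M}
    (hU : IsOpen U) (hV : V.SmoothOn U) (hW : W.SmoothOn U) {x : M} (hx : x ∈ U) :
    η.app (V.bracket W).conj x = η.app (V.conj.bracket W.conj) x := by
  simp only [ComplexForm.app, ComplexField.bracket, ComplexField.conj,
    mlieBracket_neg_right hU hW.2 hx, mlieBracket_neg_left hU hV.2 hx, neg_neg, map_neg, map_add,
    map_sub]
  ring

end Brackets

namespace PseudohermitianStructure.AdmissibleFrame

variable {n : ℕ} {M : Type*} [TopologicalSpace M]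
  [ChartedSpace (EuclideanSpace ℝ (Fin (2 * n + 1))) M] [IsManifold (𝓡 (2 * n + 1)) ∞ M]
  {S : PseudohermitianStructure n M} {U : Set M} (F : S.AdmissibleFrame U)

section Pointwise

variable {x : M} (hx : x ∈ U)
include hx

theorem form_re (α : Fin n) : S.form x ((F.Z α).re x) = 0 := (F.Z_mem α x hx).1

theorem im_eq (α : Fin n) : (F.Z α).im x = -S.J x ((F.Z α).re x) := (F.Z_mem α x hx).2

theorem form_im (α : Fin n) : S.form x ((F.Z α).im x) = 0 := by
  rw [F.im_eq hx, map_neg, S.J_mem x _ (F.form_re hx α), neg_zero]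

theorem J_im (α : Fin n) : S.J x ((F.Z α).im x) = (F.Z α).re x := by
  rw [F.im_eq hx, map_neg, S.J_sq x _ (F.form_re hx α), neg_neg]

theorem J_re (α : Fin n) : S.J x ((F.Z α).re x) = -(F.Z α).im x := by
  rw [F.im_eq hx, neg_neg]

theorem coframe_re (α β : Fin n) :
    F.coframe α x ((F.Z β).re x) = if α = β then 1 / 2 else 0 := by
  have h1 := F.coframe_Z α β x hx
  have h2 := F.coframe_Zbar α β x hx
  simp only [ComplexForm.app, ComplexField.conj, map_neg] at h1 h2
  split_ifs at h1 ⊢ <;> linear_combination (h1 + h2) / 2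

theorem coframe_im (α β : Fin n) :
    F.coframe α x ((F.Z β).im x) = if α = β then -Complex.I / 2 else 0 := by
  have h1 := F.coframe_Z α β x hx
  have h2 := F.coframe_Zbar α β x hx
  simp only [ComplexForm.app, ComplexField.conj, map_neg] at h1 h2
  split_ifs at h1 ⊢ <;>
    linear_combination -Complex.I * (h1 - h2) / 2 +
      F.coframe α x ((F.Z β).im x) * Complex.I_mul_I

/-- Expansion of a tangent vector in the frame. -/
theorem expand (w : TangentSpace (𝓡 (2 * n + 1)) x) :
    w = S.form x w • F.T x + ∑ α, ((2 * (F.coframe α x w).re) • (F.Z α).re x -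
      (2 * (F.coframe α x w).im) • (F.Z α).im x) := by
  -- `Φ` collects the coframe values. `Ψ` rebuilds the vector `t T + ∑ (z_α Z_α + z̄_α Z_ᾱ)`, whose
  -- real form has the coefficients `2 Re z_α` and `-2 Im z_α`.
  let Φ : TangentSpace (𝓡 (2 * n + 1)) x →ₗ[ℝ] ℝ × (Fin n → ℂ) :=
    (S.form x : TangentSpace (𝓡 (2 * n + 1)) x →ₗ[ℝ] ℝ).prod
      (LinearMap.pi fun α => (F.coframe α x : TangentSpace (𝓡 (2 * n + 1)) x →ₗ[ℝ] ℂ))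
  let Ψ : ℝ × (Fin n → ℂ) → TangentSpace (𝓡 (2 * n + 1)) x := fun p =>
    p.1 • F.T x + ∑ α, ((2 * (p.2 α).re) • (F.Z α).re x - (2 * (p.2 α).im) • (F.Z α).im x)
  have hΨ : ∀ p, Φ (Ψ p) = p := by
    intro p
    refine Prod.ext ?_ ?_
    · change S.form x (Ψ p) = p.1
      simp [Ψ, F.form_re hx, F.form_im hx, F.form_T x hx]
    · ext1 β
      change F.coframe β x (Ψ p) = p.2 β
      simp only [Ψ, map_add, map_sum, map_sub, map_smul, F.coframe_T β x hx, F.coframe_re hx,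
        F.coframe_im hx, Complex.real_smul]
      simp only [mul_zero, zero_add, mul_ite, Finset.sum_sub_distrib, Finset.sum_ite_eq,
        Finset.mem_univ, if_true]
      apply Complex.ext <;> simp <;> ring
  have hfr : Module.finrank ℝ (TangentSpace (𝓡 (2 * n + 1)) x) =
      Module.finrank ℝ (ℝ × (Fin n → ℂ)) := by
    have h1 : Module.finrank ℝ (TangentSpace (𝓡 (2 * n + 1)) x) = 2 * n + 1 :=
      finrank_euclideanSpace_fin
    rw [h1, Module.finrank_prod, Module.finrank_self, Module.finrank_pi_fintype]
    simp [Complex.finrank_real_complex]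
    ring
  have : FiniteDimensional ℝ (TangentSpace (𝓡 (2 * n + 1)) x) :=
    inferInstanceAs (FiniteDimensional ℝ (EuclideanSpace ℝ (Fin (2 * n + 1))))
  -- `Ψ` is a right inverse, so `Φ` is onto; both sides have real dimension `2n + 1`, so it is also
  -- injective.
  have hinj : Function.Injective Φ :=
    (LinearMap.injective_iff_surjective_of_finrank_eq_finrank hfr).2 fun p => ⟨Ψ p, hΨ p⟩
  exact (hinj (hΨ (Φ w))).symm

/-- A coframe form restricted to `H` is complex linear. This is what lets `app_of_isT10At` turn
integrability into the absence of a (0,1) part in `[Z_α, Z_β]`. -/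
theorem coframe_J (β : Fin n) (w : TangentSpace (𝓡 (2 * n + 1)) x) (hw : S.form x w = 0) :
    F.coframe β x (S.J x w) = Complex.I * F.coframe β x w := by
  conv_lhs => rw [F.expand hx w, hw]
  simp only [zero_smul, zero_add, map_sum, map_sub, map_smul, F.J_re hx, F.J_im hx, map_neg,
    F.coframe_re hx, F.coframe_im hx, Complex.real_smul]
  simp only [mul_ite, mul_zero, Finset.sum_sub_distrib, mul_neg, Finset.sum_neg_distrib,
        Finset.sum_ite_eq, Finset.mem_univ, if_true]
  apply Complex.ext <;> simp <;> ring

theorem app_of_isT10At {V : ComplexField n M} (hV : S.IsT10At V x) (β : Fin n) :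
    S.theta.app V x = 0 ∧ (F.coframe β).conj.app V x = 0 := by
  constructor
  · simp [ComplexForm.app, theta, hV.1, hV.2, S.J_mem x _ hV.1]
  · rw [ComplexForm.conj_app, map_eq_zero]
    simp only [ComplexForm.app, ComplexField.conj, hV.2, neg_neg, F.coframe_J hx β _ hV.1]
    linear_combination F.coframe β x (V.re x) * Complex.I_mul_I

theorem apply_expand (L : TangentSpace (𝓡 (2 * n + 1)) x →L[ℝ] ℂ)
    (w : TangentSpace (𝓡 (2 * n + 1)) x) :
    L w = S.form x w * L (F.T x) +
      ∑ α, F.coframe α x w * (L ((F.Z α).re x) + Complex.I * L ((F.Z α).im x)) +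
      ∑ α, starRingEnd ℂ (F.coframe α x w) *
        (L ((F.Z α).re x) - Complex.I * L ((F.Z α).im x)) := by
  conv_lhs => rw [F.expand hx w]
  simp only [map_add, map_sum, map_sub, map_smul, Complex.real_smul, add_assoc,
    ← Finset.sum_add_distrib]
  congr 1
  refine Finset.sum_congr rfl fun α _ => ?_
  have h1 := Complex.re_add_im (F.coframe α x w)
  have h2 : starRingEnd ℂ (F.coframe α x w) =
      (F.coframe α x w).re - (F.coframe α x w).im * Complex.I := by
    apply Complex.ext <;> simp
  rw [h2]
  push_cast
  linear_combination (L ((F.Z α).re x) + Complex.I * L ((F.Z α).im x)) * h1 -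
    2 * ((F.coframe α x w).im : ℂ) * L ((F.Z α).im x) * Complex.I_mul_I

/-- Expansion of a derivative in the frame. -/
theorem deriv_expand (V : ComplexField n M) (u : M → ℂ) :
    V.deriv u x = S.theta.app V x * F.T.toComplex.deriv u x +
      ∑ α, (F.coframe α).app V x * (F.Z α).deriv u x +
      ∑ α, (F.coframe α).conj.app V x * (F.Z α).conj.deriv u x := by
  have h1 := F.apply_expand hx (differential u x) (V.re x)
  have h2 := F.apply_expand hx (differential u x) (V.im x)
  simp only [ComplexField.deriv]
  rw [h1, h2]
  simp only [RealField.toComplex, ComplexForm.app, theta, ComplexForm.conj, ComplexField.conj,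
    map_neg, map_zero, ContinuousLinearMap.coe_comp, Function.comp_apply,
    Complex.ofRealCLM_apply, ContinuousLinearEquiv.coe_coe, Complex.conjCLE_apply, mul_neg, mul_zero,
    add_zero, mul_add, add_mul, Finset.sum_add_distrib, Finset.mul_sum, mul_sub,
    Finset.sum_sub_distrib, ← sub_eq_add_neg, mul_assoc]
  ring

end Pointwise

end PseudohermitianStructure.AdmissibleFrame
end CRGeom

/-! ### Brackets of the frame fields and nondegeneracy of the Levi form. -/

namespace CRGeom

variable {n : ℕ} {M : Type*} [TopologicalSpace M]
  [ChartedSpace (EuclideanSpace ℝ (Fin (2 * n + 1))) M]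

/-- Frame fields have constant pairings with the coframe, so the derivative terms of `dη` vanish.
This turns the definitions of `h`, `omega` and `A` by exterior derivatives into coefficients of
brackets. -/
theorem ComplexForm.d_of_const {U : Set M} (hU : IsOpen U) (η : ComplexForm n M)
    {V W : ComplexField n M} {a b : ℂ} (hV : ∀ x ∈ U, η.app V x = a) (hW : ∀ x ∈ U, η.app W x = b)
    {x : M} (hx : x ∈ U) : η.d V W x = -η.app (V.bracket W) x := by
  rw [ComplexForm.d, V.deriv_congr_on hU hW hx, W.deriv_congr_on hU hV hx, V.deriv_const,
    W.deriv_const]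
  ring

variable [IsManifold (𝓡 (2 * n + 1)) ∞ M]

/-- Smoothness of the partial sum is part of the statement because the induction needs it to apply
additivity of the bracket. -/
theorem mlieBracket_sum_right {ι : Type*} (s : Finset ι) {U : Set M} (hU : IsOpen U)
    {X : RealField n M} (hX : X.SmoothOn U) {Y : ι → RealField n M} (hY : ∀ i, (Y i).SmoothOn U)
    (a : ι → ℝ) {x : M} (hx : x ∈ U) :
    RealField.SmoothOn (fun y => ∑ i ∈ s, a i • Y i y) U ∧
    VectorField.mlieBracket (𝓡 (2 * n + 1)) X (fun y => ∑ i ∈ s, a i • Y i y) x =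
      ∑ i ∈ s, a i • VectorField.mlieBracket (𝓡 (2 * n + 1)) X (Y i) x := by
  classical
  induction s using Finset.induction_on with
  | empty =>
    simp only [Finset.sum_empty]
    have h := (RealField.SmoothOn.toComplex hX).2
    exact ⟨h, by rw [show (fun _ : M => 0 : RealField n M) = 0 from rfl,
      VectorField.mlieBracket_zero_right]; rfl⟩
  | insert i s hi ih =>
    simp only [Finset.sum_insert hi]
    have h1 : RealField.SmoothOn (a i • Y i) U := ContMDiffOn.const_smul_section (hY i)
    refine ⟨RealField.SmoothOn.add h1 ih.1, ?_⟩
    rw [← ih.2, ← VectorField.mlieBracket_const_smul_right ((hY i).mdifferentiableAt hU hx),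
      ← VectorField.mlieBracket_add_right (h1.mdifferentiableAt hU hx)
        (ih.1.mdifferentiableAt hU hx)]
    rfl

theorem mlieBracket_sum_left {ι : Type*} (s : Finset ι) {U : Set M} (hU : IsOpen U)
    {X : RealField n M} (hX : X.SmoothOn U) {Y : ι → RealField n M} (hY : ∀ i, (Y i).SmoothOn U)
    (a : ι → ℝ) {x : M} (hx : x ∈ U) :
    VectorField.mlieBracket (𝓡 (2 * n + 1)) (fun y => ∑ i ∈ s, a i • Y i y) X x =
      ∑ i ∈ s, a i • VectorField.mlieBracket (𝓡 (2 * n + 1)) (Y i) X x := by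
  rw [VectorField.mlieBracket_swap_apply, (mlieBracket_sum_right s hU hX hY a hx).2,
    ← Finset.sum_neg_distrib]
  refine Finset.sum_congr rfl fun i _ => ?_
  rw [VectorField.mlieBracket_swap_apply (V := X), smul_neg, neg_neg]

namespace PseudohermitianStructure

variable {S : PseudohermitianStructure n M} {U : Set M}

theorem theta_smooth (S : PseudohermitianStructure n M) (U : Set M) : S.theta.SmoothOn U :=
  ContMDiffOn.mono S.form_smooth (Set.subset_univ U)

theorem theta_app_real (V : ComplexField n M) (x : M) :
    S.theta.app V x = S.form x (V.re x) + Complex.I * S.form x (V.im x) := by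
  simp [ComplexForm.app, theta]

namespace AdmissibleFrame

variable (F : S.AdmissibleFrame U)

/-- The `(0,1)` part of `[T, Z_α]`. -/
def r (α γ : Fin n) : M → ℂ := (F.coframe γ).conj.app (F.T.toComplex.bracket (F.Z α))

/-- The structure functions of `[Z_α, Z_β]`. -/
def c (α β γ : Fin n) : M → ℂ := (F.coframe γ).app ((F.Z α).bracket (F.Z β))

section

variable {x : M} (hx : x ∈ U)
include hx

theorem theta_Z (α : Fin n) : S.theta.app (F.Z α) x = 0 := by
  simp [theta_app_real, F.form_re hx, F.form_im hx]

theorem theta_Zbar (α : Fin n) : S.theta.app (F.Z α).conj x = 0 := by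
  simp [theta_app_real, ComplexField.conj, F.form_re hx, F.form_im hx]

theorem coframe_toComplex (α : Fin n) : (F.coframe α).app F.T.toComplex x = 0 := by
  simp [ComplexForm.app, RealField.toComplex, F.coframe_T α x hx]

variable (hU : IsOpen U)
include hU

theorem theta_bracket_Z_Zbar (α β : Fin n) :
    S.theta.app ((F.Z α).bracket (F.Z β).conj) x = -(Complex.I * F.h α β x) := by
  rw [h, ComplexForm.d_of_const hU S.theta (fun y hy => F.theta_Z hy α)
    (fun y hy => F.theta_Zbar hy β) hx]
  linear_combination S.theta.app ((F.Z α).bracket (F.Z β).conj) x * Complex.I_mul_I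

theorem coframe_bracket_Z_Zbar (α β γ : Fin n) :
    (F.coframe γ).app ((F.Z α).bracket (F.Z β).conj) x = -F.omega α γ (.anti β) x := by
  simp only [omega]
  rw [ComplexForm.d_of_const hU (F.coframe γ) (fun y hy => F.coframe_Z γ α y hy)
    (fun y hy => F.coframe_Zbar γ β y hy) hx, neg_neg]

theorem coframe_conj_bracket_Z_Zbar (α β γ : Fin n) :
    (F.coframe γ).conj.app ((F.Z α).bracket (F.Z β).conj) x =
      starRingEnd ℂ (F.omega β γ (.anti α) x) := by
  rw [ComplexForm.conj_app, ComplexForm.app_conj_bracket _ hU (F.Z_smooth α) (F.Z_smooth β).conj hx,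
    ComplexField.conj_conj, ComplexForm.app_bracket_swap, F.coframe_bracket_Z_Zbar hx hU, neg_neg]

theorem theta_bracket_T_Z (α : Fin n) : S.theta.app (F.T.toComplex.bracket (F.Z α)) x = 0 := by
  have hz : ∀ Y : RealField n M, VectorField.mlieBracket (𝓡 (2 * n + 1))
      (fun _ : M => 0 : RealField n M) Y x = 0 := fun Y => by
    rw [show (fun _ : M => 0 : RealField n M) = 0 from rfl, VectorField.mlieBracket_zero_left]; rfl
  have hz' : ∀ Y : RealField n M, VectorField.mlieBracket (𝓡 (2 * n + 1)) Y
      (fun _ : M => 0 : RealField n M) x = 0 := fun Y => by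
    rw [show (fun _ : M => 0 : RealField n M) = 0 from rfl, VectorField.mlieBracket_zero_right]; rfl
  have key : ∀ Y : RealField n M, Y.SmoothOn U → (∀ y ∈ U, S.form y (Y y) = 0) →
      S.form x (VectorField.mlieBracket (𝓡 (2 * n + 1)) F.T Y x) = 0 := by
    intro Y hY h0
    have h1 := F.d_form_T Y hY x hx
    rw [ComplexForm.d_of_const (a := 1) (b := 0) hU S.theta
      (fun y hy => by simp [theta_app_real, RealField.toComplex, F.form_T y hy])
      (fun y hy => by simp [theta_app_real, RealField.toComplex, h0 y hy]) hx, theta_app_real] at h1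
    have h3 := congrArg Complex.re h1
    simpa [ComplexField.bracket, RealField.toComplex, hz, hz'] using h3
  have hr := key _ (F.Z_smooth α).1 fun y hy => F.form_re hy α
  have hi := key _ (F.Z_smooth α).2 fun y hy => F.form_im hy α
  rw [theta_app_real]
  simp [ComplexField.bracket, RealField.toComplex, hz, hr, hi]

theorem coframe_bracket_T_Z (α γ : Fin n) :
    (F.coframe γ).app (F.T.toComplex.bracket (F.Z α)) x = F.omega α γ .zero x := by
  simp only [omega]
  rw [ComplexForm.d_of_const hU (F.coframe γ) (fun y hy => F.coframe_Z γ α y hy)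
    (fun y hy => F.coframe_toComplex hy γ) hx, ComplexForm.app_bracket_swap]

theorem d_coframe_T_Zbar (α γ : Fin n) :
    (F.coframe γ).d F.T.toComplex (F.Z α).conj x = -starRingEnd ℂ (F.r α γ x) := by
  rw [ComplexForm.d_of_const hU (F.coframe γ) (fun y hy => F.coframe_toComplex hy γ)
    (fun y hy => F.coframe_Zbar γ α y hy) hx, r, ComplexForm.conj_app, Complex.conj_conj,
    ComplexForm.app_conj_bracket _ hU F.T_smooth.toComplex (F.Z_smooth α) hx,
    RealField.toComplex_conj]

theorem isT10At_bracket (α β : Fin n) : S.IsT10At ((F.Z α).bracket (F.Z β)) x :=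
  S.integrable U hU _ _ (F.Z_smooth α) (F.Z_smooth β) (fun y hy => F.Z_mem α y hy)
    (fun y hy => F.Z_mem β y hy) x hx

theorem star_h (α β : Fin n) : starRingEnd ℂ (F.h α β x) = F.h β α x := by
  have h1 := F.theta_bracket_Z_Zbar hx hU α β
  have h2 := F.theta_bracket_Z_Zbar hx hU β α
  have h3 := ComplexForm.app_conj_bracket S.theta hU (F.Z_smooth α) (F.Z_smooth β).conj hx
  have h4 : S.theta.app ((F.Z α).bracket (F.Z β).conj).conj x =
      starRingEnd ℂ (S.theta.app ((F.Z α).bracket (F.Z β).conj) x) := by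
    simp [theta_app_real, ComplexField.conj]
  rw [ComplexField.conj_conj, ComplexForm.app_bracket_swap, h2, h4, h1] at h3
  simp only [map_neg, map_mul, Complex.conj_I] at h3
  have := mul_left_cancel₀ Complex.I_ne_zero (a := Complex.I) (b := starRingEnd ℂ (F.h α β x))
    (c := F.h β α x) (by linear_combination h3)
  exact this

theorem theta_bracket_Z_Z (α β : Fin n) : S.theta.app ((F.Z α).bracket (F.Z β)) x = 0 := by
  have h := F.isT10At_bracket hx hU α β
  rw [theta_app_real, h.1, h.2, map_neg, S.J_mem x _ h.1]
  simp

theorem coframe_conj_bracket_Z_Z (α β γ : Fin n) :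
    (F.coframe γ).conj.app ((F.Z α).bracket (F.Z β)) x = 0 :=
  (F.app_of_isT10At hx (F.isT10At_bracket hx hU α β) γ).2

/-- Strict pseudoconvexity is assumed for real fields only. It is applied to the real part of `∑ c_α
Z_α`, with the numbers `c_α` taken as constant coefficients: a null vector `c` would make the Levi
form vanish on this field. -/
theorem eq_zero_of_h_mul_eq_zero (c : Fin n → ℂ) (hc : ∀ β, ∑ α, F.h α β x * c α = 0) :
    c = 0 := by
  by_contra hne
  obtain ⟨α₀, hα₀⟩ := Function.ne_iff.1 hne
  let br : RealField n M → RealField n M → ℝ := fun X Y =>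
    S.form x (VectorField.mlieBracket (𝓡 (2 * n + 1)) X Y x)
  let Y₁ : Fin n ⊕ Fin n → RealField n M := Sum.elim (fun α => (F.Z α).re) fun α => (F.Z α).im
  have hY₁ : ∀ i, (Y₁ i).SmoothOn U := by
    rintro (i | i)
    exacts [(F.Z_smooth i).1, (F.Z_smooth i).2]
  -- `X` and `Y` are the real and imaginary parts of `∑ c_α Z_α`, whence `J X = -Y`.
  let a : Fin n ⊕ Fin n → ℝ := Sum.elim (fun α => (c α).re) fun α => -(c α).im
  let b : Fin n ⊕ Fin n → ℝ := Sum.elim (fun α => (c α).im) fun α => (c α).re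
  let X : RealField n M := fun y => ∑ i, a i • Y₁ i y
  let Y : RealField n M := fun y => ∑ i, b i • Y₁ i y
  have hX : X.SmoothOn U :=
    (mlieBracket_sum_right Finset.univ hU F.T_smooth hY₁ a hx).1
  have hY : Y.SmoothOn U :=
    (mlieBracket_sum_right Finset.univ hU F.T_smooth hY₁ b hx).1
  have hX0 : ∀ y ∈ U, S.form y (X y) = 0 := by
    intro y hy
    simp [X, Y₁, Fintype.sum_sum_type, F.form_re hy, F.form_im hy]
  have hJ : ∀ y ∈ U, S.J y (X y) = -Y y := by
    intro y hy
    simp [X, Y, Y₁, a, b, Fintype.sum_sum_type, F.J_re hy, F.J_im hy]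
  have hXx : X x ≠ 0 := by
    intro h0
    have h1 : F.coframe α₀ x (X x) = 0 := by rw [h0, map_zero]
    simp only [X, Y₁, a, Fintype.sum_sum_type, map_add, map_sum, map_smul, Sum.elim_inl,
      Sum.elim_inr, F.coframe_re hx, F.coframe_im hx, Complex.real_smul, mul_ite, mul_zero,
      Finset.sum_ite_eq, Finset.mem_univ, if_true] at h1
    apply hα₀
    rw [← Complex.re_add_im (c α₀)]
    push_cast at h1
    simp only [Pi.zero_apply]
    linear_combination 2 * h1
  have hpos := S.pseudoconvex U hU X hX hX0 x hx hXx
  have hcongr : VectorField.mlieBracket (𝓡 (2 * n + 1)) X (fun y => S.J y (X y)) x =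
      VectorField.mlieBracket (𝓡 (2 * n + 1)) X (fun y => -Y y) x := by
    refine Filter.EventuallyEq.mlieBracket_vectorField_eq (Filter.EventuallyEq.refl _ _) ?_
    filter_upwards [hU.mem_nhds hx] with y hy using hJ y hy
  rw [hcongr, mlieBracket_neg_right hU hY hx, map_neg, neg_neg] at hpos
  change 0 < br X Y at hpos
  have hbr : br X Y = ∑ i, ∑ j, a i * (b j * br (Y₁ i) (Y₁ j)) := by
    simp only [br]
    rw [mlieBracket_sum_left Finset.univ hU hY hY₁ a hx, map_sum]
    refine Finset.sum_congr rfl fun i _ => ?_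
    rw [map_smul, (mlieBracket_sum_right Finset.univ hU (hY₁ i) hY₁ b hx).2, map_sum,
      smul_eq_mul, Finset.mul_sum]
    simp only [map_smul, smul_eq_mul]
  -- Real and imaginary parts of `θ([Z_α, Z_β]) = 0`, a consequence of integrability; they reduce
  -- the four real brackets to two.
  have hpp : ∀ α β, br (F.Z α).re (F.Z β).re = br (F.Z α).im (F.Z β).im ∧
      br (F.Z α).re (F.Z β).im = -br (F.Z α).im (F.Z β).re := by
    intro α β
    have h := F.theta_bracket_Z_Z hx hU α β
    rw [theta_app_real] at h
    simp only [ComplexField.bracket, map_sub, map_add] at h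
    have h1 := congrArg Complex.re h
    have h2 := congrArg Complex.im h
    simp at h1 h2
    exact ⟨by linarith, by linarith⟩
  have hh : ∀ α β, F.h α β x = 2 * (br (F.Z α).re (F.Z β).im +
      Complex.I * br (F.Z α).re (F.Z β).re) := by
    intro α β
    have h := F.theta_bracket_Z_Zbar hx hU α β
    rw [theta_app_real] at h
    simp only [ComplexField.bracket, ComplexField.conj, map_sub, map_add,
      mlieBracket_neg_right hU (F.Z_smooth β).2 hx, map_neg] at h
    have h1 : (br (F.Z α).re (F.Z β).re : ℂ) = br (F.Z α).im (F.Z β).im := by rw [(hpp α β).1]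
    have h2 : (br (F.Z α).re (F.Z β).im : ℂ) = -br (F.Z α).im (F.Z β).re := by
      rw [(hpp α β).2]; push_cast; ring
    simp only [br] at h1 h2 ⊢
    push_cast at h
    linear_combination -Complex.I * h - Complex.I * h1 - h2 + (F.h α β x -
      S.form x (VectorField.mlieBracket (𝓡 (2 * n + 1)) (F.Z α).re (F.Z β).im x) +
      S.form x (VectorField.mlieBracket (𝓡 (2 * n + 1)) (F.Z α).im (F.Z β).re x)) *
        Complex.I_mul_I
  have hsum : (∑ β, (∑ α, F.h α β x * c α) * starRingEnd ℂ (c β)).re = 0 := by simp [hc]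
  simp only [Finset.sum_mul, Complex.re_sum, hh] at hsum
  rw [Finset.sum_comm] at hsum
  refine hpos.ne' ?_
  -- The real part of `∑ h_αβ̄ c_α c̄_β` is `2 θ([X, Y])`; it is zero by `hc`, against positivity.
  have h2 : 2 * br X Y = 0 := by
    rw [← hsum, hbr]
    simp only [Fintype.sum_sum_type, Y₁, a, b, Sum.elim_inl, Sum.elim_inr, (hpp _ _).1,
      (hpp _ _).2, ← Finset.sum_add_distrib, Finset.mul_sum]
    refine Finset.sum_congr rfl fun α _ => Finset.sum_congr rfl fun β _ => ?_
    simp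
    ring
  linarith

theorem det_h_ne_zero : (Matrix.of fun γ δ => F.h γ δ x).det ≠ 0 := by
  intro h0
  obtain ⟨c, hc, h⟩ := Matrix.exists_vecMul_eq_zero_iff.2 h0
  refine hc (F.eq_zero_of_h_mul_eq_zero hx hU c fun β => ?_)
  have := congrFun h β
  simpa [Matrix.vecMul, dotProduct, mul_comm] using this

theorem sum_hInv_mul_h (α γ : Fin n) :
    ∑ β, F.hInv α β x * F.h γ β x = if α = γ then 1 else 0 := by
  have hdet := isUnit_iff_ne_zero.2 (F.det_h_ne_zero hx hU)
  have h := congrFun (congrFun (Matrix.mul_nonsing_inv _ hdet) γ) α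
  rw [Matrix.mul_apply, Matrix.one_apply] at h
  simp only [Matrix.of_apply] at h
  simp only [hInv]
  simp only [eq_comm (a := α), ← h]
  exact Finset.sum_congr rfl fun β _ => mul_comm _ _

end

end AdmissibleFrame
end PseudohermitianStructure
end CRGeom

/-! ### Smooth functions on a small open set as a `FrameAlgebra`. -/

namespace CRGeom

variable {n : ℕ} {M : Type*} [TopologicalSpace M]
  [ChartedSpace (EuclideanSpace ℝ (Fin (2 * n + 1))) M]

theorem SmoothFnOn.inv {u : M → ℂ} {V : Set M} (hu : SmoothFnOn n u V) (h0 : ∀ x ∈ V, u x ≠ 0) :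
    SmoothFnOn n (fun y => (u y)⁻¹) V := fun x hx =>
  ((contDiffAt_inv (n := ∞) ℝ (h0 x hx)).contMDiffAt).comp_contMDiffWithinAt x (hu x hx)

/-- The algebra of smooth complex-valued functions on a set. -/
def smoothSubalgebra (n : ℕ) {M : Type*} [TopologicalSpace M]
    [ChartedSpace (EuclideanSpace ℝ (Fin (2 * n + 1))) M] (V : Set M) :
    StarSubalgebra ℂ (V → ℂ) where
  carrier := {g | ∃ u : M → ℂ, SmoothFnOn n u V ∧ ∀ y : V, g y = u y}
  mul_mem' := by
    rintro f g ⟨u, hu, h⟩ ⟨w, hw, h'⟩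
    exact ⟨_, hu.mul hw, fun y => by rw [Pi.mul_apply, h, h']⟩
  add_mem' := by
    rintro f g ⟨u, hu, h⟩ ⟨w, hw, h'⟩
    exact ⟨_, hu.add hw, fun y => by rw [Pi.add_apply, h, h']⟩
  algebraMap_mem' := fun r => ⟨_, SmoothFnOn.const r V, fun y => rfl⟩
  star_mem' := by
    rintro f ⟨u, hu, h⟩
    exact ⟨_, hu.star, fun y => by rw [Pi.star_apply, h]; rfl⟩

/-- The type of smooth complex-valued functions on a set. -/
abbrev SmoothAlg (n : ℕ) {M : Type*} [TopologicalSpace M]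
    [ChartedSpace (EuclideanSpace ℝ (Fin (2 * n + 1))) M] (V : Set M) : Type _ :=
  smoothSubalgebra n V

instance {V : Set M} : CommRing (SmoothAlg n V) :=
  inferInstanceAs (CommRing (smoothSubalgebra n V).toSubalgebra)

namespace SmoothAlg

variable {V : Set M}

/-- The function `a` on `V` is the restriction of `u`. -/
def Rep (a : SmoothAlg n V) (u : M → ℂ) : Prop := ∀ y : V, a.1 y = u y

/-- A smooth function as an element of the algebra. -/
def mk (u : M → ℂ) (hu : SmoothFnOn n u V) : SmoothAlg n V := ⟨fun y => u y, u, hu, fun _ => rfl⟩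

theorem rep_mk (u : M → ℂ) (hu : SmoothFnOn n u V) : Rep (mk u hu) u := fun _ => rfl

theorem Rep.smooth {a : SmoothAlg n V} {u : M → ℂ} (h : Rep a u) : SmoothFnOn n u V := by
  obtain ⟨w, hw, h'⟩ := a.2
  exact hw.congr fun x hx => by rw [← h' ⟨x, hx⟩, h ⟨x, hx⟩]

theorem Rep.ext {a b : SmoothAlg n V} {u w : M → ℂ} (ha : Rep a u) (hb : Rep b w)
    (h : ∀ y ∈ V, u y = w y) : a = b :=
  Subtype.ext (funext fun y => by rw [ha y, hb y, h y y.2])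

theorem Rep.congr {a : SmoothAlg n V} {u w : M → ℂ} (ha : Rep a u) (h : ∀ y ∈ V, u y = w y) :
    Rep a w := fun y => by rw [ha y, h y y.2]

theorem Rep.eq {a : SmoothAlg n V} {u w : M → ℂ} (ha : Rep a u) (hb : Rep a w) {x : M}
    (hx : x ∈ V) : u x = w x := by
  rw [← ha ⟨x, hx⟩, hb ⟨x, hx⟩]

theorem exists_rep (a : SmoothAlg n V) : ∃ u, SmoothFnOn n u V ∧ Rep a u := a.2

theorem Rep.add {a b : SmoothAlg n V} {u w : M → ℂ} (ha : Rep a u) (hb : Rep b w) :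
    Rep (a + b) (fun y => u y + w y) := fun y => by
  change a.1 y + b.1 y = _; rw [ha, hb]

theorem Rep.sub {a b : SmoothAlg n V} {u w : M → ℂ} (ha : Rep a u) (hb : Rep b w) :
    Rep (a - b) (fun y => u y - w y) := fun y => by
  change a.1 y - b.1 y = _; rw [ha, hb]

theorem Rep.mul {a b : SmoothAlg n V} {u w : M → ℂ} (ha : Rep a u) (hb : Rep b w) :
    Rep (a * b) (fun y => u y * w y) := fun y => by
  change a.1 y * b.1 y = _; rw [ha, hb]

theorem Rep.neg {a : SmoothAlg n V} {u : M → ℂ} (ha : Rep a u) : Rep (-a) (fun y => -u y) :=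
  fun y => by change -a.1 y = _; rw [ha]

theorem Rep.star {a : SmoothAlg n V} {u : M → ℂ} (ha : Rep a u) :
    Rep (Star.star a) (fun y => starRingEnd ℂ (u y)) := fun y => by
  change Star.star (a.1 y) = _; rw [ha]; rfl

theorem rep_algebraMap (c : ℂ) : Rep (algebraMap ℂ (SmoothAlg n V) c) (fun _ => c) := fun _ => rfl

theorem Rep.smul {a : SmoothAlg n V} {u : M → ℂ} (ha : Rep a u) (c : ℂ) :
    Rep (c • a) (fun y => c * u y) := by
  rw [Algebra.smul_def]
  exact (rep_algebraMap c).mul ha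

theorem rep_zero : Rep (0 : SmoothAlg n V) (fun _ => 0) := fun _ => rfl

theorem rep_one : Rep (1 : SmoothAlg n V) (fun _ => 1) := fun _ => rfl

theorem rep_natCast (m : ℕ) : Rep (m : SmoothAlg n V) (fun _ => (m : ℂ)) := fun _ => rfl

theorem Rep.sum {ι : Type*} (s : Finset ι) {a : ι → SmoothAlg n V} {u : ι → M → ℂ}
    (h : ∀ i, Rep (a i) (u i)) : Rep (∑ i ∈ s, a i) (fun y => ∑ i ∈ s, u i y) := by
  classical
  induction s using Finset.induction_on with
  | empty => simpa using rep_zero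
  | insert i s hi ih => simpa only [Finset.sum_insert hi] using (h i).add ih

/-- Evaluation at a point. -/
def eval (y : V) : SmoothAlg n V →+* ℂ where
  toFun a := a.1 y
  map_one' := rfl
  map_mul' _ _ := rfl
  map_zero' := rfl
  map_add' _ _ := rfl

/-- A function on `V` that is pointwise inverse to an element of the algebra is in the algebra. -/
theorem exists_inv (a : SmoothAlg n V) (h : ∀ y : V, a.1 y ≠ 0) :
    ∃ b : SmoothAlg n V, ∀ y : V, b.1 y = (a.1 y)⁻¹ := by
  obtain ⟨u, hu, h'⟩ := a.2
  exact ⟨mk _ (hu.inv fun x hx => by rw [← h' ⟨x, hx⟩]; exact h _), fun y => by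
    rw [rep_mk, h']⟩

theorem Rep.mdifferentiableAt {a : SmoothAlg n V} {u : M → ℂ} (h : Rep a u) (hV : IsOpen V) {x : M}
    (hx : x ∈ V) : MDifferentiableAt (𝓡 (2 * n + 1)) 𝓘(ℝ, ℂ) u x :=
  h.smooth.mdifferentiableAt hV hx

variable [IsManifold (𝓡 (2 * n + 1)) ∞ M]

/-- The derivative of an element of the algebra along a smooth complex vector field. -/
def derivFn (hV : IsOpen V) (W : ComplexField n M) (hW : W.SmoothOn V) (a : SmoothAlg n V) :
    SmoothAlg n V :=
  mk (W.deriv (exists_rep a).choose) ((exists_rep a).choose_spec.1.deriv hV hW)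

/-- The chosen representative is immaterial: any two agree on the open set `V`, hence have equal
derivatives there. -/
theorem Rep.derivFn {a : SmoothAlg n V} {u : M → ℂ} (ha : Rep a u) (hV : IsOpen V)
    {W : ComplexField n M} (hW : W.SmoothOn V) :
    Rep (SmoothAlg.derivFn hV W hW a) (W.deriv u) := fun y =>
  W.deriv_congr_on hV (fun _ hz => (exists_rep a).choose_spec.2.eq ha hz) y.2

/-- The derivation of the algebra of smooth functions given by a smooth complex vector field. -/
def derivation (hV : IsOpen V) (W : ComplexField n M) (hW : W.SmoothOn V) :
    Derivation ℂ (SmoothAlg n V) (SmoothAlg n V) :=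
  Derivation.mk'
    { toFun := derivFn hV W hW
      map_add' := fun a b => by
        obtain ⟨u, -, hu⟩ := exists_rep a
        obtain ⟨w, -, hw⟩ := exists_rep b
        refine ((hu.add hw).derivFn hV hW).ext ((hu.derivFn hV hW).add (hw.derivFn hV hW))
          fun y hy => ?_
        exact W.deriv_add (hu.mdifferentiableAt hV hy) (hw.mdifferentiableAt hV hy)
      map_smul' := fun c a => by
        obtain ⟨u, -, hu⟩ := exists_rep a
        rw [RingHom.id_apply, Algebra.smul_def, Algebra.smul_def]
        have hc : Rep (algebraMap ℂ (SmoothAlg n V) c) (fun _ => c) := rep_algebraMap c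
        refine ((hc.mul hu).derivFn hV hW).ext (hc.mul (hu.derivFn hV hW)) fun y hy => ?_
        rw [W.deriv_mul (hc.mdifferentiableAt hV hy) (hu.mdifferentiableAt hV hy),
          W.deriv_const, mul_zero, add_zero] }
    fun a b => by
      obtain ⟨u, -, hu⟩ := exists_rep a
      obtain ⟨w, -, hw⟩ := exists_rep b
      rw [smul_eq_mul, smul_eq_mul]
      refine ((hu.mul hw).derivFn hV hW).ext
        ((hu.mul (hw.derivFn hV hW)).add (hw.mul (hu.derivFn hV hW))) fun y hy => ?_
      exact W.deriv_mul (hu.mdifferentiableAt hV hy) (hw.mdifferentiableAt hV hy)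

theorem Rep.derivation {a : SmoothAlg n V} {u : M → ℂ} (ha : Rep a u) (hV : IsOpen V)
    {W : ComplexField n M} (hW : W.SmoothOn V) :
    Rep (SmoothAlg.derivation hV W hW a) (W.deriv u) := ha.derivFn hV hW

theorem eval_derivation_mk (hV : IsOpen V) {W : ComplexField n M} (hW : W.SmoothOn V) {u : M → ℂ}
    (hu : SmoothFnOn n u V) (y : V) :
    eval y (derivation hV W hW (mk u hu)) = W.deriv u y := (rep_mk u hu).derivation hV hW y

end SmoothAlg

variable [IsManifold (𝓡 (2 * n + 1)) ∞ M]

theorem ComplexField.SmoothOn.mono {W : ComplexField n M} {U V : Set M} (hW : W.SmoothOn U)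
    (h : V ⊆ U) : W.SmoothOn V := ⟨ContMDiffOn.mono hW.1 h, ContMDiffOn.mono hW.2 h⟩

theorem ComplexForm.SmoothOn.conj_app {η : ComplexForm n M} {U : Set M} (hη : η.SmoothOn U)
    {W : ComplexField n M} (hW : W.SmoothOn U) : SmoothFnOn n (η.conj.app W) U :=
  (hη.app hW.conj).star.congr fun x _ => ComplexForm.conj_app η W x

/-- A complex tangent vector at a point of `V` that annihilates all smooth functions on `V` is
annihilated by all forms. -/
theorem ComplexForm.app_eq_zero_of_deriv_eq_zero {V : Set M} (x₀ : M)
    (hV : V ⊆ (chartAt (EuclideanSpace ℝ (Fin (2 * n + 1))) x₀).source) (hVo : IsOpen V)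
    {x : M} (hx : x ∈ V) (W : ComplexField n M)
    (hW : ∀ u : M → ℂ, SmoothFnOn n u V → W.deriv u x = 0) (η : ComplexForm n M) :
    η.app W x = 0 := by
  have key : ∀ u : M → ℂ, SmoothFnOn n u V →
      differential u x (W.re x) = 0 ∧ differential u x (W.im x) = 0 := by
    intro u hu
    have h1 := hW u hu
    have h2 := hW _ hu.star
    have h3 := W.conj.deriv_star (hu.mdifferentiableAt hVo hx)
    rw [ComplexField.conj_conj, h2, map_eq_zero] at h3
    simp only [ComplexField.deriv, ComplexField.conj, map_neg] at h1 h3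
    have h4 : Complex.I * differential u x (W.im x) = 0 := by linear_combination (h1 - h3) / 2
    exact ⟨by linear_combination (h1 + h3) / 2,
      (mul_eq_zero.1 h4).resolve_left Complex.I_ne_zero⟩
  rw [ComplexForm.app, eq_zero_of_differential_eq_zero x₀ hV hx _ fun u hu => (key u hu).1,
    eq_zero_of_differential_eq_zero x₀ hV hx _ fun u hu => (key u hu).2]
  simp

namespace PseudohermitianStructure.AdmissibleFrame

variable {S : PseudohermitianStructure n M} {U : Set M} (F : S.AdmissibleFrame U)

theorem h_smooth (hU : IsOpen U) (α β : Fin n) : SmoothFnOn n (F.h α β) U := by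
  have h1 := (SmoothFnOn.const (n := n) Complex.I U).mul
    ((S.theta_smooth U).app ((F.Z_smooth α).bracket hU (F.Z_smooth β).conj))
  refine h1.congr fun x hx => ?_
  rw [F.theta_bracket_Z_Zbar hx hU]
  linear_combination F.h α β x * Complex.I_mul_I

theorem omega_zero_smooth (hU : IsOpen U) (α γ : Fin n) : SmoothFnOn n (F.omega α γ .zero) U :=
  ((F.coframe_smooth γ).app (F.T_smooth.toComplex.bracket hU (F.Z_smooth α))).congr
    fun _ hx => (F.coframe_bracket_T_Z hx hU α γ).symm

theorem omega_anti_smooth (hU : IsOpen U) (α γ β : Fin n) :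
    SmoothFnOn n (F.omega α γ (.anti β)) U := by
  have h1 := (SmoothFnOn.const (n := n) (-1) U).mul ((F.coframe_smooth γ).app
    ((F.Z_smooth α).bracket hU (F.Z_smooth β).conj))
  refine h1.congr fun x hx => ?_
  rw [F.coframe_bracket_Z_Zbar hx hU, neg_mul_neg, one_mul]

theorem r_smooth (hU : IsOpen U) (α γ : Fin n) : SmoothFnOn n (F.r α γ) U :=
  (F.coframe_smooth γ).conj_app (F.T_smooth.toComplex.bracket hU (F.Z_smooth α))

theorem c_smooth (hU : IsOpen U) (α β γ : Fin n) : SmoothFnOn n (F.c α β γ) U :=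
  (F.coframe_smooth γ).app ((F.Z_smooth α).bracket hU (F.Z_smooth β))

/-- Cramer's rule inside the algebra of smooth functions: the adjugate is polynomial in `h` and the
determinant is nowhere zero. -/
theorem hInv_smooth (hU : IsOpen U) (α β : Fin n) : SmoothFnOn n (F.hInv α β) U := by
  let Hm : Matrix (Fin n) (Fin n) (SmoothAlg n U) :=
    Matrix.of fun γ δ => SmoothAlg.mk (F.h γ δ) (F.h_smooth hU γ δ)
  have hev : ∀ y : U, (SmoothAlg.eval y).mapMatrix Hm = Matrix.of fun γ δ => F.h γ δ y :=
    fun y => rfl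
  have hdet : ∀ y : U, (Hm.det).1 y = (Matrix.of fun γ δ => F.h γ δ y).det := fun y => by
    rw [← hev y, ← RingHom.map_det]; rfl
  obtain ⟨b, hb⟩ := SmoothAlg.exists_inv Hm.det fun y => by
    rw [hdet]; exact F.det_h_ne_zero y.2 hU
  have hrep : SmoothAlg.Rep (b * Hm.adjugate β α) (F.hInv α β) := by
    intro y
    change b.1 y * (SmoothAlg.eval y) (Hm.adjugate β α) = _
    have hadj : (SmoothAlg.eval y) (Hm.adjugate β α) =
        (Matrix.of fun γ δ => F.h γ δ y).adjugate β α := by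
      rw [← hev y, ← RingHom.map_adjugate]; rfl
    rw [hb, hdet, hadj, hInv, Matrix.inv_def, Matrix.smul_apply, smul_eq_mul,
      Ring.inverse_eq_inv']
  exact hrep.smooth

/-- The algebraic model of a frame on a small open set. -/
def frameAlgebra (hU : IsOpen U) {V : Set M} (hVo : IsOpen V) (hVU : V ⊆ U) (x₀ : M)
    (hV : V ⊆ (chartAt (EuclideanSpace ℝ (Fin (2 * n + 1))) x₀).source) :
    FrameAlgebra n (SmoothAlg n V) where
  T := SmoothAlg.derivation hVo F.T.toComplex (F.T_smooth.toComplex.mono hVU)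
  Z α := SmoothAlg.derivation hVo (F.Z α) ((F.Z_smooth α).mono hVU)
  Zb α := SmoothAlg.derivation hVo (F.Z α).conj ((F.Z_smooth α).conj.mono hVU)
  h α β := SmoothAlg.mk (F.h α β) ((F.h_smooth hU α β).mono hVU)
  hInv α β := SmoothAlg.mk (F.hInv α β) ((F.hInv_smooth hU α β).mono hVU)
  w0 α γ := SmoothAlg.mk (F.omega α γ .zero) ((F.omega_zero_smooth hU α γ).mono hVU)
  r α γ := SmoothAlg.mk (F.r α γ) ((F.r_smooth hU α γ).mono hVU)
  wa α γ β := SmoothAlg.mk (F.omega α γ (.anti β)) ((F.omega_anti_smooth hU α γ β).mono hVU)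
  c α β γ := SmoothAlg.mk (F.c α β γ) ((F.c_smooth hU α β γ).mono hVU)
  star_T f := by
    obtain ⟨u, hu, hf⟩ := SmoothAlg.exists_rep f
    refine (hf.derivation hVo _).star.ext (hf.star.derivation hVo _) fun y hy => ?_
    rw [ComplexField.deriv_star _ (hu.mdifferentiableAt hVo hy), RealField.toComplex_conj]
  star_Z α f := by
    obtain ⟨u, hu, hf⟩ := SmoothAlg.exists_rep f
    refine (hf.derivation hVo _).star.ext (hf.star.derivation hVo _) fun y hy => ?_
    rw [ComplexField.deriv_star _ (hu.mdifferentiableAt hVo hy)]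
  star_h α β := (SmoothAlg.rep_mk _ _).star.ext (SmoothAlg.rep_mk _ _) fun y hy =>
    F.star_h (hVU hy) hU α β
  hInv_h α γ := by
    have h1 := SmoothAlg.Rep.sum Finset.univ fun β =>
      (SmoothAlg.rep_mk (F.hInv α β) ((F.hInv_smooth hU α β).mono hVU)).mul
        (SmoothAlg.rep_mk (F.h γ β) ((F.h_smooth hU γ β).mono hVU))
    have h2 := h1.congr fun y hy => F.sum_hInv_mul_h (hVU hy) hU α γ
    split_ifs at h2 ⊢ with h
    · exact h2.ext SmoothAlg.rep_one fun _ _ => rfl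
    · exact h2.ext SmoothAlg.rep_zero fun _ _ => rfl
  lie_Z_Zb α β f := by
    obtain ⟨u, hu, hf⟩ := SmoothAlg.exists_rep f
    have hZ := (F.Z_smooth α).mono hVU
    have hZb := (F.Z_smooth β).conj.mono hVU
    refine (((hf.derivation hVo hZb).derivation hVo hZ).sub
      ((hf.derivation hVo hZ).derivation hVo hZb)).ext
      (((((SmoothAlg.rep_algebraMap _).mul (SmoothAlg.rep_mk _ _)).neg.mul
        (hf.derivation hVo _)).sub (SmoothAlg.Rep.sum Finset.univ fun γ =>
          (SmoothAlg.rep_mk _ _).mul (hf.derivation hVo _))).add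
        (SmoothAlg.Rep.sum Finset.univ fun γ =>
          (SmoothAlg.rep_mk _ _).star.mul (hf.derivation hVo _))) fun y hy => ?_
    rw [← ComplexField.deriv_bracket hVo hu hZ hZb hy, F.deriv_expand (hVU hy),
      F.theta_bracket_Z_Zbar (hVU hy) hU]
    simp only [F.coframe_bracket_Z_Zbar (hVU hy) hU, F.coframe_conj_bracket_Z_Zbar (hVU hy) hU,
      neg_mul, Finset.sum_neg_distrib, ← sub_eq_add_neg]
  lie_T_Z α f := by
    obtain ⟨u, hu, hf⟩ := SmoothAlg.exists_rep f
    have hZ := (F.Z_smooth α).mono hVU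
    have hT := F.T_smooth.toComplex.mono hVU
    refine (((hf.derivation hVo hZ).derivation hVo hT).sub
      ((hf.derivation hVo hT).derivation hVo hZ)).ext
      ((SmoothAlg.Rep.sum Finset.univ fun γ =>
          (SmoothAlg.rep_mk _ _).mul (hf.derivation hVo _)).add
        (SmoothAlg.Rep.sum Finset.univ fun γ =>
          (SmoothAlg.rep_mk _ _).mul (hf.derivation hVo _))) fun y hy => ?_
    rw [← ComplexField.deriv_bracket hVo hu hT hZ hy, F.deriv_expand (hVU hy),
      F.theta_bracket_T_Z (hVU hy) hU]
    simp only [F.coframe_bracket_T_Z (hVU hy) hU, zero_mul, zero_add]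
    rfl
  lie_Z_Z α β f := by
    obtain ⟨u, hu, hf⟩ := SmoothAlg.exists_rep f
    have hZ := (F.Z_smooth α).mono hVU
    have hZ' := (F.Z_smooth β).mono hVU
    refine (((hf.derivation hVo hZ').derivation hVo hZ).sub
      ((hf.derivation hVo hZ).derivation hVo hZ')).ext
      (SmoothAlg.Rep.sum Finset.univ fun γ =>
          (SmoothAlg.rep_mk _ _).mul (hf.derivation hVo _)) fun y hy => ?_
    rw [← ComplexField.deriv_bracket hVo hu hZ hZ' hy, F.deriv_expand (hVU hy),
      F.theta_bracket_Z_Z (hVU hy) hU]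
    simp only [F.coframe_conj_bracket_Z_Z (hVU hy) hU, zero_mul, zero_add, Finset.sum_const_zero,
      add_zero]
    rfl
  indep a b c hf := by
    have key : ∀ (y : V) (η : ComplexForm n M), a.1 y * η.app F.T.toComplex y +
        ∑ γ, (b γ).1 y * η.app (F.Z γ) y + ∑ γ, (c γ).1 y * η.app (F.Z γ).conj y = 0 := by
      intro y η
      -- The combination of frame fields with coefficients frozen at `y`, split into real and
      -- imaginary parts. It kills every smooth function at `y`, hence every form kills it; testing
      -- against `θ`, `θ^α` and their conjugates isolates the coefficients.
      let W : ComplexField n M :=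
        { re := fun x => (a.1 y).re • F.T x +
            ∑ γ, ((b γ).1 y + (c γ).1 y).re • (F.Z γ).re x -
            ∑ γ, ((b γ).1 y - (c γ).1 y).im • (F.Z γ).im x
          im := fun x => (a.1 y).im • F.T x +
            ∑ γ, ((b γ).1 y + (c γ).1 y).im • (F.Z γ).re x +
            ∑ γ, ((b γ).1 y - (c γ).1 y).re • (F.Z γ).im x }
      have hWη : ∀ η : ComplexForm n M, η.app W y = a.1 y * η.app F.T.toComplex y +
          ∑ γ, (b γ).1 y * η.app (F.Z γ) y + ∑ γ, (c γ).1 y * η.app (F.Z γ).conj y := by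
        intro η
        have hs : ∀ z : ℂ, z = z.re + Complex.I * z.im := fun z => by
          rw [mul_comm, Complex.re_add_im]
        simp only [ComplexForm.app, W, RealField.toComplex, ComplexField.conj, map_add, map_sub,
          map_sum, map_smul, map_neg, map_zero, Complex.real_smul, mul_zero, add_zero]
        have hsum : ∑ γ, (((b γ).1 y + (c γ).1 y).re : ℂ) * η y ((F.Z γ).re y) -
            ∑ γ, (((b γ).1 y - (c γ).1 y).im : ℂ) * η y ((F.Z γ).im y) +
            Complex.I * (∑ γ, (((b γ).1 y + (c γ).1 y).im : ℂ) * η y ((F.Z γ).re y) +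
              ∑ γ, (((b γ).1 y - (c γ).1 y).re : ℂ) * η y ((F.Z γ).im y)) =
            ∑ γ, (b γ).1 y * (η y ((F.Z γ).re y) + Complex.I * η y ((F.Z γ).im y)) +
            ∑ γ, (c γ).1 y * (η y ((F.Z γ).re y) + Complex.I * -η y ((F.Z γ).im y)) := by
          simp only [← Finset.sum_add_distrib, ← Finset.sum_sub_distrib, Finset.mul_sum]
          refine Finset.sum_congr rfl fun γ _ => ?_
          linear_combination -η y ((F.Z γ).re y) * hs ((b γ).1 y + (c γ).1 y) -
            Complex.I * η y ((F.Z γ).im y) * hs ((b γ).1 y - (c γ).1 y) -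
            (((b γ).1 y - (c γ).1 y).im : ℂ) * η y ((F.Z γ).im y) * Complex.I_mul_I
        linear_combination hsum - η y (F.T y) * hs (a.1 y)
      rw [← hWη]
      refine ComplexForm.app_eq_zero_of_deriv_eq_zero x₀ hV hVo y.2 W (fun u hu => ?_) η
      have h1 := hf (SmoothAlg.mk u hu)
      have h2 := congrArg (SmoothAlg.eval y) h1
      simp only [map_add, map_sum, map_mul, map_zero, SmoothAlg.eval_derivation_mk] at h2
      change (differential u).app W y = 0
      rw [hWη, ← h2]
      rfl
    have conj_Z : ∀ (y : V) (α γ : Fin n), (F.coframe α).conj.app (F.Z γ) y = 0 := fun y α γ => by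
      rw [ComplexForm.conj_app, F.coframe_Zbar α γ y (hVU y.2), map_zero]
    have conj_Zb : ∀ (y : V) (α γ : Fin n), (F.coframe α).conj.app (F.Z γ).conj y =
        if α = γ then 1 else 0 := fun y α γ => by
      rw [ComplexForm.conj_app, ComplexField.conj_conj, F.coframe_Z α γ y (hVU y.2)]
      split_ifs <;> simp
    have conj_T : ∀ (y : V) (α : Fin n), (F.coframe α).conj.app F.T.toComplex y = 0 := fun y α => by
      rw [ComplexForm.conj_app, RealField.toComplex_conj, F.coframe_toComplex (hVU y.2), map_zero]
    refine ⟨Subtype.ext (funext fun y => ?_), fun α => Subtype.ext (funext fun y => ?_),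
      fun α => Subtype.ext (funext fun y => ?_)⟩
    · have h1 := key y S.theta
      simp only [F.theta_Z (hVU y.2), F.theta_Zbar (hVU y.2), mul_zero, Finset.sum_const_zero,
        add_zero] at h1
      rwa [show S.theta.app F.T.toComplex y = 1 by
        simp [theta_app_real, RealField.toComplex, F.form_T y (hVU y.2)], mul_one] at h1
    · have h1 := key y (F.coframe α)
      simpa [F.coframe_toComplex (hVU y.2), F.coframe_Z _ _ y (hVU y.2),
        F.coframe_Zbar _ _ y (hVU y.2)] using h1
    · have h1 := key y (F.coframe α).conj
      simpa [conj_Z, conj_Zb, conj_T] using h1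

end PseudohermitianStructure.AdmissibleFrame
end CRGeom

/-! ### The dictionary between the algebraic and the geometric quantities. -/

namespace CRGeom

namespace PseudohermitianStructure.AdmissibleFrame

open SmoothAlg

variable {n : ℕ} {M : Type*} [TopologicalSpace M]
  [ChartedSpace (EuclideanSpace ℝ (Fin (2 * n + 1))) M] [IsManifold (𝓡 (2 * n + 1)) ∞ M]
  {S : PseudohermitianStructure n M} {U : Set M} (F : S.AdmissibleFrame U)

theorem sum_hInv_mul_h_self (hU : IsOpen U) {x : M} (hx : x ∈ U) :
    ∑ α, ∑ β, F.hInv α β x * F.h α β x = n := by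
  simp [F.sum_hInv_mul_h hx hU]

theorem P_eq (hU : IsOpen U) {x : M} (hx : x ∈ U) : F.P x = 1 / (2 * ((n : ℂ) + 1)) * F.R x := by
  have h1 : F.P x = 1 / ((n : ℂ) + 2) * (∑ α, ∑ β, F.hInv α β x * F.ricci α β x -
      1 / (2 * ((n : ℂ) + 1)) * F.R x * ∑ α, ∑ β, F.hInv α β x * F.h α β x) := by
    simp only [P, trace, schouten, Finset.mul_sum, ← Finset.sum_sub_distrib]
    exact Finset.sum_congr rfl fun _ _ => Finset.sum_congr rfl fun _ _ => by ring
  rw [h1, F.sum_hInv_mul_h_self hU hx]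
  change 1 / ((n : ℂ) + 2) * (F.R x - _) = _
  have : (n : ℂ) + 1 ≠ 0 := by exact_mod_cast Nat.succ_ne_zero n
  have : (n : ℂ) + 2 ≠ 0 := by exact_mod_cast Nat.succ_ne_zero (n + 1)
  field_simp
  ring

theorem schouten0_eq (hU : IsOpen U) (hn : n ≠ 0) {x : M} (hx : x ∈ U) (α β : Fin n) :
    F.schouten0 α β x =
      1 / ((n : ℂ) + 2) * (F.ricci α β x - (n : ℂ)⁻¹ * F.R x * F.h α β x) := by
  rw [schouten0, schouten, F.P_eq hU hx]
  have : (n : ℂ) + 1 ≠ 0 := by exact_mod_cast Nat.succ_ne_zero n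
  have : (n : ℂ) + 2 ≠ 0 := by exact_mod_cast Nat.succ_ne_zero (n + 1)
  have : (n : ℂ) ≠ 0 := by exact_mod_cast hn
  field_simp
  ring

/-- The algebra `G` of smooth functions on `V` models the frame `F`. -/
structure IsModel {V : Set M} (G : FrameAlgebra n (SmoothAlg n V)) : Prop where
  isOpen : IsOpen U
  subset : V ⊆ U
  T {a : SmoothAlg n V} {u : M → ℂ} (ha : Rep a u) : Rep (G.T a) (F.nabla0 u)
  Z {a : SmoothAlg n V} {u : M → ℂ} (ha : Rep a u) (α : Fin n) : Rep (G.Z α a) (F.grad u α)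
  Zb {a : SmoothAlg n V} {u : M → ℂ} (ha : Rep a u) (α : Fin n) :
    Rep (G.Zb α a) (F.gradBar u α)
  h (α β : Fin n) : Rep (G.h α β) (F.h α β)
  hInv (α β : Fin n) : Rep (G.hInv α β) (F.hInv α β)
  w0 (α β : Fin n) : Rep (G.w0 α β) (F.omega α β .zero)
  wa (α γ β : Fin n) : Rep (G.wa α γ β) (F.omega α γ (.anti β))
  r (α γ : Fin n) : Rep (G.r α γ) (F.r α γ)

theorem isModel_frameAlgebra (hU : IsOpen U) {V : Set M} (hVo : IsOpen V) (hVU : V ⊆ U) (x₀ : M)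
    (hV : V ⊆ (chartAt (EuclideanSpace ℝ (Fin (2 * n + 1))) x₀).source) :
    F.IsModel (F.frameAlgebra hU hVo hVU x₀ hV) where
  isOpen := hU
  subset := hVU
  T ha := ha.derivation hVo _
  Z ha _ := ha.derivation hVo _
  Zb ha _ := ha.derivation hVo _
  h _ _ := fun _ => rfl
  hInv _ _ := fun _ => rfl
  w0 _ _ := fun _ => rfl
  wa _ _ _ := fun _ => rfl
  r _ _ := fun _ => rfl

namespace IsModel

variable {F} {V : Set M} {G : FrameAlgebra n (SmoothAlg n V)} (m : F.IsModel G)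
include m

theorem e {a : SmoothAlg n V} {u : M → ℂ} (ha : Rep a u) (d : Dir n) :
    Rep (G.e d a) ((F.field d).deriv u) := by
  rcases d with _ | α | α
  exacts [m.T ha, m.Z ha α, m.Zb ha α]

theorem wh (α γ β : Fin n) : Rep (G.wh α γ β) (F.omega α γ (.hol β)) :=
  Rep.sum _ fun δ => (m.hInv γ δ).mul ((m.Z (m.h α δ) β).sub
    (Rep.sum _ fun σ => (m.h α σ).mul (m.wa δ σ β).star))

theorem om (α γ : Fin n) (d : Dir n) : Rep (G.om α γ d) (F.omega α γ d) := by
  rcases d with _ | β | β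
  exacts [m.w0 α γ, m.wh α γ β, m.wa α γ β]

theorem cov {a : Fin n → SmoothAlg n V} {σ : Fin n → M → ℂ} (h : ∀ α, Rep (a α) (σ α))
    (d : Dir n) (α : Fin n) : Rep (G.cov d a α) (F.cov d σ α) :=
  (m.e (h α) d).sub (Rep.sum _ fun γ => (m.om α γ d).mul (h γ))

theorem covBar {a : Fin n → SmoothAlg n V} {σ : Fin n → M → ℂ} (h : ∀ α, Rep (a α) (σ α))
    (d : Dir n) (α : Fin n) : Rep (G.covBar d a α) (F.covBar d σ α) :=
  (m.e (h α) d).sub (Rep.sum _ fun γ => (m.om α γ d.conj).star.mul (h γ))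

theorem div {a : Fin n → SmoothAlg n V} {σ : Fin n → M → ℂ} (h : ∀ α, Rep (a α) (σ α)) :
    Rep (G.div a) (F.div σ) :=
  Rep.sum _ fun α => Rep.sum _ fun β => (m.hInv α β).mul (m.cov h (.anti β) α)

theorem divBar {a : Fin n → SmoothAlg n V} {σ : Fin n → M → ℂ} (h : ∀ α, Rep (a α) (σ α)) :
    Rep (G.divBar a) (F.divBar σ) :=
  Rep.sum _ fun α => Rep.sum _ fun β => (m.hInv α β).mul (m.covBar h (.hol α) β)

theorem lap {a : SmoothAlg n V} {u : M → ℂ} (ha : Rep a u) :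
    Rep (G.lap a) (F.sublaplacian u) :=
  ((m.div (m.Z ha)).add (m.divBar (m.Zb ha))).neg

theorem gradUp {a : SmoothAlg n V} {u : M → ℂ} (ha : Rep a u) (α : Fin n) :
    Rep (G.gradUp a α) (F.gradUp u α) :=
  Rep.sum _ fun β => (m.hInv α β).mul (m.Zb ha β)

theorem gradBarUp {a : SmoothAlg n V} {u : M → ℂ} (ha : Rep a u) (α : Fin n) :
    Rep (G.gradBarUp a α) (F.gradBarUp u α) :=
  Rep.sum _ fun β => (m.hInv β α).mul (m.Z ha β)

theorem tor (α β : Fin n) : Rep (G.tor α β) (F.A α β) :=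
  (Rep.sum _ fun γ => (m.h α γ).mul (m.r β γ)).neg.congr fun y hy => by
    rw [A, map_sum, ← Finset.sum_neg_distrib]
    refine Finset.sum_congr rfl fun γ _ => ?_
    rw [F.d_coframe_T_Zbar (m.subset hy) m.isOpen, map_mul, map_neg, Complex.conj_conj,
      F.star_h (m.subset hy) m.isOpen, mul_neg]

theorem torsionDiv {a : SmoothAlg n V} {u : M → ℂ} (ha : Rep a u) :
    Rep (G.torsionDiv a) (F.torsionDiv u) :=
  m.div fun α => Rep.sum _ fun β => (m.tor α β).mul (m.gradUp ha β)

theorem divTor (α : Fin n) : Rep (G.divTor α) (F.divA α) :=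
  Rep.sum _ fun β => Rep.sum _ fun γ => (m.hInv β γ).mul
    (((m.Zb (m.tor α β) γ).sub (Rep.sum _ fun δ => (m.wa α δ γ).mul (m.tor δ β))).sub
      (Rep.sum _ fun δ => (m.wa β δ γ).mul (m.tor α δ)))

/-- The geometric Ricci tensor contracts the full curvature, the algebraic one uses only `d(tr ω)`;
they agree because the trace of `ω ∧ ω` is zero. -/
theorem ric (α β : Fin n) : Rep (G.ric α β) (F.ricci α β) := by
  have h1 := Rep.sum Finset.univ fun γ => (((m.Z (m.wa γ γ β) α).sub (m.Zb (m.wh γ γ α) β)).sub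
    (((((rep_algebraMap Complex.I).mul (m.h α β)).neg.mul (m.w0 γ γ)).add
      (Rep.sum Finset.univ fun μ => (m.wa α μ β).neg.mul (m.wh γ γ μ))).add
      (Rep.sum Finset.univ fun μ => (m.wa β μ α).star.mul (m.wa γ γ μ)))).sub
    (Rep.sum Finset.univ fun μ => ((m.wh γ μ α).mul (m.wa μ γ β)).sub
      ((m.wa γ μ β).mul (m.wh μ γ α)))
  have hquad : ∑ γ, ∑ μ, (G.wh γ μ α * G.wa μ γ β - G.wa γ μ β * G.wh μ γ α) = 0 := by
    simp only [Finset.sum_sub_distrib]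
    rw [sub_eq_zero, Finset.sum_comm]
    exact Finset.sum_congr rfl fun _ _ => Finset.sum_congr rfl fun _ _ => mul_comm _ _
  have h2 : ∀ w : Fin n → Fin n → SmoothAlg n V, ∀ b : Fin n → SmoothAlg n V,
      ∑ γ, ∑ μ, b μ * w γ μ = ∑ μ, b μ * ∑ γ, w γ μ := fun w b => by
    rw [Finset.sum_comm]
    simp only [Finset.mul_sum]
  have h3 : G.ric α β = ∑ γ, (G.Z α (G.wa γ γ β) - G.Zb β (G.wh γ γ α) -
      (-(algebraMap ℂ _ Complex.I * G.h α β) * G.w0 γ γ + ∑ μ, -G.wa α μ β * G.wh γ γ μ +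
        ∑ μ, star (G.wa β μ α) * G.wa γ γ μ) -
      ∑ μ, (G.wh γ μ α * G.wa μ γ β - G.wa γ μ β * G.wh μ γ α)) := by
    rw [Finset.sum_sub_distrib, hquad, sub_zero, FrameAlgebra.ric, FrameAlgebra.rho, dForm,
      Dir.sum_eq]
    simp only [Finset.sum_sub_distrib, Finset.sum_add_distrib, h2, ← Finset.mul_sum, ← map_sum]
    rfl
  rw [h3]
  refine h1.congr fun y hy => Finset.sum_congr rfl fun γ _ => ?_
  rw [curvature, omegaApp, F.theta_bracket_Z_Zbar (m.subset hy) m.isOpen]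
  simp only [F.coframe_bracket_Z_Zbar (m.subset hy) m.isOpen,
    F.coframe_conj_bracket_Z_Zbar (m.subset hy) m.isOpen]
  rfl

theorem scal : Rep G.scal F.R :=
  Rep.sum _ fun α => Rep.sum _ fun β => (m.hInv α β).mul (m.ric α β)

theorem ric0 (hn : n ≠ 0) (α β : Fin n) :
    Rep ((1 / ((n : ℂ) + 2)) • G.ric0 α β) (F.schouten0 α β) :=
  (((m.ric α β).sub (((rep_algebraMap _).mul m.scal).mul (m.h α β))).smul _).congr fun _ hy =>
    (F.schouten0_eq m.isOpen hn (m.subset hy) α β).symm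

theorem schoutenDiv (hn : n ≠ 0) {a : SmoothAlg n V} {u : M → ℂ} (ha : Rep a u) :
    Rep (G.div fun δ => ∑ γ, ((1 / ((n : ℂ) + 2)) • G.ric0 δ γ) * G.gradBarUp a γ)
      (F.schoutenDiv u) :=
  m.div fun δ => Rep.sum _ fun γ => (m.ric0 hn δ γ).mul (m.gradBarUp ha γ)

end IsModel

end PseudohermitianStructure.AdmissibleFrame
end CRGeom

/-! ### Return to the manifold: the higher-dimensional and the critical operator. -/

namespace CRGeom

theorem FrameAlgebra.div_smul {n : ℕ} {A : Type*} [CommRing A] [StarRing A] [Algebra ℂ A]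
    [StarModule ℂ A] (F : FrameAlgebra n A) (c : ℂ) (σ : Fin n → A) :
    F.div (fun α => c • σ α) = c • F.div σ := by
  simp only [div, cov, Derivation.map_smul, mul_smul_comm, ← Finset.smul_sum, ← smul_sub]

namespace PseudohermitianStructure.AdmissibleFrame

open SmoothAlg

variable {n : ℕ} {M : Type*} [TopologicalSpace M]
  [ChartedSpace (EuclideanSpace ℝ (Fin (2 * n + 1))) M] [IsManifold (𝓡 (2 * n + 1)) ∞ M]
  {S : PseudohermitianStructure n M} {U : Set M} (F : S.AdmissibleFrame U)

/-- `V` is cut down to the frame domain, the domain of the CR function and one chart. The factor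
`1/2` comes from `Re v = v/2 + v̄/2`. -/
theorem exists_isModel (hU : IsOpen U) {f : M → ℝ} (hf : S.IsPluriharmonic f) {x : M}
    (hx : x ∈ U) : ∃ (V : Set M) (G : FrameAlgebra n (SmoothAlg n V)) (v : SmoothAlg n V),
      x ∈ V ∧ F.IsModel G ∧ (∀ α, G.Zb α v = 0) ∧ Rep (v + star v) (fun y => (f y : ℂ)) := by
  obtain ⟨U', hU', hxU', v, ⟨hv, hcr⟩, hfv⟩ := hf.2 x
  let V := U ∩ U' ∩ (chartAt (EuclideanSpace ℝ (Fin (2 * n + 1))) x).source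
  have hVo : IsOpen V := (hU.inter hU').inter (chartAt _ x).open_source
  have hVU : V ⊆ U := fun y hy => hy.1.1
  have hVU' : V ⊆ U' := fun y hy => hy.1.2
  have hv' : SmoothFnOn n v V := ContMDiffOn.mono hv hVU'
  have m := F.isModel_frameAlgebra hU hVo hVU x (fun y hy => hy.2)
  refine ⟨V, F.frameAlgebra hU hVo hVU x (fun y hy => hy.2), (1 / 2 : ℂ) • SmoothAlg.mk v hv',
    ⟨⟨hx, hxU'⟩, mem_chart_source _ x⟩, m, fun α => ?_, ?_⟩
  · rw [Derivation.map_smul]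
    suffices h : (F.frameAlgebra hU hVo hVU x (fun y hy => hy.2)).Zb α (SmoothAlg.mk v hv') = 0 by
      rw [h, smul_zero]
    refine (m.Zb (rep_mk v hv') α).ext rep_zero fun y hy => ?_
    -- For `w = Re Z_α` one has `J w = -Im Z_α`, so the CR condition reads `Z_ᾱ v = 0`.
    have h1 := hcr y (hVU' hy) ((F.Z α).re y) (F.form_re (hVU hy) α)
    rw [F.J_re (hVU hy)] at h1
    exact h1
  · refine (((rep_mk v hv').smul _).add ((rep_mk v hv').smul _).star).congr fun y hy => ?_
    rw [hfv y (hVU' hy), Complex.re_eq_add_conj, map_mul]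
    simp only [one_div, map_inv₀, Complex.conj_ofNat]
    ring

namespace IsModel

variable {F} {V : Set M} {G : FrameAlgebra n (SmoothAlg n V)} (m : F.IsModel G)
include m

theorem P : Rep ((1 / (2 * ((n : ℂ) + 1))) • G.scal) F.P :=
  (m.scal.smul _).congr fun _ hy => (F.P_eq m.isOpen (m.subset hy)).symm

variable {x : M} (hx : x ∈ V)
include hx

theorem grad_P (α : Fin n) : F.grad F.P α x = 1 / (2 * ((n : ℂ) + 1)) * F.grad F.R α x := by
  have h := m.Z m.P α
  rw [Derivation.map_smul] at h
  exact h.eq ((m.Z m.scal α).smul _) hx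

theorem sublaplacian_P :
    F.sublaplacian F.P x = 1 / (2 * ((n : ℂ) + 1)) * F.sublaplacian F.R x := by
  have h := m.lap m.P
  rw [FrameAlgebra.lap_smul] at h
  exact h.eq ((m.lap m.scal).smul _) hx

variable {u : M → ℂ}

theorem div_P_grad {a : SmoothAlg n V} (hu : Rep a u) :
    F.div (fun α y => F.P y * F.grad u α y) x =
      1 / (2 * ((n : ℂ) + 1)) * F.div (fun α y => F.R y * F.grad u α y) x := by
  have h := m.div fun α => m.P.mul (m.Z hu α)
  simp only [smul_mul_assoc, FrameAlgebra.div_smul] at h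
  exact h.eq ((m.div fun α => m.scal.mul (m.Z hu α)).smul _) hx

variable {v : SmoothAlg n V} (hv : ∀ α, G.Zb α v = 0) (hu : Rep (v + star v) u)
include hv hu

theorem sublaplacian_sublaplacian_of_pluriharmonic :
    F.sublaplacian (F.sublaplacian u) x + (n : ℂ) ^ 2 * F.nabla0 (F.nabla0 u) x =
      4 * n * (F.torsionDiv u x).im := by
  have h := congrArg (SmoothAlg.eval ⟨x, hx⟩) (G.lap_lap_of_pluriharmonic hv)
  obtain ⟨w, hw⟩ : ∃ w, w = v + star v := ⟨_, rfl⟩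
  rw [← hw] at h hu
  have h1 : SmoothAlg.eval ⟨x, hx⟩ (G.lap (G.lap w)) = _ := m.lap (m.lap hu) ⟨x, hx⟩
  have h2 : SmoothAlg.eval ⟨x, hx⟩ (G.T (G.T w)) = _ := m.T (m.T hu) ⟨x, hx⟩
  have h3 : SmoothAlg.eval ⟨x, hx⟩ (G.torsionDiv w) = _ := m.torsionDiv hu ⟨x, hx⟩
  have h4 : SmoothAlg.eval ⟨x, hx⟩ (star (G.torsionDiv w)) = _ :=
    (m.torsionDiv hu).star ⟨x, hx⟩
  have h5 : SmoothAlg.eval ⟨x, hx⟩ (FrameAlgebra.iu (SmoothAlg n V)) = Complex.I := rfl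
  simp only [map_add, map_mul, map_sub, map_pow, map_natCast, map_ofNat] at h
  rw [h1, h2, h3, h4, h5] at h
  have h6 : F.torsionDiv u x = (F.torsionDiv u x).re + (F.torsionDiv u x).im * Complex.I :=
    (Complex.re_add_im _).symm
  have h7 : starRingEnd ℂ (F.torsionDiv u x) =
      (F.torsionDiv u x).re - (F.torsionDiv u x).im * Complex.I := by
    apply Complex.ext <;> simp
  simp only [h7] at h
  -- Here `2 i n (z̄ - z) = 4 n Im z` with `z` the torsion divergence.
  linear_combination h - 2 * Complex.I * n * h6 -
    4 * n * (F.torsionDiv u x).im * Complex.I_mul_I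

theorem schoutenDiv_of_pluriharmonic (hn : n ≠ 0) :
    (F.schoutenDiv u x).re = 2 * ((n : ℝ) - 1) * (n + 1) / (n * (n + 2)) *
      (∑ α, (F.grad F.P α x - Complex.I * n / (2 * ((n : ℂ) + 1)) * F.divA α x) *
        F.gradUp u α x).re := by
  have h := G.div_ric0_grad_of_pluriharmonic hn hv
  have h1 := m.schoutenDiv hn hu
  simp only [smul_mul_assoc, ← Finset.smul_sum, FrameAlgebra.div_smul] at h1
  have h2 := (rep_natCast n).mul h1
  rw [mul_smul_comm, h] at h2
  have h3 := (((rep_natCast n).sub rep_one).mul (Rep.sum Finset.univ fun γ =>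
    ((m.Z m.scal γ).sub (((rep_algebraMap Complex.I).mul (rep_natCast n)).mul (m.divTor γ))).mul
      (m.gradUp hu γ)).star).smul (1 / ((n : ℂ) + 2))
  have h4 := h2.eq h3 hx
  have hn0 : (n : ℂ) ≠ 0 := by exact_mod_cast hn
  have hn1 : (n : ℂ) + 1 ≠ 0 := by exact_mod_cast Nat.succ_ne_zero n
  have hn2 : (n : ℂ) + 2 ≠ 0 := by exact_mod_cast Nat.succ_ne_zero (n + 1)
  have h5 : ∑ γ, (F.grad F.R γ x - Complex.I * n * F.divA γ x) * F.gradUp u γ x =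
      2 * ((n : ℂ) + 1) * ∑ α, (F.grad F.P α x - Complex.I * n / (2 * ((n : ℂ) + 1)) *
        F.divA α x) * F.gradUp u α x := by
    rw [Finset.mul_sum]
    refine Finset.sum_congr rfl fun γ _ => ?_
    rw [m.grad_P hx]
    field_simp
  rw [h5] at h4
  -- The prefactor is real, so the conjugation inherited from the algebraic identity disappears on
  -- taking real parts.
  have h6 : F.schoutenDiv u x = ((2 * ((n : ℝ) - 1) * (n + 1) / (n * (n + 2)) : ℝ) : ℂ) *
      starRingEnd ℂ (∑ α, (F.grad F.P α x - Complex.I * n / (2 * ((n : ℂ) + 1)) * F.divA α x) *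
        F.gradUp u α x) := by
    apply mul_left_cancel₀ hn0
    rw [h4, map_mul]
    simp only [map_mul, map_add, map_natCast, map_one, Complex.conj_ofNat]
    push_cast
    field_simp
  rw [h6, Complex.re_ofReal_mul, Complex.conj_re]

/-- The `P'`-operator in higher dimensions. -/
theorem paneitz_of_pluriharmonic (hn : 2 ≤ n) :
    2 / ((n : ℂ) - 1) * F.paneitz u x = F.pPrime n u x := by
  have hn' : n ≠ 0 := by omega
  have h1 := m.sublaplacian_sublaplacian_of_pluriharmonic hx hv hu
  have h2 := m.schoutenDiv_of_pluriharmonic hx hv hu hn'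
  have hn0 : (n : ℂ) ≠ 0 := by exact_mod_cast hn'
  have hn1 : (n : ℂ) - 1 ≠ 0 := by
    rw [sub_ne_zero]; exact_mod_cast (by omega : n ≠ 1)
  have hn2 : (n : ℂ) + 2 ≠ 0 := by exact_mod_cast Nat.succ_ne_zero (n + 1)
  -- `T² u` is the term of the Paneitz operator absent from `pPrime`; once it is replaced,
  -- everything is divisible by `n - 1`.
  have hT : F.nabla0 (F.nabla0 u) x = (4 * n * (F.torsionDiv u x).im -
      F.sublaplacian (F.sublaplacian u) x) / (n : ℂ) ^ 2 := by
    rw [eq_div_iff (pow_ne_zero 2 hn0)]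
    linear_combination h1
  have hQ : F.pPrime n u x = 2 * ((n : ℂ) + 1) / n ^ 2 * F.sublaplacian (F.sublaplacian u) x -
      8 / (n : ℂ) * (F.torsionDiv u x).im -
      8 * ((n : ℂ) + 1) / n * (F.div (fun α y => F.P y * F.grad u α y) x).re +
      16 * ((n : ℂ) + 1) / (n * (n + 2)) * (∑ α, (F.grad F.P α x - Complex.I * n /
        (2 * ((n : ℂ) + 1)) * F.divA α x) * F.gradUp u α x).re + F.Q4 x * u x := by
    simp only [pPrime, Q4, Complex.ofReal_natCast]
  rw [hQ, paneitz, hT, h2]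
  push_cast
  generalize F.Q4 x = q, (F.torsionDiv u x).im = t, F.sublaplacian (F.sublaplacian u) x = l,
    (F.div (fun α y => F.P y * F.grad u α y) x).re = d,
    (∑ α, (F.grad F.P α x - Complex.I * n / (2 * ((n : ℂ) + 1)) * F.divA α x) *
      F.gradUp u α x).re = s
  field_simp
  ring

end IsModel

/-- The explicit expression is a combination of the operators `PPrimeTerm.eval`. -/
theorem pPrime_eq_sum {ν : ℝ} (hν : 0 < ν) (u : M → ℂ) (x : M) :
    F.pPrime ν u x = ∑ t : PPrimeTerm, (PPrimeTerm.coeff ν t : ℂ) * PPrimeTerm.eval F u x t := by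
  have hsum : ∀ g : PPrimeTerm → ℂ, ∑ t, g t = g .sublaplacianSq + g .imTorsionDiv +
      g .reDivPGrad + g .reGradPGrad + g .reIDivAGrad + g .sublaplacianP + g .imDivDivA +
      g .normSqA + g .normSqSchouten0 + g .PSq := by
    intro g
    have : (Finset.univ : Finset PPrimeTerm) = {.sublaplacianSq, .imTorsionDiv, .reDivPGrad,
      .reGradPGrad, .reIDivAGrad, .sublaplacianP, .imDivDivA, .normSqA, .normSqSchouten0,
      .PSq} := rfl
    rw [this]
    simp
    ring
  have hre : (∑ α, (F.grad F.P α x - Complex.I * ν / (2 * ((ν : ℂ) + 1)) * F.divA α x) *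
      F.gradUp u α x).re = (∑ α, F.grad F.P α x * F.gradUp u α x).re -
        ν / (2 * (ν + 1)) * (∑ α, Complex.I * F.divA α x * F.gradUp u α x).re := by
    rw [← Complex.re_ofReal_mul, ← Complex.sub_re, Finset.mul_sum, ← Finset.sum_sub_distrib]
    congr 1
    refine Finset.sum_congr rfl fun α _ => ?_
    push_cast
    ring
  have h0 : (ν : ℂ) ≠ 0 := by exact_mod_cast hν.ne'
  have h1 : (ν : ℂ) + 1 ≠ 0 := by exact_mod_cast (by positivity : ν + 1 ≠ 0)
  have h2 : (ν : ℂ) + 2 ≠ 0 := by exact_mod_cast (by positivity : ν + 2 ≠ 0)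
  rw [hsum, pPrime, hre]
  simp only [PPrimeTerm.coeff, PPrimeTerm.eval]
  push_cast
  field_simp
  ring

/-- With a single index every tensor of this type is a multiple of `h`, so its tracefree part is
zero. -/
theorem normSqSchouten0_eq_zero (hU : IsOpen U) (hn : n = 1) {x : M} (hx : x ∈ U) :
    F.normSqSchouten0 x = 0 := by
  have h0 : ∀ α β, F.schouten0 α β x = 0 := by
    subst hn
    intro α β
    have h1 := F.sum_hInv_mul_h_self hU hx
    rw [F.schouten0_eq hU one_ne_zero hx, R, trace]
    obtain rfl := Subsingleton.elim α 0
    obtain rfl := Subsingleton.elim β 0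
    simp only [Finset.univ_unique, Fin.default_eq_zero, Finset.sum_singleton, Nat.cast_one] at h1 ⊢
    linear_combination -(1 / ((1 : ℂ) + 2) * F.ricci 0 0 x) * h1
  simp [normSqSchouten0, h0]

/-- For `n = 1` one has `P = R/4`, and at `ν = 1` the factor `iν/(2(ν+1))` is `i/4`, so the
first-order term assembles into `W/4`. The terms in `|A|²` and `P²` carry the factor `ν - 1`. -/
theorem IsModel.pPrime_one {V : Set M} {G : FrameAlgebra n (SmoothAlg n V)} (m : F.IsModel G)
    (hn : n = 1) {x : M} (hx : x ∈ V) {u : M → ℂ} {a : SmoothAlg n V} (hu : Rep a u) :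
    F.pPrime 1 u x = F.criticalPPrime u x := by
  have hc : 1 / (2 * ((n : ℂ) + 1)) = ((1 / 4 : ℝ) : ℂ) := by rw [hn]; norm_num
  have hs : (∑ α, (F.grad F.P α x - Complex.I * (1 : ℝ) / (2 * (((1 : ℝ) : ℂ) + 1)) * F.divA α x) *
      F.gradUp u α x).re = 1 / 4 * (∑ α, F.W α x * F.gradUp u α x).re := by
    rw [← Complex.re_ofReal_mul, Finset.mul_sum]
    congr 1
    refine Finset.sum_congr rfl fun α _ => ?_
    rw [m.grad_P hx, hc, W]
    push_cast
    ring
  rw [pPrime, criticalPPrime, hs, m.div_P_grad hx hu, m.sublaplacian_P hx, hc,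
    Complex.re_ofReal_mul, F.normSqSchouten0_eq_zero m.isOpen hn (m.subset hx)]
  push_cast
  ring

end PseudohermitianStructure.AdmissibleFrame

theorem PPrimeTerm.isRationalRegularAt (t : PPrimeTerm) :
    IsRationalRegularAt (fun ν => PPrimeTerm.coeff ν t) 1 := by
  open Polynomial in
  cases t
  · exact ⟨2 * (X + 1), X ^ 2, by simp, fun ν _ => by simp [coeff]⟩
  · exact ⟨-8, X, by simp, fun ν _ => by simp [coeff, neg_div]⟩
  · exact ⟨-(8 * (X + 1)), X, by simp, fun ν _ => by simp [coeff, neg_div]⟩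
  · exact ⟨16 * (X + 1), X * (X + 2), by norm_num, fun ν _ => by simp [coeff]⟩
  · exact ⟨-8, X + 2, by norm_num, fun ν _ => by simp [coeff, neg_div]⟩
  · exact ⟨2 * (X + 1) ^ 2, X * (X + 2), by norm_num, fun ν _ => by simp [coeff]⟩
  · exact ⟨-4, X * (X + 2), by norm_num, fun ν _ => by simp [coeff, neg_div]⟩
  · exact ⟨-(2 * (X - 1)), X, by simp, fun ν _ => by simp [coeff, neg_div]⟩
  · exact ⟨-(2 * (X + 1)), X, by simp, fun ν _ => by simp [coeff, neg_div]⟩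
  · exact ⟨2 * (X - 1) * (X + 1) ^ 2, X ^ 2, by simp, fun ν _ => by simp [coeff]⟩

/-- The denominator is nonzero near `a`, and there `c` coincides with the quotient of polynomials.
-/
theorem IsRationalRegularAt.continuousAt {c : ℝ → ℝ} {a : ℝ} (h : IsRationalRegularAt c a) :
    ContinuousAt c a := by
  obtain ⟨p, q, hq, hc⟩ := h
  have h1 : ContinuousAt (fun ν => p.eval ν / q.eval ν) a :=
    p.continuous.continuousAt.div q.continuous.continuousAt hq
  refine h1.congr ?_
  filter_upwards [q.continuous.continuousAt.eventually_ne hq] with ν hν using (hc ν hν).symm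

end CRGeom

end

theorem mainTheorem5 {n : ℕ} (hn : 1 ≤ n) {M : Type*} [TopologicalSpace M]
    [ChartedSpace (EuclideanSpace ℝ (Fin (2 * n + 1))) M]
    [IsManifold (𝓡 (2 * n + 1)) ∞ M]
    (S : CRGeom.PseudohermitianStructure n M) {U : Set M} (hU : IsOpen U)
    (F : S.AdmissibleFrame U) (f : M → ℝ) (hf : S.IsPluriharmonic f) :
    (2 ≤ n → ∀ x ∈ U,
      2 / ((n : ℂ) - 1) * F.paneitz (fun y => (f y : ℂ)) x =
        F.pPrime (n : ℝ) (fun y => (f y : ℂ)) x) ∧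
    (∀ t : CRGeom.PPrimeTerm,
      CRGeom.IsRationalRegularAt (fun ν => CRGeom.PPrimeTerm.coeff ν t) 1) ∧
    (∀ x ∈ U, ∀ ν : ℝ, 0 < ν →
      F.pPrime ν (fun y => (f y : ℂ)) x =
        ∑ t : CRGeom.PPrimeTerm,
          (CRGeom.PPrimeTerm.coeff ν t : ℂ) *
            CRGeom.PPrimeTerm.eval F (fun y => (f y : ℂ)) x t) ∧
    (n = 1 → ∀ x ∈ U,
      Filter.Tendsto (fun ν : ℝ => F.pPrime ν (fun y => (f y : ℂ)) x) (𝓝[≠] 1)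
        (𝓝 (F.criticalPPrime (fun y => (f y : ℂ)) x))) := by
  refine ⟨fun h2 x hx => ?_, CRGeom.PPrimeTerm.isRationalRegularAt,
    fun x _ ν hν => F.pPrime_eq_sum hν _ x, fun h1 x hx => ?_⟩
  · obtain ⟨V, G, v, hxV, m, hv, hu⟩ := F.exists_isModel hU hf hx
    exact m.paneitz_of_pluriharmonic hxV hv hu h2
  · obtain ⟨V, G, v, hxV, m, hv, hu⟩ := F.exists_isModel hU hf hx
    -- The limit is recognized as the value at `ν = 1`, so only continuity of finitely many
    -- coefficients remains.
    rw [← m.pPrime_one F h1 hxV hu, F.pPrime_eq_sum one_pos]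
    have hlim : Filter.Tendsto (fun ν : ℝ => ∑ t : CRGeom.PPrimeTerm,
        (CRGeom.PPrimeTerm.coeff ν t : ℂ) *
          CRGeom.PPrimeTerm.eval F (fun y => (f y : ℂ)) x t) (𝓝 1) (𝓝 (∑ t : CRGeom.PPrimeTerm,
        (CRGeom.PPrimeTerm.coeff 1 t : ℂ) *
          CRGeom.PPrimeTerm.eval F (fun y => (f y : ℂ)) x t)) :=
      tendsto_finsetSum _ fun t _ => ((Complex.continuous_ofReal.tendsto _).comp
        (CRGeom.PPrimeTerm.isRationalRegularAt t).continuousAt).mul_const _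
    refine (hlim.congr' ?_).mono_left nhdsWithin_le_nhds
    -- The expansion into terms requires `ν > 0`, which holds near `1`.
    filter_upwards [lt_mem_nhds one_pos] with ν hν using (F.pPrime_eq_sum hν _ x).symm
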